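/- Let $0\le\tau<\alpha\le 1$, $\beta\ge 0$, $c>0$, $\eta>0$, and let $H$ be a probability distribution on a Polish space $\Theta$. Put $$\rho_{\mathrm{mSt}}(w)=\frac1{\alpha-\tau}\int_\tau^\alpha \frac{s}{\Gamma(1-s)}w^{-1-s}\,ds,\qquad \rho_{\mathrm{mGG}}(w)=\frac{\eta}{c}\,\rho_{\mathrm{mSt}}\!\left(\frac wc\right)e^{-\beta w/c}\qquad(w>0),$$ $$\psi_{\mathrm{mSt}}(t)=\frac1{\alpha-\tau}\int_\tau^\alpha t^{s}\,ds\qquad(t\ge 0),$$ and let $\psi_{\mathrm{mSt}}^{-1}$ be the inverse of the increasing bijection $\psi_{\mathrm{mSt}}:[0,\infty)\to[0,\infty)$. For a density $\rho\ge 0$ on $(0,\infty)$ with $\int_0^\infty(1-e^{-w})\rho(w)\,dw<\infty$ (a Lévy intensity), a completely random measure $G\sim\mathrm{CRM}(\rho,H)$ is a random measure $G=\sum_j W_j\delta_{\theta_j}$ on $\Theta$ whose points $(W_j,\theta_j)$ form a Poisson point process on $(0,\infty)\times\Theta$ with mean measure $\rho(w)\,dw\,H(d\theta)$. Let $\xi_1,\xi_2,\dots$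 be the ordered points of a unit-rate Poisson process on $(0,\infty)$, that is, $\xi_1,\ \xi_2-\xi_1,\ \xi_3-\xi_2,\dots$ are iid unit-rate exponential random variables, and for $j\ge1$ let $$T_j=\psi_{\mathrm{mSt}}^{-1}\!\left(\frac{\xi_j}{\eta}+\psi_{\mathrm{mSt}}(\beta)\right)-\beta .$$ Conditionally on $(\xi_j)_{j\ge1}$, let the pairs $(S_j,W_j')$, $j\ge 1$, be independent, with $$S_j\mid\{T_j=t\}\sim p(s\mid t)\propto s(t+\beta)^s\,\mathbf 1\{s\in(\tau,\alpha)\},\qquad W_j'\mid\{T_j=t,S_j=s\}\sim\mathrm{Gamma}(1-s,\,t+\beta)$$ (shape $1-s$, rate $t+\beta$), and let $\theta_1,\theta_2,\dots$ be iid with law $H$, independent of all the other variables. Set $W_j=cW_j'$. Then $\rho_{\mathrm{mGG}}$ is a Lévy intensity, the points $(W_j,\theta_j)_{j\ge1}$ form a Poisson point process with mean measure $\rho_{\mathrm{mGG}}(w)\,dw\,H(d\theta)$, so that $G=\sum_{j\ge1}W_j\delta_{\theta_j}\sim\mathrm{CRM}(\rho_{\mathrm{mGG}},H)$, and its atoms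 are listed in size-biased order: almost surely all $W_j>0$ and $\sum_jW_j<\infty$, and for every $n\ge0$, conditionally on the unordered configuration $\sum_j\delta_{(W_j,\theta_j)}$ and on $(W_1,\theta_1),\dots,(W_n,\theta_n)$, the next atom $(W_{n+1},\theta_{n+1})$ equals $(W_k,\theta_k)$, $k>n$, with probability $W_k/\sum_{l>n}W_l$; that is, its conditional law is $\sum_{k>n}W_k\,\delta_{(W_k,\theta_k)}\big/\sum_{l>n}W_l$. -/

import Mathlib

open MeasureTheory ProbabilityTheory
open scoped ENNReal

namespace MixedGG

noncomputable section

/-! ### Poisson random measures and completely random measures -/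

/-- `N` is a Poisson random measure on `E` with intensity (mean measure) `μ`: the number of
points in a set of finite intensity is Poisson distributed, a set of infinite intensity contains
infinitely many points, and the counts of pairwise disjoint sets are independent. -/
structure IsPoissonRandomMeasure {Ω E : Type*} [MeasurableSpace Ω] [MeasurableSpace E]
    (P : Measure Ω) (N : Ω → Measure E) (μ : Measure E) : Prop where
  measurable : Measurable N
  hasLaw_apply : ∀ B : Set E, MeasurableSet B → μ B ≠ ∞ →
    HasLaw (fun ω => N ω B)
      ((poissonMeasure (μ B).toNNReal).map (fun k : ℕ => (k : ℝ≥0∞))) P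
  apply_eq_top : ∀ B : Set E, MeasurableSet B → μ B = ∞ → ∀ᵐ ω ∂P, N ω B = ∞
  iIndepFun_apply : ∀ (n : ℕ) (B : Fin n → Set E), (∀ i, MeasurableSet (B i)) →
    (Pairwise fun i j => Disjoint (B i) (B j)) → iIndepFun (fun i ω => N ω (B i)) P

/-- `ρ` is the density of a Lévy measure on `(0, ∞)`:
`ρ ≥ 0` and `∫₀^∞ (1 - e^{-w}) ρ(w) dw < ∞`. -/
structure IsLevyIntensity (ρ : ℝ → ℝ) : Prop where
  measurable : Measurable ρ
  nonneg : ∀ w : ℝ, 0 < w → 0 ≤ ρ w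
  lintegral_lt_top :
    ∫⁻ w in Set.Ioi (0 : ℝ), ENNReal.ofReal ((1 - Real.exp (-w)) * ρ w) < ∞

/-- The measure `ρ(w) dw` on `(0, ∞)`, as a measure on `ℝ`. -/
def levyMeasure (ρ : ℝ → ℝ) : Measure ℝ :=
  (volume.restrict (Set.Ioi (0 : ℝ))).withDensity fun w => ENNReal.ofReal (ρ w)

/-- `G ∼ CRM(ρ, H)`: the random measure `G` is almost surely of the form
`G(dθ) = ∫ w N(dw, dθ)`, where `N` is a Poisson random measure with intensity
`ρ(w) dw H(dθ)`, so `G = ∑ w δ_θ`, summed over the points `(w, θ)` of `N`. -/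
def IsCRM {Ω Θ : Type*} [MeasurableSpace Ω] [MeasurableSpace Θ]
    (P : Measure Ω) (ρ : ℝ → ℝ) (H : Measure Θ) (G : Ω → Measure Θ) : Prop :=
  IsLevyIntensity ρ ∧
  ∃ N : Ω → Measure (ℝ × Θ),
    IsPoissonRandomMeasure P N ((levyMeasure ρ).prod H) ∧
    ∀ᵐ ω ∂P, G ω = ((N ω).withDensity fun x => ENNReal.ofReal x.1).map Prod.snd

/-! ### Conditional laws and size-biased order -/

/-- The random variable `Y` has (regular) conditional law `ω ↦ κ ω` given the σ-algebra `m`: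
for every measurable set `B`, almost surely `P(Y ∈ B | m) = κ(B)`. -/
def HasConditionalLaw {Ω E : Type*} [MeasurableSpace Ω] [MeasurableSpace E]
    (P : Measure Ω) (Y : Ω → E) (m : MeasurableSpace Ω) (κ : Ω → Measure E) : Prop :=
  ∀ B : Set E, MeasurableSet B →
    P[(Y ⁻¹' B).indicator (fun _ => (1 : ℝ)) | m] =ᵐ[P] fun ω => (κ ω).real B

/-- The point configuration `∑_j δ_{(W_j, θ_j)}`, which forgets the order of the atoms. -/
def pointMeasure {Ω Θ : Type*} [MeasurableSpace Θ]
    (W : ℕ → Ω → ℝ) (θ : ℕ → Ω → Θ) (ω : Ω) : Measure (ℝ × Θ) :=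
  Measure.sum fun j => Measure.dirac (W j ω, θ j ω)

/-- The discrete random measure `∑_j W_j δ_{θ_j}`. -/
def discreteMeasure {Ω Θ : Type*} [MeasurableSpace Θ]
    (W : ℕ → Ω → ℝ) (θ : ℕ → Ω → Θ) (ω : Ω) : Measure Θ :=
  Measure.sum fun j => ENNReal.ofReal (W j ω) • Measure.dirac (θ j ω)

/-- The law of a size-biased pick among the atoms of index at least `n`: atom `k ≥ n` is chosen
with probability `W_k / ∑_{l ≥ n} W_l`. -/
def sizeBiasedPick {Ω Θ : Type*} [MeasurableSpace Θ]
    (W : ℕ → Ω → ℝ) (θ : ℕ → Ω → Θ) (n : ℕ) (ω : Ω) : Measure (ℝ × Θ) :=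
  (∑' k, ENNReal.ofReal (W (n + k) ω))⁻¹ •
    Measure.sum fun k =>
      ENNReal.ofReal (W (n + k) ω) • Measure.dirac (W (n + k) ω, θ (n + k) ω)

/-- The atoms `(W_j, θ_j)` come in size-biased order: the weights are positive and have a finite
sum, and, given the whole (unordered) configuration of the atoms and the first `n` atoms of the
sequence, the next one is drawn from the remaining ones with probabilities proportional to their
weights. -/
structure IsSizeBiasedOrder {Ω Θ : Type*} [MeasurableSpace Ω] [MeasurableSpace Θ]
    (P : Measure Ω) (W : ℕ → Ω → ℝ) (θ : ℕ → Ω → Θ) : Prop where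
  measurable_weight : ∀ j, Measurable (W j)
  measurable_location : ∀ j, Measurable (θ j)
  pos : ∀ᵐ ω ∂P, ∀ j, 0 < W j ω
  sum_lt_top : ∀ᵐ ω ∂P, ∑' j, ENNReal.ofReal (W j ω) < ∞
  hasConditionalLaw : ∀ n : ℕ,
    HasConditionalLaw P (fun ω => (W n ω, θ n ω))
      (MeasurableSpace.comap
        (fun ω => (pointMeasure W θ ω, fun i : Fin n => (W i ω, θ i ω))) inferInstance)
      (sizeBiasedPick W θ n)

/-! ### The mixed stable and mixed generalized gamma models -/

/-- Lévy intensity of the stable model: `s w^{-1-s} / Γ(1-s)`. -/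
def rhoSt (w s : ℝ) : ℝ := s / Real.Gamma (1 - s) * w ^ (-1 - s)

/-- Lévy intensity of the mixed stable model. -/
def rhoMSt (w α τ : ℝ) : ℝ := (α - τ)⁻¹ * ∫ s in τ..α, rhoSt w s

/-- Laplace exponent of the stable model. -/
def psiSt (t s : ℝ) : ℝ := t ^ s

/-- Laplace exponent of the mixed stable model. -/
def psiMSt (t α τ : ℝ) : ℝ := (α - τ)⁻¹ * ∫ s in τ..α, psiSt t s

/-- The inverse of the increasing bijection `t ↦ psiMSt t α τ` of `[0, ∞)`. -/
def psiMStInv (y α τ : ℝ) : ℝ :=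
  Function.invFunOn (fun t => psiMSt t α τ) (Set.Ici 0) y

/-- Lévy intensity of the mixed generalized gamma model. -/
def rhoMGG (α τ β c η w : ℝ) : ℝ :=
  η / c * rhoMSt (w / c) α τ * Real.exp (-β * w / c)

/-- The law `p(s | t) ds`, where `p(s | t)` is proportional to `s (t + β)^s` on `(τ, α)`. -/
def indexLaw (α τ β t : ℝ) : Measure ℝ :=
  (volume.restrict (Set.Ioo τ α)).withDensity fun s =>
    ENNReal.ofReal (s * (t + β) ^ s / ∫ r in τ..α, r * (t + β) ^ r)

/-- The times `T_j = ψ⁻¹(ξ_j / η + ψ(β)) - β`. -/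
def arrivalTime {Ω : Type*} (α τ β η : ℝ) (ξ : ℕ → Ω → ℝ) (j : ℕ) (ω : Ω) : ℝ :=
  psiMStInv (ξ j ω / η + psiMSt β α τ) α τ - β

/-- `ξ 0, ξ 1, …` are the ordered points of a unit-rate Poisson process on `(0, ∞)`: the first
point and the successive gaps are iid unit-rate exponential random variables. -/
structure IsUnitRatePoissonPoints {Ω : Type*} [MeasurableSpace Ω]
    (P : Measure Ω) (ξ : ℕ → Ω → ℝ) : Prop where
  measurable : ∀ j, Measurable (ξ j)
  iIndepFun_gap : iIndepFun (fun j ω => ξ j ω - if j = 0 then 0 else ξ (j - 1) ω) P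
  hasLaw_gap : ∀ j, HasLaw (fun ω => ξ j ω - if j = 0 then 0 else ξ (j - 1) ω) (expMeasure 1) P

/-- The sampling scheme. Given all the points `ξ` (hence all the `T_j`), the pairs `(S_j, W'_j)`
are drawn independently of one another, `S_j` from `p(s | T_j)` and then `W'_j` from the Gamma
distribution with shape `1 - S_j` and rate `T_j + β`; the locations `θ_j` are iid with law `H`,
independent of everything else. -/
structure IsSamplingScheme {Ω Θ : Type*} [MeasurableSpace Ω] [MeasurableSpace Θ]
    (P : Measure Ω) (α τ β η : ℝ) (H : Measure Θ)
    (ξ S W' : ℕ → Ω → ℝ) (θ : ℕ → Ω → Θ) : Prop where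
  poissonPoints : IsUnitRatePoissonPoints P ξ
  measurable_index : ∀ j, Measurable (S j)
  measurable_weight : ∀ j, Measurable (W' j)
  measurable_location : ∀ j, Measurable (θ j)
  condLaw_index : ∀ j : ℕ,
    HasConditionalLaw P (S j)
      (MeasurableSpace.comap
        (fun ω => (fun i : ℕ => ξ i ω, fun i : Fin j => (S i ω, W' i ω))) inferInstance)
      (fun ω => indexLaw α τ β (arrivalTime α τ β η ξ j ω))
  condLaw_weight : ∀ j : ℕ,
    HasConditionalLaw P (W' j)
      (MeasurableSpace.comap
        (fun ω => (fun i : ℕ => ξ i ω, fun i : Fin j => (S i ω, W' i ω), S j ω)) inferInstance)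
      (fun ω => gammaMeasure (1 - S j ω) (arrivalTime α τ β η ξ j ω + β))
  hasLaw_location : ∀ j, HasLaw (θ j) H P
  iIndepFun_location : iIndepFun θ P
  indepFun_location :
    IndepFun (fun ω (j : ℕ) => θ j ω) (fun ω (j : ℕ) => (ξ j ω, S j ω, W' j ω)) P

end

end MixedGG

/-! Give each atom of weight `w` of a Poisson random measure with intensity `μ` an independent
exponential alarm of rate `w`. The atoms then ring in size-biased order, and the pairs (ringing
time, atom) form a Poisson process with intensity `w e^{-uw} du μ(dx)`. With `Λ(t) = ∫ (1 - e^{-tw})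
dμ` (`lapExp`), the ringing times have rate `Λ'(u)`, so `Λ` maps them to a unit-rate Poisson
process, and the atom that rings at time `u` has law proportional to `w e^{-uw} μ`. For `μ =
ρ_mGG(w) dw ⊗ H` one finds `Λ(t) = η (ψ(ct + β) - ψ(β))`, hence `T_j / c = Λ⁻¹(ξ_j)`, and the tilted
law of the weight is a mixture over `s` of `Gamma(1 - s, cu + β)`, scaled by `c`. This is the
sampling scheme.

The proof runs in the opposite direction: it starts from the sequence and constructs no alarms.
`IsSizeBiasedChain` records the one-step law of times and marks. Let `L_f(t)` (`lapFactor`) be the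
Laplace functional of a Poisson measure with intensity `e^{-tw} μ`, the law of the atoms still
silent at time `t`. By the fundamental theorem of calculus (`lintegral_clockDensity`), `e^{-∑_{j<n}
f(X_j)} L_f(T_n)` is a martingale; since `T_n → ∞`, the future marks have Laplace functional
`L_f(T_n)` given the past (`lintegral_expNeg_tsum`). From `n = 0` comes the Poisson law.

For the order, let `Z` be the total weight of the future marks and write `1/Z = ∫₀^∞ e^{-rZ} dr`. A
Mecke equation (`lintegral_mecke`) evaluates the integrand, and the substitution `u = t + r` turns
the result into one step of the chain (`lintegral_mecke_eq_clockDensity`). So the next mark and a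
size-biased pick agree when tested against past events and all `e^{-∑ f(X_j)}`. Such functionals
determine laws (`ext_prod_of_lintegral_expNeg_lintegral`), which gives the conditional law.

It remains to recognise the sampling scheme as such a chain: `rate_mul_pairIntegral` identifies the
kernel, and `indepFun_past_gap` supplies the Markov property, which needs an argument because the
scheme conditions on all the points `ξ`, future ones included. -/

namespace MixedGG

open Filter Topology

/-! ### The decreasing exponential on `[0, ∞]` -/

/-- The function `x ↦ e^{-x}` on `[0, ∞]`. -/
noncomputable def expNeg (x : ℝ≥0∞) : ℝ≥0∞ := EReal.exp (-(x : EReal))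

@[simp] lemma expNeg_zero : expNeg 0 = 1 := by simp [expNeg]

@[simp] lemma expNeg_top : expNeg ∞ = 0 := by simp [expNeg]

lemma expNeg_add (x y : ℝ≥0∞) : expNeg (x + y) = expNeg x * expNeg y := by
  rw [expNeg, expNeg, expNeg, ← EReal.exp_add, EReal.coe_ennreal_add, EReal.neg_add]
  · rfl
  · exact Or.inl (EReal.coe_ennreal_ne_bot x)
  · exact Or.inr (EReal.coe_ennreal_ne_bot y)

lemma expNeg_antitone : Antitone expNeg := fun x y h => by
  unfold expNeg
  exact EReal.exp_monotone (EReal.neg_le_neg_iff.2 (EReal.coe_ennreal_le_coe_ennreal_iff.2 h))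

lemma expNeg_le_one (x : ℝ≥0∞) : expNeg x ≤ 1 := by
  simpa using expNeg_antitone (zero_le (a := x))

lemma expNeg_ne_top (x : ℝ≥0∞) : expNeg x ≠ ∞ :=
  ((expNeg_le_one x).trans_lt ENNReal.one_lt_top).ne

lemma continuous_expNeg : Continuous expNeg :=
  ENNReal.continuous_exp.comp (continuous_neg.comp continuous_coe_ennreal_ereal)

@[fun_prop]
lemma measurable_expNeg : Measurable expNeg := continuous_expNeg.measurable

lemma expNeg_ofReal {r : ℝ} (hr : 0 ≤ r) :
    expNeg (ENNReal.ofReal r) = ENNReal.ofReal (Real.exp (-r)) := by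
  rw [expNeg, EReal.coe_ennreal_ofReal, max_eq_left hr, ← EReal.coe_neg, EReal.exp_coe]

lemma expNeg_eq_zero {x : ℝ≥0∞} : expNeg x = 0 ↔ x = ∞ := by
  simp [expNeg]

lemma expNeg_nsmul (n : ℕ) (x : ℝ≥0∞) : expNeg (n * x) = expNeg x ^ n := by
  induction n with
  | zero => simp
  | succ n ih => rw [Nat.cast_succ, add_mul, one_mul, expNeg_add, ih, pow_succ]

lemma expNeg_sum {ι : Type*} (s : Finset ι) (f : ι → ℝ≥0∞) :
    expNeg (∑ i ∈ s, f i) = ∏ i ∈ s, expNeg (f i) := by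
  classical
  induction s using Finset.induction_on with
  | empty => simp
  | insert a s ha ih => rw [Finset.sum_insert ha, Finset.prod_insert ha, expNeg_add, ih]

lemma expNeg_toReal_mem (x : ℝ≥0∞) : (expNeg x).toReal ∈ Set.Icc (0 : ℝ) 1 :=
  ⟨ENNReal.toReal_nonneg, ENNReal.toReal_le_of_le_ofReal zero_le_one (by simpa using expNeg_le_one x)⟩

/-! ### Uniqueness of Laplace transforms -/

/-- A finite measure on a finite-dimensional cube is determined by its moments. -/
theorem ext_of_lintegral_monomial {ι : Type*} [Fintype ι] {ν₁ ν₂ : Measure (ι → unitInterval)}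
    [IsFiniteMeasure ν₁] [IsFiniteMeasure ν₂]
    (h : ∀ a : ι → ℕ, ∫ x, ∏ i, (x i : ℝ) ^ a i ∂ν₁ = ∫ x, ∏ i, (x i : ℝ) ^ a i ∂ν₂) :
    ν₁ = ν₂ := by
  classical
  let c : ι → BoundedContinuousFunction (ι → unitInterval) ℝ := fun i =>
    BoundedContinuousFunction.mkOfCompact ⟨fun x => (x i : ℝ), by fun_prop⟩
  -- Polynomials in the coordinates separate points, so integrals against them determine a finite
  -- measure; by linearity, monomials are enough.
  let A : StarSubalgebra ℝ (BoundedContinuousFunction (ι → unitInterval) ℝ) :=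
    { Algebra.adjoin ℝ (Set.range c) with
      star_mem' := fun {a} ha => by
        have : star a = a := by ext x; simp
        rw [this]; exact ha }
  have hmon : ∀ g ∈ Submonoid.closure (Set.range c),
      ∃ a : ι → ℕ, ∀ x, g x = ∏ i, (x i : ℝ) ^ a i := by
    intro g hg
    induction hg using Submonoid.closure_induction with
    | mem g hg =>
      obtain ⟨i, rfl⟩ := hg
      refine ⟨Pi.single i 1, fun x => ?_⟩
      rw [Finset.prod_eq_single i]
      · simp [c]
      · intro j _ hj; simp [Pi.single_eq_of_ne hj]
      · simp
    | one => exact ⟨0, fun x => by simp⟩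
    | mul g g' _ _ hg hg' =>
      obtain ⟨a, ha⟩ := hg
      obtain ⟨b, hb⟩ := hg'
      refine ⟨a + b, fun x => ?_⟩
      simp [ha, hb, pow_add, Finset.prod_mul_distrib]
  refine ext_of_forall_mem_subalgebra_integral_eq_of_polish (A := A) ?_ ?_
  · intro x y hxy
    obtain ⟨i, hi⟩ := Function.ne_iff.1 hxy
    refine ⟨fun x => (x i : ℝ), ⟨⟨fun x => (x i : ℝ), by fun_prop⟩, ?_, rfl⟩, ?_⟩
    · exact ⟨c i, Algebra.subset_adjoin ⟨i, rfl⟩, by ext; simp [c]⟩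
    · simpa [Subtype.ext_iff] using hi
  · intro g hg
    have hg' : g ∈ Submodule.span ℝ
        (Submonoid.closure (Set.range c) : Set (BoundedContinuousFunction (ι → unitInterval) ℝ)) := by
      rw [← Algebra.adjoin_eq_span]; exact hg
    induction hg' using Submodule.span_induction with
    | mem g hgm =>
      obtain ⟨a, ha⟩ := hmon g hgm
      simp_rw [ha]; exact h a
    | zero => simp
    | add g g' hgs hgs' ih ih' =>
      have e : ∀ g ∈ Submodule.span ℝ (Submonoid.closure (Set.range c) :
          Set (BoundedContinuousFunction (ι → unitInterval) ℝ)), g ∈ A := fun g hg => by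
        rw [← Algebra.adjoin_eq_span] at hg; exact hg
      simp only [BoundedContinuousFunction.coe_add, Pi.add_apply]
      rw [integral_add (g.integrable _) (g'.integrable _),
        integral_add (g.integrable _) (g'.integrable _), ih (e _ hgs), ih' (e _ hgs')]
    | smul r g hgs ih =>
      have e : g ∈ A := by
        rw [← Algebra.adjoin_eq_span] at hgs; exact hgs
      simp only [BoundedContinuousFunction.coe_smul]
      rw [integral_smul, integral_smul, ih e]

/-- A finite measure on `[0, ∞]^ι` is determined by its Laplace transform. -/
theorem ext_of_lintegral_expNeg {ι : Type*} [Fintype ι] {ν₁ ν₂ : Measure (ι → ℝ≥0∞)}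
    [IsFiniteMeasure ν₁] [IsFiniteMeasure ν₂]
    (h : ∀ a : ι → ℕ, ∫⁻ x, expNeg (∑ i, a i * x i) ∂ν₁ = ∫⁻ x, expNeg (∑ i, a i * x i) ∂ν₂) :
    ν₁ = ν₂ := by
  -- Under `x ↦ e^{-x}` in each coordinate, the Laplace transform at integer points becomes the
  -- family of moments on the cube.
  let Φ : (ι → ℝ≥0∞) → (ι → unitInterval) := fun x i => ⟨(expNeg (x i)).toReal, expNeg_toReal_mem _⟩
  -- `Real.log 0 = 0`, so the value `∞` at `0` has to be set separately.
  let Ψ : (ι → unitInterval) → (ι → ℝ≥0∞) := fun y i =>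
    if (y i : ℝ) = 0 then ∞ else ENNReal.ofReal (-Real.log (y i))
  have hΦ : Measurable Φ := measurable_pi_lambda _ fun i =>
    Measurable.subtype_mk (by fun_prop)
  have hΨ : Measurable Ψ := measurable_pi_lambda _ fun i => by
    refine Measurable.ite ?_ measurable_const (by fun_prop)
    exact (measurableSet_singleton (0 : ℝ)).preimage
      (measurable_subtype_coe.comp (measurable_pi_apply i))
  have hΨΦ : Ψ ∘ Φ = id := by
    ext x i
    by_cases hx : x i = ∞
    · simp [Ψ, Φ, hx]
    · have h1 : x i = ENNReal.ofReal (x i).toReal := (ENNReal.ofReal_toReal hx).symm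
      simp only [Ψ, Φ, Function.comp, id]
      rw [h1, expNeg_ofReal ENNReal.toReal_nonneg, ENNReal.toReal_ofReal (Real.exp_pos _).le]
      simp
  have key : ν₁.map Φ = ν₂.map Φ := by
    refine ext_of_lintegral_monomial fun a => ?_
    have hm : AEStronglyMeasurable (fun x : ι → unitInterval => ∏ i, (x i : ℝ) ^ a i)
        (ν₁.map Φ) := (Continuous.aestronglyMeasurable (by fun_prop))
    have hm' : AEStronglyMeasurable (fun x : ι → unitInterval => ∏ i, (x i : ℝ) ^ a i)
        (ν₂.map Φ) := (Continuous.aestronglyMeasurable (by fun_prop))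
    rw [integral_map hΦ.aemeasurable hm, integral_map hΦ.aemeasurable hm']
    have e : ∀ x : ι → ℝ≥0∞, ∏ i, ((Φ x i : unitInterval) : ℝ) ^ a i
        = (expNeg (∑ i, a i * x i)).toReal := fun x => by
      rw [expNeg_sum, ENNReal.toReal_prod]
      simp [Φ, expNeg_nsmul]
    simp_rw [e]
    have hm₁ : Measurable fun x : ι → ℝ≥0∞ => expNeg (∑ i, a i * x i) := by fun_prop
    rw [integral_toReal hm₁.aemeasurable (ae_of_all _ fun x => (expNeg_ne_top _).lt_top),
      integral_toReal hm₁.aemeasurable (ae_of_all _ fun x => (expNeg_ne_top _).lt_top), h a]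
  have := congrArg (fun ν => Measure.map Ψ ν) key
  simpa [Measure.map_map hΨ hΦ, hΨΦ] using this

/-- A finite measure on the space of measures is determined by its Laplace functional. -/
theorem ext_of_lintegral_expNeg_lintegral {E : Type*} [MeasurableSpace E]
    {ν₁ ν₂ : Measure (Measure E)} [IsFiniteMeasure ν₁] [IsFiniteMeasure ν₂]
    (h : ∀ f : E → ℝ≥0∞, Measurable f →
      ∫⁻ m, expNeg (∫⁻ x, f x ∂m) ∂ν₁ = ∫⁻ m, expNeg (∫⁻ x, f x ∂m) ∂ν₂) :
    ν₁ = ν₂ := by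
  classical
  let ev : Measure E → ({B : Set E // MeasurableSet B} → ℝ≥0∞) := fun m B => m B
  have hev : Measurable ev := measurable_pi_lambda _ fun B => Measure.measurable_coe B.2
  -- A measure is seen as the vector of its values on all measurable sets. Finite-dimensional
  -- marginals suffice, and their Laplace transforms are the given functionals at `f = ∑ a_B 1_B`.
  have key : ν₁.map ev = ν₂.map ev := by
    refine IsProjectiveLimit.unique (P := fun J => (ν₂.map ev).map J.restrict) (fun J => ?_)
      (fun J => rfl)
    refine ext_of_lintegral_expNeg fun a => ?_
    beta_reduce
    have e : ∀ m : Measure E, ∑ B : J, a B * J.restrict (ev m) B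
        = ∫⁻ x, ∑ B : J, a B * (B : Set E).indicator 1 x ∂m := fun m => by
      rw [lintegral_finsetSum]
      · refine Finset.sum_congr rfl fun B _ => ?_
        rw [lintegral_const_mul _ ((measurable_one).indicator B.1.2), lintegral_indicator_one B.1.2]
        rfl
      · intro B _
        exact ((measurable_one).indicator B.1.2).const_mul _
    have hJ : Measurable (J.restrict : ({B : Set E // MeasurableSet B} → ℝ≥0∞) → _) :=
      Finset.measurable_restrict J
    have hm : Measurable fun x : J → ℝ≥0∞ => expNeg (∑ B : J, a B * x B) := by fun_prop
    rw [Measure.map_map hJ hev, Measure.map_map hJ hev, lintegral_map hm (hJ.comp hev),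
      lintegral_map hm (hJ.comp hev)]
    simp only [Function.comp, e]
    exact h _ (Finset.measurable_sum _ fun B _ => ((measurable_one).indicator B.1.2).const_mul _)
  -- The σ-algebra on measures is generated by the evaluations, so equality of the images under `ev`
  -- gives equality of the laws.
  have hcomap : Measure.instMeasurableSpace ≤ MeasurableSpace.comap ev MeasurableSpace.pi := by
    refine iSup₂_le fun B hB => ?_
    rintro _ ⟨D, hD, rfl⟩
    exact ⟨(fun y => y ⟨B, hB⟩) ⁻¹' D, measurable_pi_apply _ hD, rfl⟩
  ext D hD
  obtain ⟨D', hD', rfl⟩ := hcomap D hD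
  rw [← Measure.map_apply hev hD', ← Measure.map_apply hev hD', key]

/-- A finite measure on the product of the space of measures with another space is determined by
its Laplace functionals over the events of the second factor. -/
theorem ext_prod_of_lintegral_expNeg_lintegral {E A : Type*} [MeasurableSpace E]
    [MeasurableSpace A] {ν₁ ν₂ : Measure (Measure E × A)} [IsFiniteMeasure ν₁] [IsFiniteMeasure ν₂]
    (h : ∀ f : E → ℝ≥0∞, Measurable f → ∀ C : Set A, MeasurableSet C →
      ∫⁻ p, C.indicator 1 p.2 * expNeg (∫⁻ x, f x ∂p.1) ∂ν₁
        = ∫⁻ p, C.indicator 1 p.2 * expNeg (∫⁻ x, f x ∂p.1) ∂ν₂) :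
    ν₁ = ν₂ := by
  refine Measure.ext_prod fun {D C} hD hC => ?_
  have hC' : MeasurableSet (Prod.snd ⁻¹' C : Set (Measure E × A)) := measurable_snd hC
  -- With the event `C` frozen, only a law on the space of measures is left to identify.
  have key : (ν₁.restrict (Prod.snd ⁻¹' C)).map Prod.fst
      = (ν₂.restrict (Prod.snd ⁻¹' C)).map Prod.fst := by
    refine ext_of_lintegral_expNeg_lintegral fun f hf => ?_
    have hm : Measurable fun m : Measure E => expNeg (∫⁻ x, f x ∂m) :=
      measurable_expNeg.comp (Measure.measurable_lintegral hf)
    rw [lintegral_map hm measurable_fst, lintegral_map hm measurable_fst,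
      ← lintegral_indicator hC', ← lintegral_indicator hC']
    convert h f hf C hC using 3 with p p
    all_goals
      by_cases hp : p.2 ∈ C <;> simp [hp]
  have := congrArg (fun ν => ν D) key
  simp only [Measure.map_apply measurable_fst hD,
    Measure.restrict_apply (measurable_fst hD)] at this
  exact this

end MixedGG

namespace MixedGG

open Filter Topology

/-! ### Laplace exponents of weighted measures -/

section Weight

variable {E : Type*} [MeasurableSpace E] {μ : Measure E} {w : E → ℝ}

/-- The Laplace exponent `t ↦ ∫ (1 - e^{-t w}) dμ` of a weight `w` under a measure `μ`. -/
noncomputable def lapExp (μ : Measure E) (w : E → ℝ) (t : ℝ) : ℝ :=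
  ∫ x, (1 - Real.exp (-(t * w x))) ∂μ

/-- A positive weight whose Laplace exponent is finite and unbounded. -/
structure IsLaplaceWeight (μ : Measure E) (w : E → ℝ) : Prop where
  measurable : Measurable w
  pos : ∀ᵐ x ∂μ, 0 < w x
  integrable : ∀ t : ℝ, 0 < t → Integrable (fun x => 1 - Real.exp (-(t * w x))) μ
  tendsto : Tendsto (lapExp μ w) atTop atTop

namespace IsLaplaceWeight

variable (hw : IsLaplaceWeight μ w)
include hw

lemma integrable_of_nonneg {t : ℝ} (ht : 0 ≤ t) :
    Integrable (fun x => 1 - Real.exp (-(t * w x))) μ := by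
  rcases ht.eq_or_lt with rfl | ht
  · simp
  · exact hw.integrable t ht

/-- From `y e^{-y} ≤ 1 - e^{-y}` at `y = t w`, the integrand is at most `t⁻¹ (1 - e^{-tw})`. -/
lemma integrable_weight_mul_exp {H : E → ℝ} (hH : Measurable H) (h0 : ∀ x, 0 ≤ H x)
    (h1 : ∀ x, H x ≤ 1) {t : ℝ} (ht : 0 < t) :
    Integrable (fun x => H x * w x * Real.exp (-(t * w x))) μ := by
  have hm := hw.measurable
  refine ((hw.integrable t ht).const_mul t⁻¹).mono' (by fun_prop) ?_
  filter_upwards [hw.pos] with x hx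
  rw [Real.norm_of_nonneg (by have := h0 x; positivity)]
  have key : t * w x * Real.exp (-(t * w x)) ≤ 1 - Real.exp (-(t * w x)) := by
    have := Real.add_one_le_exp (t * w x)
    have e : Real.exp (t * w x) * Real.exp (-(t * w x)) = 1 := by rw [← Real.exp_add]; simp
    nlinarith [Real.exp_pos (-(t * w x))]
  calc H x * w x * Real.exp (-(t * w x)) ≤ 1 * w x * Real.exp (-(t * w x)) := by
        gcongr; exact h1 x
    _ = t⁻¹ * (t * w x * Real.exp (-(t * w x))) := by field_simp
    _ ≤ _ := by gcongr

/-- Half of the exponential absorbs one factor of the weight, as `y e^{-y} ≤ 1` at `y = t w / 2`;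
the other half is the first-order case at `t / 2`. -/
lemma integrable_weight_sq_mul_exp {H : E → ℝ} (hH : Measurable H) (h0 : ∀ x, 0 ≤ H x)
    (h1 : ∀ x, H x ≤ 1) {t : ℝ} (ht : 0 < t) :
    Integrable (fun x => H x * w x ^ 2 * Real.exp (-(t * w x))) μ := by
  have hm := hw.measurable
  refine ((hw.integrable_weight_mul_exp hH h0 h1 (half_pos ht)).const_mul (2 / t)).mono'
    (by fun_prop) ?_
  filter_upwards [hw.pos] with x hx
  have hx0 := h0 x
  rw [Real.norm_of_nonneg (by positivity)]
  have e : Real.exp (-(t * w x)) = Real.exp (-(t / 2 * w x)) * Real.exp (-(t / 2 * w x)) := by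
    rw [← Real.exp_add]; ring_nf
  have key : t / 2 * w x * Real.exp (-(t / 2 * w x)) ≤ 1 := by
    have := Real.add_one_le_exp (t / 2 * w x)
    have e : Real.exp (t / 2 * w x) * Real.exp (-(t / 2 * w x)) = 1 := by
      rw [← Real.exp_add]; simp
    nlinarith [Real.exp_pos (-(t / 2 * w x))]
  calc H x * w x ^ 2 * Real.exp (-(t * w x))
      = 2 / t * (H x * w x * Real.exp (-(t / 2 * w x))) *
          (t / 2 * w x * Real.exp (-(t / 2 * w x))) := by rw [e]; field_simp
    _ ≤ 2 / t * (H x * w x * Real.exp (-(t / 2 * w x))) * 1 := by gcongr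
    _ = _ := mul_one _

/-- Differentiation under the integral sign: on `u > t / 2` the derivatives are dominated by their
size at `t / 2`. -/
lemma hasDerivAt_integral_weight {H : E → ℝ} (hH : Measurable H) (h0 : ∀ x, 0 ≤ H x)
    (h1 : ∀ x, H x ≤ 1) {t : ℝ} (ht : 0 < t) :
    HasDerivAt (fun t => ∫ x, H x * w x * Real.exp (-(t * w x)) ∂μ)
      (-∫ x, H x * w x ^ 2 * Real.exp (-(t * w x)) ∂μ) t := by
  have hm := hw.measurable
  rw [← integral_neg]
  refine (hasDerivAt_integral_of_dominated_loc_of_deriv_le (𝕜 := ℝ)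
    (F' := fun t x => -(H x * w x ^ 2 * Real.exp (-(t * w x))))
    (bound := fun x => H x * w x ^ 2 * Real.exp (-(t / 2 * w x)))
    (Ioi_mem_nhds (half_lt_self ht)) (Eventually.of_forall fun u => by fun_prop)
    (hw.integrable_weight_mul_exp hH h0 h1 ht) (by fun_prop) ?_
    (hw.integrable_weight_sq_mul_exp hH h0 h1 (half_pos ht)) ?_).2
  · filter_upwards [hw.pos] with x hx u hu
    have hx0 := h0 x
    have hu' : t / 2 < u := hu
    rw [norm_neg, Real.norm_of_nonneg (by positivity)]
    gcongr
  · refine Eventually.of_forall fun x u _ => ?_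
    have h := ((((hasDerivAt_id u).mul_const (w x)).neg).exp).const_mul (H x * w x)
    convert! h using 1
    simp only [id, Pi.neg_apply]; ring

lemma integrable_one_sub_mul_exp {G : E → ℝ} (hG : Measurable G) (h1 : ∀ x, G x ≤ 1)
    (hi : Integrable (fun x => 1 - G x) μ) {t : ℝ} (ht : 0 ≤ t) :
    Integrable (fun x => (1 - G x) * Real.exp (-(t * w x))) μ := by
  have hm := hw.measurable
  refine hi.mono' (by fun_prop) ?_
  filter_upwards [hw.pos] with x hx
  have hx1 : 0 ≤ 1 - G x := by linarith [h1 x]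
  rw [Real.norm_of_nonneg (by positivity)]
  have : Real.exp (-(t * w x)) ≤ 1 := Real.exp_le_one_iff.2 (by simp; positivity)
  nlinarith

/-- The splitting `1 - G e^{-tw} = (1 - e^{-tw}) + (1 - G) e^{-tw}` has two integrable terms,
although `G e^{-tw}` need not be integrable when `μ` is infinite. -/
lemma integrable_tilted {G : E → ℝ} (hG : Measurable G) (h1 : ∀ x, G x ≤ 1)
    (hi : Integrable (fun x => 1 - G x) μ) {t : ℝ} (ht : 0 ≤ t) :
    Integrable (fun x => 1 - G x * Real.exp (-(t * w x))) μ := by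
  convert! (hw.integrable_of_nonneg ht).add
    (hw.integrable_one_sub_mul_exp hG h1 hi ht) using 1
  ext x; simp; ring

lemma integral_tilted {G : E → ℝ} (hG : Measurable G) (h1 : ∀ x, G x ≤ 1)
    (hi : Integrable (fun x => 1 - G x) μ) {t : ℝ} (ht : 0 ≤ t) :
    ∫ x, (1 - G x * Real.exp (-(t * w x))) ∂μ
      = lapExp μ w t + ∫ x, (1 - G x) * Real.exp (-(t * w x)) ∂μ := by
  rw [lapExp, ← integral_add (hw.integrable_of_nonneg ht)
    (hw.integrable_one_sub_mul_exp hG h1 hi ht)]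
  congr 1 with x; ring

lemma hasDerivAt_integral_tilted {G : E → ℝ} (hG : Measurable G) (h0 : ∀ x, 0 ≤ G x)
    (h1 : ∀ x, G x ≤ 1) (hi : Integrable (fun x => 1 - G x) μ) {t : ℝ} (ht : 0 < t) :
    HasDerivAt (fun t => ∫ x, (1 - G x * Real.exp (-(t * w x))) ∂μ)
      (∫ x, G x * w x * Real.exp (-(t * w x)) ∂μ) t := by
  have hm := hw.measurable
  refine (hasDerivAt_integral_of_dominated_loc_of_deriv_le (𝕜 := ℝ)
    (F' := fun t x => G x * w x * Real.exp (-(t * w x)))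
    (bound := fun x => G x * w x * Real.exp (-(t / 2 * w x)))
    (Ioi_mem_nhds (half_lt_self ht)) (Eventually.of_forall fun u => by fun_prop)
    (hw.integrable_tilted hG h1 hi ht.le) (by fun_prop) ?_
    (hw.integrable_weight_mul_exp hG h0 h1 (half_pos ht)) ?_).2
  · filter_upwards [hw.pos] with x hx u hu
    have hx0 := h0 x
    have hu' : t / 2 < u := hu
    rw [Real.norm_of_nonneg (by positivity)]
    gcongr
  · refine Eventually.of_forall fun x u _ => ?_
    have h := (((((hasDerivAt_id u).mul_const (w x)).neg).exp).const_mul (G x)).const_sub 1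
    convert! h using 1
    simp only [id, Pi.neg_apply]; ring

/-- The weight need not be integrable, so the derivative may blow up at `t = 0`. Continuity there is
all that the fundamental theorem of calculus on `(0, ∞)` requires. -/
lemma continuousOn_integral_tilted {G : E → ℝ} (hG : Measurable G) (h0 : ∀ x, 0 ≤ G x)
    (h1 : ∀ x, G x ≤ 1) (hi : Integrable (fun x => 1 - G x) μ) :
    ContinuousOn (fun t => ∫ x, (1 - G x * Real.exp (-(t * w x))) ∂μ) (Set.Ici 0) := by
  have hm := hw.measurable
  intro t ht
  have ht0 : (0 : ℝ) ≤ t := ht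
  refine continuousWithinAt_of_dominated
    (bound := fun x => 1 - G x * Real.exp (-((t + 1) * w x)))
    (Eventually.of_forall fun u => by fun_prop) ?_
    (hw.integrable_tilted hG h1 hi (by positivity)) ?_
  · have : ∀ᶠ u in 𝓝[Set.Ici 0] t, u ∈ Set.Ici 0 ∧ u < t + 1 :=
      (eventually_mem_nhdsWithin).and
        (mem_nhdsWithin_of_mem_nhds (Iio_mem_nhds (lt_add_one t)))
    filter_upwards [this] with u hu
    filter_upwards [hw.pos] with x hx
    have hu0 : (0 : ℝ) ≤ u := hu.1
    have h2 : Real.exp (-(u * w x)) ≤ 1 := Real.exp_le_one_iff.2 (by simp; positivity)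
    have h3 : Real.exp (-((t + 1) * w x)) ≤ Real.exp (-(u * w x)) := by gcongr; exact hu.2.le
    have h4 := h0 x
    have h5 := h1 x
    rw [Real.norm_of_nonneg (by nlinarith [Real.exp_pos (-(u * w x))])]
    gcongr
  · refine Eventually.of_forall fun x => Continuous.continuousWithinAt (by fun_prop)

/-- The integral is at least `lapExp μ w t`, which tends to infinity. This removes the boundary term
at infinity. -/
lemma tendsto_exp_neg_integral_tilted {G : E → ℝ} (hG : Measurable G) (h1 : ∀ x, G x ≤ 1)
    (hi : Integrable (fun x => 1 - G x) μ) :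
    Tendsto (fun t => Real.exp (-∫ x, (1 - G x * Real.exp (-(t * w x))) ∂μ)) atTop (𝓝 0) := by
  refine Real.tendsto_exp_atBot.comp (tendsto_neg_atTop_atBot.comp ?_)
  refine tendsto_atTop_mono' _ ?_ hw.tendsto
  filter_upwards [eventually_ge_atTop 0] with t ht
  rw [hw.integral_tilted hG h1 hi ht]
  have : 0 ≤ ∫ x, (1 - G x) * Real.exp (-(t * w x)) ∂μ :=
    integral_nonneg fun x => mul_nonneg (by linarith [h1 x]) (Real.exp_pos _).le
  linarith

/-- The fundamental theorem of calculus for `exp (-∫ (1 - G e^{-u w}) dμ)`. -/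
lemma lintegral_deriv_exp_tilted {G : E → ℝ} (hG : Measurable G) (h0 : ∀ x, 0 ≤ G x)
    (h1 : ∀ x, G x ≤ 1) (hi : Integrable (fun x => 1 - G x) μ) {t : ℝ} (ht : 0 ≤ t) :
    ∫⁻ u in Set.Ioi t, ENNReal.ofReal ((∫ x, G x * w x * Real.exp (-(u * w x)) ∂μ) *
        Real.exp (-∫ x, (1 - G x * Real.exp (-(u * w x))) ∂μ))
      = ENNReal.ofReal (Real.exp (-∫ x, (1 - G x * Real.exp (-(t * w x))) ∂μ)) := by
  set M : ℝ → ℝ := fun t => ∫ x, (1 - G x * Real.exp (-(t * w x))) ∂μ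
  have hd : ∀ u ∈ Set.Ioi t, HasDerivAt (fun u => -Real.exp (-M u))
      ((∫ x, G x * w x * Real.exp (-(u * w x)) ∂μ) * Real.exp (-M u)) u := fun u hu => by
    have := ((hw.hasDerivAt_integral_tilted hG h0 h1 hi (ht.trans_lt hu)).neg.exp).neg
    convert! this using 1
    simp only [M, Pi.neg_apply]; ring
  have hc : ContinuousWithinAt (fun u => -Real.exp (-M u)) (Set.Ici t) t :=
    ((((hw.continuousOn_integral_tilted hG h0 h1 hi).mono
      (Set.Ici_subset_Ici.2 ht)) t Set.self_mem_Ici).neg.rexp).neg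
  have hp : ∀ u ∈ Set.Ioi t,
      0 ≤ (∫ x, G x * w x * Real.exp (-(u * w x)) ∂μ) * Real.exp (-M u) := fun u _ => by
    refine mul_nonneg (integral_nonneg_of_ae ?_) (Real.exp_pos _).le
    filter_upwards [hw.pos] with x hx
    have := h0 x
    simp only [Pi.zero_apply]
    positivity
  have hl : Tendsto (fun u => -Real.exp (-M u)) atTop (𝓝 0) := by
    simpa using (hw.tendsto_exp_neg_integral_tilted hG h1 hi).neg
  rw [← ofReal_integral_eq_lintegral_ofReal (integrableOn_Ioi_deriv_of_nonneg hc hd hp hl)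
    ((ae_restrict_iff' measurableSet_Ioi).2 (ae_of_all _ hp)),
    integral_Ioi_of_hasDerivAt_of_nonneg hc hd hp hl]
  simp [M]

/-- The fundamental theorem of calculus for
`exp (-∫ (1 - G e^{-u w}) dμ) ∫ H w e^{-(u + r) w} dμ`. -/
lemma lintegral_deriv_exp_tilted_mul {G H : E → ℝ} (hG : Measurable G) (h0 : ∀ x, 0 ≤ G x)
    (h1 : ∀ x, G x ≤ 1) (hi : Integrable (fun x => 1 - G x) μ)
    (hH : Measurable H) (hH0 : ∀ x, 0 ≤ H x) (hH1 : ∀ x, H x ≤ 1) {r : ℝ} (hr : 0 < r)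
    {t : ℝ} (ht : 0 ≤ t) :
    ∫⁻ u in Set.Ioi t, ENNReal.ofReal (Real.exp (-∫ x, (1 - G x * Real.exp (-(u * w x))) ∂μ) *
        ((∫ x, H x * w x ^ 2 * Real.exp (-((u + r) * w x)) ∂μ) +
        (∫ x, G x * w x * Real.exp (-(u * w x)) ∂μ) *
          ∫ x, H x * w x * Real.exp (-((u + r) * w x)) ∂μ))
      = ENNReal.ofReal (Real.exp (-∫ x, (1 - G x * Real.exp (-(t * w x))) ∂μ) *
          ∫ x, H x * w x * Real.exp (-((t + r) * w x)) ∂μ) := by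
  set M : ℝ → ℝ := fun t => ∫ x, (1 - G x * Real.exp (-(t * w x))) ∂μ
  set A : ℝ → ℝ := fun t => ∫ x, H x * w x * Real.exp (-((t + r) * w x)) ∂μ
  have hA : ∀ u, 0 ≤ u → HasDerivAt A
      (-∫ x, H x * w x ^ 2 * Real.exp (-((u + r) * w x)) ∂μ) u := fun u hu =>
    (hw.hasDerivAt_integral_weight hH hH0 hH1 (by positivity : 0 < u + r)).comp_add_const u r
  have hA0 : ∀ u, 0 ≤ A u := fun u => integral_nonneg_of_ae <| by
    filter_upwards [hw.pos] with x hx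
    have := hH0 x
    simp only [Pi.zero_apply]
    positivity
  have hd : ∀ u ∈ Set.Ioi t, HasDerivAt (fun u => -(Real.exp (-M u) * A u))
      (Real.exp (-M u) * ((∫ x, H x * w x ^ 2 * Real.exp (-((u + r) * w x)) ∂μ) +
        (∫ x, G x * w x * Real.exp (-(u * w x)) ∂μ) * A u)) u := fun u hu => by
    have := (((hw.hasDerivAt_integral_tilted hG h0 h1 hi (ht.trans_lt hu)).neg.exp).mul
      (hA u (ht.trans hu.le))).neg
    convert! this using 1
    simp only [M, Pi.neg_apply]; ring
  have hc : ContinuousWithinAt (fun u => -(Real.exp (-M u) * A u)) (Set.Ici t) t :=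
    (((((hw.continuousOn_integral_tilted hG h0 h1 hi).mono
      (Set.Ici_subset_Ici.2 ht)) t Set.self_mem_Ici).neg.rexp).mul
      (hA t ht).continuousAt.continuousWithinAt).neg
  have hp : ∀ u ∈ Set.Ioi t, 0 ≤ Real.exp (-M u) *
      ((∫ x, H x * w x ^ 2 * Real.exp (-((u + r) * w x)) ∂μ) +
        (∫ x, G x * w x * Real.exp (-(u * w x)) ∂μ) * A u) := fun u _ => by
    refine mul_nonneg (Real.exp_pos _).le (add_nonneg (integral_nonneg_of_ae ?_)
      (mul_nonneg (integral_nonneg_of_ae ?_) (hA0 u)))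
    all_goals
      filter_upwards [hw.pos] with x hx
      have := h0 x
      have := hH0 x
      simp only [Pi.zero_apply]
      positivity
  -- `A` decreases, and `0 < r` makes its integrand integrable even at `u = 0`. So `A` stays bounded
  -- while `e^{-M}` tends to `0`.
  have hA1 : ∀ u, 0 ≤ u → A u ≤ A 0 := fun u hu => by
    refine integral_mono_ae (hw.integrable_weight_mul_exp hH hH0 hH1 (by positivity))
      (hw.integrable_weight_mul_exp hH hH0 hH1 (by positivity)) ?_
    filter_upwards [hw.pos] with x hx
    have := hH0 x
    gcongr
  have hl : Tendsto (fun u => -(Real.exp (-M u) * A u)) atTop (𝓝 0) := by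
    have h3 : Tendsto (fun u => Real.exp (-M u) * A 0) atTop (𝓝 0) := by
      simpa using (hw.tendsto_exp_neg_integral_tilted hG h1 hi).mul_const (A 0)
    have h4 : Tendsto (fun u => Real.exp (-M u) * A u) atTop (𝓝 0) := by
      refine squeeze_zero' (Eventually.of_forall fun u => mul_nonneg (Real.exp_pos _).le (hA0 u))
        ?_ h3
      filter_upwards [eventually_ge_atTop 0] with u hu
      exact mul_le_mul_of_nonneg_left (hA1 u hu) (Real.exp_pos _).le
    simpa using h4.neg
  rw [← ofReal_integral_eq_lintegral_ofReal (integrableOn_Ioi_deriv_of_nonneg hc hd hp hl)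
    ((ae_restrict_iff' measurableSet_Ioi).2 (ae_of_all _ hp)),
    integral_Ioi_of_hasDerivAt_of_nonneg hc hd hp hl]
  simp [M, A]

end IsLaplaceWeight

end Weight

end MixedGG

/-! ### One step of the chain: invariance of the Laplace functional and the Mecke identity -/

namespace MixedGG

open Filter Topology

section Weight

variable {E : Type*} [MeasurableSpace E] {μ : Measure E} {w : E → ℝ}

/-- The density, in `u` and `x`, of the next time and mark of a size-biased chain, given that the
current time is `t`. -/
noncomputable def clockDensity (μ : Measure E) (w : E → ℝ) (t u : ℝ) (x : E) : ℝ≥0∞ :=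
  ENNReal.ofReal (w x * Real.exp (-(u * w x)) * Real.exp (-(lapExp μ w u - lapExp μ w t)))

/-- The Laplace functional at `f` of a Poisson random measure with intensity `e^{-t w} dμ`. -/
noncomputable def lapFactor (μ : Measure E) (w : E → ℝ) (f : E → ℝ≥0∞) (t : ℝ) : ℝ≥0∞ :=
  expNeg (∫⁻ x, (1 - expNeg (f x)) * ENNReal.ofReal (Real.exp (-(t * w x))) ∂μ)

lemma one_sub_expNeg_eq_ofReal (x : ℝ≥0∞) :
    1 - expNeg x = ENNReal.ofReal (1 - (expNeg x).toReal) := by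
  rw [ENNReal.ofReal_sub _ ENNReal.toReal_nonneg, ENNReal.ofReal_one,
    ENNReal.ofReal_toReal (expNeg_ne_top x)]

lemma integrable_one_sub_expNeg {f : E → ℝ≥0∞} (hf : Measurable f)
    (hfi : ∫⁻ x, (1 - expNeg (f x)) ∂μ ≠ ∞) :
    Integrable (fun x => 1 - (expNeg (f x)).toReal) μ := by
  refine ⟨(by fun_prop : Measurable _).aestronglyMeasurable, ?_⟩
  rw [hasFiniteIntegral_iff_ofReal]
  · simp_rw [← one_sub_expNeg_eq_ofReal]; exact hfi.lt_top
  · exact ae_of_all _ fun x => sub_nonneg.2 (expNeg_toReal_mem _).2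

namespace IsLaplaceWeight

variable (hw : IsLaplaceWeight μ w)
include hw

lemma lapFactor_eq {f : E → ℝ≥0∞} (hf : Measurable f)
    (hfi : ∫⁻ x, (1 - expNeg (f x)) ∂μ ≠ ∞) {t : ℝ} (ht : 0 ≤ t) :
    lapFactor μ w f t = ENNReal.ofReal
      (Real.exp (-∫ x, (1 - (expNeg (f x)).toReal) * Real.exp (-(t * w x)) ∂μ)) := by
  have h0 : ∀ x, 0 ≤ (1 - (expNeg (f x)).toReal) := fun x =>
    sub_nonneg.2 (expNeg_toReal_mem _).2
  rw [lapFactor, ← expNeg_ofReal (integral_nonneg fun x => mul_nonneg (h0 x) (Real.exp_pos _).le),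
    ofReal_integral_eq_lintegral_ofReal]
  · simp_rw [one_sub_expNeg_eq_ofReal, ENNReal.ofReal_mul (h0 _)]
  · exact hw.integrable_one_sub_mul_exp (by fun_prop) (fun x => (expNeg_toReal_mem _).2)
      (integrable_one_sub_expNeg hf hfi) ht
  · exact ae_of_all _ fun x => mul_nonneg (h0 x) (Real.exp_pos _).le

/-- The exponents combine: `Λ(u) + ∫ (1 - e^{-f}) e^{-uw} dμ = ∫ (1 - e^{-f} e^{-uw}) dμ`. Up to the
constant `e^{Λ(t)}`, the Laplace factor times the survival probability of the clock is thus
`e^{-M(u)}`, where `M'(u) = ∫ e^{-f} w e^{-uw} dμ`. -/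
lemma lapFactor_mul_exp {f : E → ℝ≥0∞} (hf : Measurable f)
    (hfi : ∫⁻ x, (1 - expNeg (f x)) ∂μ ≠ ∞) {t u : ℝ} (hu : 0 ≤ u) :
    lapFactor μ w f u * ENNReal.ofReal (Real.exp (-(lapExp μ w u - lapExp μ w t)))
      = ENNReal.ofReal (Real.exp (lapExp μ w t)) * ENNReal.ofReal
        (Real.exp (-∫ x, (1 - (expNeg (f x)).toReal * Real.exp (-(u * w x))) ∂μ)) := by
  rw [hw.lapFactor_eq hf hfi hu, hw.integral_tilted (by fun_prop)
    (fun x => (expNeg_toReal_mem _).2) (integrable_one_sub_expNeg hf hfi) hu,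
    ← ENNReal.ofReal_mul (Real.exp_pos _).le, ← ENNReal.ofReal_mul (Real.exp_pos _).le,
    ← Real.exp_add, ← Real.exp_add]
  congr 2; ring

lemma lintegral_expNeg_mul_weight {f : E → ℝ≥0∞} (hf : Measurable f) {u : ℝ} (hu : 0 < u) :
    ∫⁻ x, expNeg (f x) * ENNReal.ofReal (w x * Real.exp (-(u * w x))) ∂μ
      = ENNReal.ofReal (∫ x, (expNeg (f x)).toReal * w x * Real.exp (-(u * w x)) ∂μ) := by
  rw [ofReal_integral_eq_lintegral_ofReal (hw.integrable_weight_mul_exp (by fun_prop)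
    (fun x => ENNReal.toReal_nonneg) (fun x => (expNeg_toReal_mem _).2) hu)]
  · refine lintegral_congr fun x => ?_
    rw [mul_assoc, ENNReal.ofReal_mul ENNReal.toReal_nonneg, ENNReal.ofReal_toReal (expNeg_ne_top _)]
  · filter_upwards [hw.pos] with x hx
    simp only [Pi.zero_apply]
    positivity

/-- Invariance of the Laplace functional under one step of a size-biased chain. -/
lemma lintegral_clockDensity {f : E → ℝ≥0∞} (hf : Measurable f)
    (hfi : ∫⁻ x, (1 - expNeg (f x)) ∂μ ≠ ∞) {t : ℝ} (ht : 0 ≤ t) :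
    ∫⁻ u in Set.Ioi t, ∫⁻ x, expNeg (f x) * lapFactor μ w f u * clockDensity μ w t u x ∂μ
      = lapFactor μ w f t := by
  have hm := hw.measurable
  -- At `u = t` the identity reads `L(t) = e^{Λ(t)} e^{-M(t)}`, the boundary value in the
  -- fundamental theorem of calculus.
  have h1 := hw.lapFactor_mul_exp hf hfi (t := t) ht
  simp only [sub_self, neg_zero, Real.exp_zero, ENNReal.ofReal_one, mul_one] at h1
  rw [h1, ← hw.lintegral_deriv_exp_tilted (G := fun x => (expNeg (f x)).toReal) (by fun_prop)
    (fun x => ENNReal.toReal_nonneg) (fun x => (expNeg_toReal_mem _).2)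
    (integrable_one_sub_expNeg hf hfi) ht, ← lintegral_const_mul' _ _ ENNReal.ofReal_ne_top]
  refine setLIntegral_congr_fun measurableSet_Ioi fun u hu => ?_
  have hu0 : 0 < u := ht.trans_lt hu
  have e : ∀ x, expNeg (f x) * lapFactor μ w f u * clockDensity μ w t u x
      = expNeg (f x) * ENNReal.ofReal (w x * Real.exp (-(u * w x))) * (lapFactor μ w f u *
        ENNReal.ofReal (Real.exp (-(lapExp μ w u - lapExp μ w t)))) := fun x => by
    rw [clockDensity, ENNReal.ofReal_mul' (Real.exp_pos _).le]; ring
  simp only [e]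
  rw [lintegral_mul_const _ (by fun_prop), hw.lintegral_expNeg_mul_weight hf hu0,
    hw.lapFactor_mul_exp hf hfi hu0.le, ENNReal.ofReal_mul' (Real.exp_pos _).le]
  ring

/-- For `a, b ∈ [0, 1]` one has `1 - ab ≤ (1 - a) + (1 - b)`. -/
lemma lintegral_one_sub_expNeg_add_weight_ne_top {f : E → ℝ≥0∞} (hf : Measurable f)
    (hfi : ∫⁻ x, (1 - expNeg (f x)) ∂μ ≠ ∞) {r : ℝ} (hr : 0 < r) :
    ∫⁻ x, (1 - expNeg (f x + ENNReal.ofReal (r * w x))) ∂μ ≠ ∞ := by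
  have hm := hw.measurable
  have h2 : ∫⁻ x, ENNReal.ofReal (1 - Real.exp (-(r * w x))) ∂μ ≠ ∞ :=
    (hw.integrable r hr).lintegral_lt_top.ne
  refine ne_top_of_le_ne_top (ENNReal.add_ne_top.2 ⟨hfi, h2⟩) ?_
  rw [← lintegral_add_left (by fun_prop)]
  refine lintegral_mono_ae ?_
  filter_upwards [hw.pos] with x hx
  have hx' : 0 ≤ r * w x := by positivity
  rw [one_sub_expNeg_eq_ofReal, one_sub_expNeg_eq_ofReal, ← ENNReal.ofReal_add
    (sub_nonneg.2 (expNeg_toReal_mem _).2)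
    (sub_nonneg.2 (Real.exp_le_one_iff.2 (by linarith)))]
  refine ENNReal.ofReal_le_ofReal ?_
  rw [expNeg_add, expNeg_ofReal hx', ENNReal.toReal_mul, ENNReal.toReal_ofReal (Real.exp_pos _).le]
  have h3 := (expNeg_toReal_mem (f x)).2
  have h4 : Real.exp (-(r * w x)) ≤ 1 := Real.exp_le_one_iff.2 (by linarith)
  nlinarith

/-- The factor `e^{-rw}` moves the tilt from `u` to `u + r`, which is what makes the integral finite
at `u = 0`. The real form is the one that can be differentiated in `u`. -/
lemma lintegral_indicator_weight_mul_expNeg {f : E → ℝ≥0∞} (hf : Measurable f)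
    {B : Set E} (hB : MeasurableSet B) {r u : ℝ} (hr : 0 < r) (hu : 0 ≤ u) :
    ∫⁻ x, B.indicator 1 x * ENNReal.ofReal (w x) * expNeg (f x + ENNReal.ofReal (r * w x)) *
        ENNReal.ofReal (Real.exp (-(u * w x))) ∂μ
      = ENNReal.ofReal (∫ x, B.indicator 1 x * (expNeg (f x)).toReal * w x *
          Real.exp (-((u + r) * w x)) ∂μ) := by
  have hB' : Measurable (B.indicator (1 : E → ℝ)) := measurable_one.indicator hB
  rw [ofReal_integral_eq_lintegral_ofReal]
  · refine lintegral_congr_ae ?_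
    filter_upwards [hw.pos] with x hx
    have hx' : 0 ≤ r * w x := by positivity
    by_cases hxB : x ∈ B
    · simp only [Set.indicator_of_mem hxB, Pi.one_apply, one_mul, expNeg_add, expNeg_ofReal hx']
      rw [show -((u + r) * w x) = -(r * w x) + -(u * w x) by ring, Real.exp_add,
        ENNReal.ofReal_mul (by positivity), ENNReal.ofReal_mul (by positivity),
        ENNReal.ofReal_mul (by positivity), ENNReal.ofReal_toReal (expNeg_ne_top _)]
      ring
    · simp [hxB]
  · refine hw.integrable_weight_mul_exp (by fun_prop) ?_ ?_ (by positivity)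
    · intro x; by_cases hxB : x ∈ B <;> simp [hxB]
    · intro x; by_cases hxB : x ∈ B <;> simp [hxB, (expNeg_toReal_mem _).2]
  · filter_upwards [hw.pos] with x hx
    by_cases hxB : x ∈ B
    · simp only [Set.indicator_of_mem hxB, Pi.one_apply, one_mul, Pi.zero_apply]
      positivity
    · simp [hxB]

/-- Minus the derivative in `u` of the preceding integral, with the same shift of the tilt. -/
lemma lintegral_indicator_weight_sq_mul_expNeg {f : E → ℝ≥0∞} (hf : Measurable f)
    {B : Set E} (hB : MeasurableSet B) {r u : ℝ} (hr : 0 < r) (hu : 0 ≤ u) :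
    ∫⁻ x, B.indicator 1 x * ENNReal.ofReal (w x) * expNeg (f x + ENNReal.ofReal (r * w x)) *
        ENNReal.ofReal (w x * Real.exp (-(u * w x))) ∂μ
      = ENNReal.ofReal (∫ x, B.indicator 1 x * (expNeg (f x)).toReal * w x ^ 2 *
          Real.exp (-((u + r) * w x)) ∂μ) := by
  have hB' : Measurable (B.indicator (1 : E → ℝ)) := measurable_one.indicator hB
  rw [ofReal_integral_eq_lintegral_ofReal]
  · refine lintegral_congr_ae ?_
    filter_upwards [hw.pos] with x hx
    have hx' : 0 ≤ r * w x := by positivity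
    by_cases hxB : x ∈ B
    · simp only [Set.indicator_of_mem hxB, Pi.one_apply, one_mul, expNeg_add, expNeg_ofReal hx']
      rw [show -((u + r) * w x) = -(r * w x) + -(u * w x) by ring, Real.exp_add, sq,
        ENNReal.ofReal_mul (by positivity), ENNReal.ofReal_mul (by positivity),
        ENNReal.ofReal_mul (by positivity), ENNReal.ofReal_mul (by positivity),
        ENNReal.ofReal_mul (by positivity), ENNReal.ofReal_toReal (expNeg_ne_top _)]
      ring
    · simp [hxB]
  · refine hw.integrable_weight_sq_mul_exp (by fun_prop) ?_ ?_ (by positivity)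
    · intro x; by_cases hxB : x ∈ B <;> simp [hxB]
    · intro x; by_cases hxB : x ∈ B <;> simp [hxB, (expNeg_toReal_mem _).2]
  · filter_upwards [hw.pos] with x hx
    by_cases hxB : x ∈ B
    · simp only [Set.indicator_of_mem hxB, Pi.one_apply, one_mul, Pi.zero_apply]
      positivity
    · simp [hxB]

/-- One step of a size-biased chain in the Mecke equation for the total weight in `B`. -/
lemma lintegral_clockDensity_mecke {f : E → ℝ≥0∞} (hf : Measurable f)
    (hfi : ∫⁻ x, (1 - expNeg (f x)) ∂μ ≠ ∞) {B : Set E} (hB : MeasurableSet B) {r : ℝ}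
    (hr : 0 < r) {t : ℝ} (ht : 0 ≤ t) {g φ : E → ℝ≥0∞} {A : ℝ → ℝ≥0∞}
    (hg : g = fun x => f x + ENNReal.ofReal (r * w x))
    (hφ : φ = fun x => B.indicator 1 x * ENNReal.ofReal (w x))
    (hA : A = fun u => ∫⁻ x, φ x * expNeg (g x) * ENNReal.ofReal (Real.exp (-(u * w x))) ∂μ) :
    ∫⁻ u in Set.Ioi t, ∫⁻ x, expNeg (g x) * (φ x * lapFactor μ w g u + lapFactor μ w g u * A u) *
        clockDensity μ w t u x ∂μ
      = lapFactor μ w g t * A t := by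
  have hm := hw.measurable
  have hB' : Measurable (B.indicator (1 : E → ℝ)) := measurable_one.indicator hB
  have hB'' : Measurable (B.indicator (1 : E → ℝ≥0∞)) := measurable_one.indicator hB
  have hgm : Measurable g := by rw [hg]; fun_prop
  have hφm : Measurable φ := by rw [hφ]; fun_prop
  have hgi : ∫⁻ x, (1 - expNeg (g x)) ∂μ ≠ ∞ := by
    rw [hg]; exact hw.lintegral_one_sub_expNeg_add_weight_ne_top hf hfi hr
  have hA1 : ∀ u, 0 ≤ u → A u = ENNReal.ofReal (∫ x, B.indicator 1 x * (expNeg (f x)).toReal * w x *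
      Real.exp (-((u + r) * w x)) ∂μ) := fun u hu => by
    rw [hA, hφ, hg]; exact hw.lintegral_indicator_weight_mul_expNeg hf hB hr hu
  have hA2 : ∀ u, 0 ≤ u → ∫⁻ x, φ x * expNeg (g x) * ENNReal.ofReal (w x * Real.exp (-(u * w x))) ∂μ
      = ENNReal.ofReal (∫ x, B.indicator 1 x * (expNeg (f x)).toReal * w x ^ 2 *
      Real.exp (-((u + r) * w x)) ∂μ) := fun u hu => by
    rw [hφ, hg]; exact hw.lintegral_indicator_weight_sq_mul_expNeg hf hB hr hu
  have h1 := hw.lapFactor_mul_exp hgm hgi (t := t) ht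
  simp only [sub_self, neg_zero, Real.exp_zero, ENNReal.ofReal_one, mul_one] at h1
  have hH0 : ∀ x, 0 ≤ B.indicator (1 : E → ℝ) x * (expNeg (f x)).toReal := fun x => by
    by_cases hxB : x ∈ B <;> simp [hxB]
  have hH1 : ∀ x, B.indicator (1 : E → ℝ) x * (expNeg (f x)).toReal ≤ 1 := fun x => by
    by_cases hxB : x ∈ B <;> simp [hxB, (expNeg_toReal_mem _).2]
  rw [h1, hA1 t ht, mul_assoc, ← ENNReal.ofReal_mul (Real.exp_pos _).le,
    ← hw.lintegral_deriv_exp_tilted_mul (G := fun x => (expNeg (g x)).toReal)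
    (H := fun x => B.indicator 1 x * (expNeg (f x)).toReal) (by fun_prop)
    (fun x => ENNReal.toReal_nonneg) (fun x => (expNeg_toReal_mem _).2)
    (integrable_one_sub_expNeg hgm hgi) (by fun_prop) hH0 hH1 hr ht,
    ← lintegral_const_mul' _ _ ENNReal.ofReal_ne_top]
  refine setLIntegral_congr_fun measurableSet_Ioi fun u hu => ?_
  have hu0 : 0 < u := ht.trans_lt hu
  -- With `L A` proportional to `e^{-M} A`, the first term contributes `-A'`, from the extra factor
  -- `w`, and the second contributes `M' A`: together the derivative of `-e^{-M} A`, up to the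
  -- factor `e^{-M}`.
  have e : ∀ x, expNeg (g x) * (φ x * lapFactor μ w g u + lapFactor μ w g u * A u) *
        clockDensity μ w t u x
      = (φ x * expNeg (g x) * ENNReal.ofReal (w x * Real.exp (-(u * w x))) +
        A u * (expNeg (g x) * ENNReal.ofReal (w x * Real.exp (-(u * w x))))) * (lapFactor μ w g u *
        ENNReal.ofReal (Real.exp (-(lapExp μ w u - lapExp μ w t)))) := fun x => by
    rw [clockDensity, ENNReal.ofReal_mul' (Real.exp_pos _).le]; ring
  simp only [e]
  have hp1 : 0 ≤ ∫ x, B.indicator 1 x * (expNeg (f x)).toReal * w x ^ 2 *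
      Real.exp (-((u + r) * w x)) ∂μ := integral_nonneg fun x =>
    mul_nonneg (mul_nonneg (hH0 x) (sq_nonneg _)) (Real.exp_pos _).le
  have hp2 : 0 ≤ ∫ x, (expNeg (g x)).toReal * w x * Real.exp (-(u * w x)) ∂μ :=
    integral_nonneg_of_ae <| by
      filter_upwards [hw.pos] with x hx
      simp only [Pi.zero_apply]
      positivity
  have hp3 : 0 ≤ ∫ x, B.indicator 1 x * (expNeg (f x)).toReal * w x *
      Real.exp (-((u + r) * w x)) ∂μ := integral_nonneg_of_ae <| by
    filter_upwards [hw.pos] with x hx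
    exact mul_nonneg (mul_nonneg (hH0 x) hx.le) (Real.exp_pos _).le
  rw [lintegral_mul_const _ (by fun_prop), lintegral_add_left (by fun_prop),
    lintegral_const_mul _ (by fun_prop), hw.lintegral_expNeg_mul_weight hgm hu0,
    hA2 u hu0.le, hA1 u hu0.le,
    hw.lapFactor_mul_exp hgm hgi hu0.le, ENNReal.ofReal_mul (Real.exp_pos _).le,
    ENNReal.ofReal_add hp1 (mul_nonneg hp2 hp3), ENNReal.ofReal_mul hp2]
  ring

end IsLaplaceWeight

end Weight

end MixedGG

namespace MixedGG

open Filter Topology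

/-! ### Size-biased chains -/

section Chain

variable {Ω E : Type*} [mΩ : MeasurableSpace Ω] [MeasurableSpace E]
  {P : Measure Ω} {F : Filtration ℕ mΩ} {μ : Measure E} {w : E → ℝ}
  {T : ℕ → Ω → ℝ} {X : ℕ → Ω → E}

/-- Arrival times `T 1 < T 2 < ⋯` with marks `X 0, X 1, …`, started at `T 0 = 0`: given the past,
the next arrival time and mark have density `clockDensity` with respect to `du μ(dx)`. -/
structure IsSizeBiasedChain (P : Measure Ω) (F : Filtration ℕ mΩ) (μ : Measure E) (w : E → ℝ)
    (T : ℕ → Ω → ℝ) (X : ℕ → Ω → E) : Prop where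
  measurable_time : ∀ n, Measurable[F n] (T n)
  measurable_mark : ∀ n, Measurable[F (n + 1)] (X n)
  time_zero : ∀ ω, T 0 ω = 0
  time_nonneg : ∀ n, ∀ᵐ ω ∂P, 0 ≤ T n ω
  tendsto_time : ∀ᵐ ω ∂P, Tendsto (fun n => T n ω) atTop atTop
  lintegral_step : ∀ (n : ℕ) (Y : Ω → ℝ≥0∞), Measurable[F n] Y →
    ∀ h : ℝ × E → ℝ≥0∞, Measurable h →
      ∫⁻ ω, Y ω * h (T (n + 1) ω, X n ω) ∂P = ∫⁻ ω, Y ω * (∫⁻ u in Set.Ioi (T n ω),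
        ∫⁻ x, h (u, x) * clockDensity μ w (T n ω) u x ∂μ) ∂P

lemma measurable_lapFactor [SFinite μ] (hw : Measurable w) {f : E → ℝ≥0∞} (hf : Measurable f) :
    Measurable (lapFactor μ w f) := by
  refine measurable_expNeg.comp ?_
  exact Measurable.lintegral_prod_right' (f := fun p : ℝ × E =>
    (1 - expNeg (f p.2)) * ENNReal.ofReal (Real.exp (-(p.1 * w p.2)))) (by fun_prop)

lemma measurable_lintegral_mul_exp [SFinite μ] (hw : Measurable w) {φ : E → ℝ≥0∞}
    (hφ : Measurable φ) :
    Measurable fun t : ℝ => ∫⁻ x, φ x * ENNReal.ofReal (Real.exp (-(t * w x))) ∂μ :=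
  Measurable.lintegral_prod_right' (f := fun p : ℝ × E =>
    φ p.2 * ENNReal.ofReal (Real.exp (-(p.1 * w p.2)))) (by fun_prop)

lemma lapFactor_le_one (f : E → ℝ≥0∞) (t : ℝ) : lapFactor μ w f t ≤ 1 := expNeg_le_one _

lemma IsLaplaceWeight.tendsto_lintegral_mul_exp (hw : IsLaplaceWeight μ w) {φ : E → ℝ≥0∞}
    (hφ : Measurable φ) (hfin : ∫⁻ x, φ x ∂μ ≠ ∞) :
    Tendsto (fun t : ℝ => ∫⁻ x, φ x * ENNReal.ofReal (Real.exp (-(t * w x))) ∂μ)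
      atTop (𝓝 0) := by
  have hm := hw.measurable
  have : Tendsto (fun t : ℝ => ∫⁻ x, φ x * ENNReal.ofReal (Real.exp (-(t * w x))) ∂μ)
      atTop (𝓝 (∫⁻ _, 0 ∂μ)) := by
    refine tendsto_lintegral_filter_of_dominated_convergence φ
      (Eventually.of_forall fun t => by fun_prop) ?_ hfin ?_
    · filter_upwards [eventually_ge_atTop 0] with t ht
      filter_upwards [hw.pos] with x hx
      refine mul_le_of_le_one_right' ?_
      rw [ENNReal.ofReal_le_one]
      exact Real.exp_le_one_iff.2 (by simp; positivity)
    · have hne : ∀ᵐ x ∂μ, φ x ≠ ∞ := (ae_lt_top hφ hfin).mono fun x hx => hx.ne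
      filter_upwards [hw.pos, hne] with x hx hφx
      have h1 : Tendsto (fun t : ℝ => ENNReal.ofReal (Real.exp (-(t * w x)))) atTop (𝓝 0) := by
        rw [← ENNReal.ofReal_zero]
        refine ENNReal.tendsto_ofReal (Real.tendsto_exp_neg_atTop_nhds_zero.comp ?_)
        exact tendsto_id.atTop_mul_const hx
      simpa using ENNReal.Tendsto.const_mul h1 (Or.inr hφx)
  simpa using this

/-- The tilt `e^{-tw}` exhausts the intensity, so no atom remains in the limit. -/
lemma IsLaplaceWeight.tendsto_lapFactor (hw : IsLaplaceWeight μ w) {f : E → ℝ≥0∞}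
    (hf : Measurable f) (hfi : ∫⁻ x, (1 - expNeg (f x)) ∂μ ≠ ∞) :
    Tendsto (lapFactor μ w f) atTop (𝓝 1) := by
  rw [← expNeg_zero]
  exact (continuous_expNeg.tendsto 0).comp (hw.tendsto_lintegral_mul_exp (by fun_prop) hfi)

namespace IsSizeBiasedChain

variable (hc : IsSizeBiasedChain P F μ w T X)
include hc

lemma measurable_time' (n : ℕ) : Measurable (T n) := (hc.measurable_time n).mono (F.le n) le_rfl

lemma measurable_mark' (n : ℕ) : Measurable (X n) :=
  (hc.measurable_mark n).mono (F.le (n + 1)) le_rfl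

lemma measurable_sum_mark {f : E → ℝ≥0∞} (hf : Measurable f) (n k : ℕ) :
    Measurable[F (n + k)] fun ω => ∑ j ∈ Finset.range k, f (X (n + j) ω) := by
  refine Finset.measurable_fun_sum _ fun j hj => ?_
  refine hf.comp ((hc.measurable_mark (n + j)).mono (F.mono ?_) le_rfl)
  have := Finset.mem_range.1 hj
  lia

lemma measurable_tsum_mark {f : E → ℝ≥0∞} (hf : Measurable f) (n : ℕ) :
    Measurable fun ω => ∑' j, f (X (n + j) ω) :=
  Measurable.tsum fun _ => hf.comp (hc.measurable_mark' _)

/-- The density vanishes where `w ≤ 0`, because `ENNReal.ofReal` truncates negative values to `0`.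
-/
lemma ae_weight_pos (hw : Measurable w) : ∀ᵐ ω ∂P, ∀ n, 0 < w (X n ω) := by
  rw [ae_all_iff]
  intro n
  have hB : MeasurableSet {x | w x ≤ 0} := measurableSet_le hw measurable_const
  have h := hc.lintegral_step n (fun _ => 1) measurable_const
    (fun p => {x | w x ≤ 0}.indicator 1 p.2)
    ((measurable_one.indicator hB).comp measurable_snd)
  have h0 : ∀ (t u : ℝ) (x : E),
      {x | w x ≤ 0}.indicator (1 : E → ℝ≥0∞) x * clockDensity μ w t u x = 0 := fun t u x => by
    by_cases hx : w x ≤ 0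
    · have : clockDensity μ w t u x = 0 := ENNReal.ofReal_eq_zero.2 <|
        mul_nonpos_of_nonpos_of_nonneg
          (mul_nonpos_of_nonpos_of_nonneg hx (Real.exp_pos _).le) (Real.exp_pos _).le
      simp [this]
    · simp [hx]
  simp only [h0, one_mul, lintegral_zero] at h
  have h' := (lintegral_eq_zero_iff
    ((measurable_one.indicator hB).comp (hc.measurable_mark' n))).1 h
  filter_upwards [h'] with ω hω
  by_contra hcon
  simp [Set.indicator, not_lt.1 hcon] at hω

variable [SFinite μ] (hw : IsLaplaceWeight μ w)
include hw

/-- The martingale property of `e^{-∑_{j<n} f(X_j)} L_f(T_n)`, with `Y` playing the part of the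
past. -/
lemma lintegral_lapFactor_succ {f : E → ℝ≥0∞} (hf : Measurable f)
    (hfi : ∫⁻ x, (1 - expNeg (f x)) ∂μ ≠ ∞) {n : ℕ} {Y : Ω → ℝ≥0∞} (hY : Measurable[F n] Y) :
    ∫⁻ ω, Y ω * lapFactor μ w f (T n ω) ∂P
      = ∫⁻ ω, Y ω * expNeg (f (X n ω)) * lapFactor μ w f (T (n + 1) ω) ∂P := by
  have hL := measurable_lapFactor (μ := μ) hw.measurable hf
  have h := hc.lintegral_step n Y hY (fun p => expNeg (f p.2) * lapFactor μ w f p.1) (by fun_prop)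
  simp only [← mul_assoc] at h
  rw [h]
  refine lintegral_congr_ae ?_
  filter_upwards [hc.time_nonneg n] with ω hω
  rw [← hw.lintegral_clockDensity hf hfi hω]

lemma lintegral_lapFactor_add {f : E → ℝ≥0∞} (hf : Measurable f)
    (hfi : ∫⁻ x, (1 - expNeg (f x)) ∂μ ≠ ∞) {n : ℕ} {Y : Ω → ℝ≥0∞} (hY : Measurable[F n] Y)
    (k : ℕ) :
    ∫⁻ ω, Y ω * lapFactor μ w f (T n ω) ∂P
      = ∫⁻ ω, Y ω * expNeg (∑ j ∈ Finset.range k, f (X (n + j) ω)) *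
          lapFactor μ w f (T (n + k) ω) ∂P := by
  induction k with
  | zero => simp
  | succ k ih =>
    rw [ih, hc.lintegral_lapFactor_succ hw hf hfi]
    · refine lintegral_congr fun ω => ?_
      rw [Finset.sum_range_succ, expNeg_add, ← mul_assoc, add_assoc]
    · exact (hY.mono (F.mono (Nat.le_add_right n k)) le_rfl).mul
        (measurable_expNeg.comp (hc.measurable_sum_mark hf n k))

/-- The Laplace functional of the future marks given the past. -/
theorem lintegral_expNeg_tsum {f : E → ℝ≥0∞} (hf : Measurable f)
    (hfi : ∫⁻ x, (1 - expNeg (f x)) ∂μ ≠ ∞) {n : ℕ} {Y : Ω → ℝ≥0∞} (hY : Measurable[F n] Y)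
    (hYi : ∫⁻ ω, Y ω ∂P ≠ ∞) :
    ∫⁻ ω, Y ω * expNeg (∑' j, f (X (n + j) ω)) ∂P
      = ∫⁻ ω, Y ω * lapFactor μ w f (T n ω) ∂P := by
  have hL := measurable_lapFactor (μ := μ) hw.measurable hf
  have hYm : Measurable Y := hY.mono (F.le n) le_rfl
  have hT := hc.measurable_time'
  have hX := hc.measurable_mark'
  -- As `T (n + k) → ∞` the remaining Laplace factor tends to `1`, and `Y` dominates.
  have hlim : Tendsto (fun k => ∫⁻ ω, Y ω * expNeg (∑ j ∈ Finset.range k, f (X (n + j) ω)) *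
      lapFactor μ w f (T (n + k) ω) ∂P) atTop
      (𝓝 (∫⁻ ω, Y ω * expNeg (∑' j, f (X (n + j) ω)) ∂P)) := by
    refine tendsto_lintegral_of_dominated_convergence Y (fun k => by fun_prop)
      (fun k => ae_of_all _ fun ω => ?_) hYi ?_
    · exact (mul_le_of_le_one_right' (lapFactor_le_one _ _)).trans
        (mul_le_of_le_one_right' (expNeg_le_one _))
    · have hYt : ∀ᵐ ω ∂P, Y ω ≠ ∞ := (ae_lt_top hYm hYi).mono fun x hx => hx.ne
      filter_upwards [hc.tendsto_time, hYt] with ω hω hYω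
      have h1 : Tendsto (fun k => lapFactor μ w f (T (n + k) ω)) atTop (𝓝 1) :=
        (hw.tendsto_lapFactor hf hfi).comp (hω.comp (tendsto_add_atTop_nat n |>.congr
          fun k => by rw [add_comm]))
      have h2 : Tendsto (fun k => expNeg (∑ j ∈ Finset.range k, f (X (n + j) ω))) atTop
          (𝓝 (expNeg (∑' j, f (X (n + j) ω)))) :=
        (continuous_expNeg.tendsto _).comp (ENNReal.tendsto_nat_tsum _)
      have h3 := ENNReal.Tendsto.mul (ENNReal.Tendsto.const_mul h2 (Or.inr hYω))
        (Or.inr ENNReal.one_ne_top) h1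
        (Or.inr (ENNReal.mul_ne_top hYω (expNeg_ne_top _)))
      simpa using h3
  refine tendsto_nhds_unique hlim ?_
  simp_rw [← hc.lintegral_lapFactor_add hw hf hfi hY]
  exact tendsto_const_nhds

/-- One step of the Mecke equation. -/
lemma lintegral_mecke_succ {f : E → ℝ≥0∞} (hf : Measurable f)
    (hfi : ∫⁻ x, (1 - expNeg (f x)) ∂μ ≠ ∞) {B : Set E} (hB : MeasurableSet B) {r : ℝ}
    (hr : 0 < r) {g φ : E → ℝ≥0∞} {A : ℝ → ℝ≥0∞}
    (hg : g = fun x => f x + ENNReal.ofReal (r * w x))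
    (hφ : φ = fun x => B.indicator 1 x * ENNReal.ofReal (w x))
    (hA : A = fun u => ∫⁻ x, φ x * expNeg (g x) * ENNReal.ofReal (Real.exp (-(u * w x))) ∂μ)
    {n : ℕ} {Y : Ω → ℝ≥0∞} (hY : Measurable[F n] Y) (hYi : ∫⁻ ω, Y ω ∂P ≠ ∞) :
    ∫⁻ ω, Y ω * (lapFactor μ w g (T n ω) * A (T n ω)) ∂P
      = ∫⁻ ω, Y ω * φ (X n ω) * expNeg (∑' j, g (X (n + j) ω)) ∂P
        + ∫⁻ ω, Y ω * expNeg (g (X n ω)) *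
          (lapFactor μ w g (T (n + 1) ω) * A (T (n + 1) ω)) ∂P := by
  have hwm := hw.measurable
  have hB'' : Measurable (B.indicator (1 : E → ℝ≥0∞)) := measurable_one.indicator hB
  have hgm : Measurable g := by rw [hg]; fun_prop
  have hφm : Measurable φ := by rw [hφ]; fun_prop
  have hAm : Measurable A := by
    rw [hA]; exact measurable_lintegral_mul_exp hwm (by fun_prop)
  have hL := measurable_lapFactor (μ := μ) hw.measurable hgm
  have hgi : ∫⁻ x, (1 - expNeg (g x)) ∂μ ≠ ∞ := by
    rw [hg]; exact hw.lintegral_one_sub_expNeg_add_weight_ne_top hf hfi hr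
  have hYm : Measurable Y := hY.mono (F.le n) le_rfl
  have hT := hc.measurable_time'
  have hX := hc.measurable_mark'
  -- `φ e^{-g} ≤ w e^{-rw} ≤ 1/r`: the unbounded weight becomes a bounded factor, which may join
  -- `Y`.
  have hbd : ∀ x, φ x * expNeg (g x) ≤ ENNReal.ofReal r⁻¹ := fun x => by
    by_cases hx : 0 ≤ w x
    · calc φ x * expNeg (g x) ≤ ENNReal.ofReal (w x) * expNeg (ENNReal.ofReal (r * w x)) := by
            refine mul_le_mul' ?_ (expNeg_antitone ?_)
            · rw [hφ]
              by_cases hxB : x ∈ B <;> simp [hxB]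
            · rw [hg]; exact le_add_self
        _ = ENNReal.ofReal (w x * Real.exp (-(r * w x))) := by
            rw [expNeg_ofReal (by positivity), ENNReal.ofReal_mul hx]
        _ ≤ ENNReal.ofReal r⁻¹ := by
            refine ENNReal.ofReal_le_ofReal ?_
            have h1 := Real.add_one_le_exp (r * w x)
            rw [Real.exp_neg, ← div_eq_mul_inv, div_le_iff₀ (Real.exp_pos _), inv_mul_eq_div,
              le_div_iff₀ hr]
            linarith
    · have : φ x = 0 := by rw [hφ]; simp [ENNReal.ofReal_eq_zero.2 (not_le.1 hx).le]
      simp [this]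
  have h := hc.lintegral_step n Y hY (fun p => expNeg (g p.2) *
    (φ p.2 * lapFactor μ w g p.1 + lapFactor μ w g p.1 * A p.1)) (by fun_prop)
  have h1 : ∫⁻ ω, Y ω * (lapFactor μ w g (T n ω) * A (T n ω)) ∂P
      = ∫⁻ ω, (Y ω * (φ (X n ω) * expNeg (g (X n ω)))) * lapFactor μ w g (T (n + 1) ω) +
          Y ω * expNeg (g (X n ω)) * (lapFactor μ w g (T (n + 1) ω) * A (T (n + 1) ω)) ∂P := by
    calc _ = _ := by
          refine lintegral_congr_ae ?_
          filter_upwards [hc.time_nonneg n] with ω hω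
          rw [← hw.lintegral_clockDensity_mecke hf hfi hB hr hω hg hφ hA]
      _ = _ := h.symm
      _ = _ := by
          refine lintegral_congr fun ω => ?_
          ring
  rw [h1, lintegral_add_left (by fun_prop)]
  congr 1
  -- Once `X n` is revealed, `φ (X n) e^{-g (X n)}` belongs to the past, and `L_g(T (n + 1))` can be
  -- traded for the exponentials of the later marks.
  have hY' : Measurable[F (n + 1)] fun ω => Y ω * (φ (X n ω) * expNeg (g (X n ω))) :=
    (hY.mono (F.mono (Nat.le_succ n)) le_rfl).mul
      ((by fun_prop : Measurable fun x => φ x * expNeg (g x)).comp (hc.measurable_mark n))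
  have hY'i : ∫⁻ ω, Y ω * (φ (X n ω) * expNeg (g (X n ω))) ∂P ≠ ∞ := by
    refine ne_top_of_le_ne_top (ENNReal.mul_ne_top hYi (ENNReal.ofReal_ne_top (r := r⁻¹))) ?_
    rw [← lintegral_mul_const _ hYm]
    exact lintegral_mono fun ω => mul_le_mul' le_rfl (hbd _)
  rw [← hc.lintegral_expNeg_tsum hw hgm hgi hY' hY'i]
  refine lintegral_congr fun ω => ?_
  rw [tsum_eq_zero_add' (f := fun j => g (X (n + j) ω)) ENNReal.summable, expNeg_add]
  simp only [add_zero, add_assoc, add_comm 1]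
  ring

/-- The Mecke equation for the total weight in `B` of the future marks, given the past. -/
theorem lintegral_mecke {f : E → ℝ≥0∞} (hf : Measurable f)
    (hfi : ∫⁻ x, (1 - expNeg (f x)) ∂μ ≠ ∞) {B : Set E} (hB : MeasurableSet B) {r : ℝ}
    (hr : 0 < r) {g φ : E → ℝ≥0∞} {A : ℝ → ℝ≥0∞}
    (hg : g = fun x => f x + ENNReal.ofReal (r * w x))
    (hφ : φ = fun x => B.indicator 1 x * ENNReal.ofReal (w x))
    (hA : A = fun u => ∫⁻ x, φ x * expNeg (g x) * ENNReal.ofReal (Real.exp (-(u * w x))) ∂μ)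
    {n : ℕ} {Y : Ω → ℝ≥0∞} (hY : Measurable[F n] Y) (hYi : ∫⁻ ω, Y ω ∂P ≠ ∞) :
    ∫⁻ ω, Y ω * (∑' k, φ (X (n + k) ω)) * expNeg (∑' j, g (X (n + j) ω)) ∂P
      = ∫⁻ ω, Y ω * (lapFactor μ w g (T n ω) * A (T n ω)) ∂P := by
  have hwm := hw.measurable
  have hB'' : Measurable (B.indicator (1 : E → ℝ≥0∞)) := measurable_one.indicator hB
  have hgm : Measurable g := by rw [hg]; fun_prop
  have hφm : Measurable φ := by rw [hφ]; fun_prop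
  have hAm : Measurable A := by
    rw [hA]; exact measurable_lintegral_mul_exp hwm (by fun_prop)
  have hL := measurable_lapFactor (μ := μ) hw.measurable hgm
  have hYm : Measurable Y := hY.mono (F.le n) le_rfl
  have hT := hc.measurable_time'
  have hX := hc.measurable_mark'
  have hZ := hc.measurable_tsum_mark hgm n
  -- Finite because `0 < r`. It bounds the remainder and makes `A` tend to `0`.
  have hA0 : A 0 ≠ ∞ := by
    rw [hA, hφ, hg]
    simp only
    rw [hw.lintegral_indicator_weight_mul_expNeg hf hB hr le_rfl]
    exact ENNReal.ofReal_ne_top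
  have hAle : ∀ t, 0 ≤ t → A t ≤ A 0 := fun t ht => by
    rw [hA]
    refine lintegral_mono_ae ?_
    filter_upwards [hw.pos] with x hx
    gcongr
  have hAlim : Tendsto A atTop (𝓝 0) := by
    rw [hA]
    refine hw.tendsto_lintegral_mul_exp (by fun_prop) ?_
    have : A 0 = ∫⁻ x, φ x * expNeg (g x) ∂μ := by rw [hA]; simp
    rwa [← this]
  set D : ℝ → ℝ≥0∞ := fun t => lapFactor μ w g t * A t
  -- Each step splits off one term of `∑ φ (X (n + i))`; the remainder carries `A (T (n + k))` and
  -- disappears as `k → ∞`.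
  have hk : ∀ k, ∫⁻ ω, Y ω * D (T n ω) ∂P
      = ∑ i ∈ Finset.range k, ∫⁻ ω, Y ω * φ (X (n + i) ω) * expNeg (∑' j, g (X (n + j) ω)) ∂P
        + ∫⁻ ω, Y ω * expNeg (∑ j ∈ Finset.range k, g (X (n + j) ω)) * D (T (n + k) ω) ∂P := by
    intro k
    induction k with
    | zero => simp
    | succ k ih =>
      have hY' : Measurable[F (n + k)] fun ω =>
          Y ω * expNeg (∑ j ∈ Finset.range k, g (X (n + j) ω)) :=
        (hY.mono (F.mono (Nat.le_add_right n k)) le_rfl).mul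
          (measurable_expNeg.comp (hc.measurable_sum_mark hgm n k))
      have hY'i : ∫⁻ ω, Y ω * expNeg (∑ j ∈ Finset.range k, g (X (n + j) ω)) ∂P ≠ ∞ :=
        ne_top_of_le_ne_top hYi
          (lintegral_mono fun ω => mul_le_of_le_one_right' (expNeg_le_one _))
      rw [ih, hc.lintegral_mecke_succ hw hf hfi hB hr hg hφ hA hY' hY'i, Finset.sum_range_succ]
      refine Eq.trans ?_ (add_assoc _ _ _).symm
      congr 2
      · refine lintegral_congr fun ω => ?_
        rw [← Summable.sum_add_tsum_nat_add' (f := fun j => g (X (n + j) ω)) (k := k)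
          ENNReal.summable, expNeg_add]
        simp only [add_assoc, add_comm k]
        ring
      · refine lintegral_congr fun ω => ?_
        rw [Finset.sum_range_succ, expNeg_add, ← add_assoc]
        ring
  have hrem : Tendsto (fun k => ∫⁻ ω, Y ω * expNeg (∑ j ∈ Finset.range k, g (X (n + j) ω)) *
      D (T (n + k) ω) ∂P) atTop (𝓝 0) := by
    rw [← lintegral_zero (μ := P)]
    refine tendsto_lintegral_of_dominated_convergence (fun ω => Y ω * A 0) (fun k => by fun_prop)
      (fun k => ?_) ?_ ?_
    · filter_upwards [hc.time_nonneg (n + k)] with ω hω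
      refine mul_le_mul' (mul_le_of_le_one_right' (expNeg_le_one _)) ?_
      exact (mul_le_of_le_one_left' (lapFactor_le_one _ _)).trans (hAle _ hω)
    · rw [lintegral_mul_const _ hYm]
      exact ENNReal.mul_ne_top hYi hA0
    · have hYt : ∀ᵐ ω ∂P, Y ω ≠ ∞ := (ae_lt_top hYm hYi).mono fun x hx => hx.ne
      filter_upwards [hc.tendsto_time, hYt] with ω hω hYω
      have h1 : Tendsto (fun k => Y ω * A (T (n + k) ω)) atTop (𝓝 0) := by
        have := ENNReal.Tendsto.const_mul (a := Y ω) (hAlim.comp (hω.comp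
          (tendsto_add_atTop_nat n |>.congr fun k => by rw [add_comm]))) (Or.inr hYω)
        simpa using this
      refine tendsto_of_tendsto_of_tendsto_of_le_of_le tendsto_const_nhds h1
        (fun k => zero_le) fun k => ?_
      exact mul_le_mul' (mul_le_of_le_one_right' (expNeg_le_one _))
        (mul_le_of_le_one_left' (lapFactor_le_one _ _))
  have hsum : ∫⁻ ω, Y ω * (∑' k, φ (X (n + k) ω)) * expNeg (∑' j, g (X (n + j) ω)) ∂P
      = ∑' i, ∫⁻ ω, Y ω * φ (X (n + i) ω) * expNeg (∑' j, g (X (n + j) ω)) ∂P := by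
    rw [← lintegral_tsum fun i => by fun_prop]
    refine lintegral_congr fun ω => ?_
    rw [ENNReal.tsum_mul_right, ENNReal.tsum_mul_left]
  rw [hsum]
  have hlim := (ENNReal.tendsto_nat_tsum fun i =>
    ∫⁻ ω, Y ω * φ (X (n + i) ω) * expNeg (∑' j, g (X (n + j) ω)) ∂P).add hrem
  simp_rw [← hk, add_zero] at hlim
  exact tendsto_nhds_unique hlim tendsto_const_nhds

end IsSizeBiasedChain

end Chain

end MixedGG

/-! ### The next mark as a size-biased pick -/

namespace MixedGG

open Filter Topology

/-- Monotone convergence for the counting measure. It reduces arbitrary test functions to those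
supported on sets of finite intensity. -/
lemma tendsto_tsum_indicator {E : Type*} {s : ℕ → Set E} (hs : Monotone s)
    (hu : ∀ x, ∀ᶠ k in atTop, x ∈ s k) (f : E → ℝ≥0∞) (x : ℕ → E) :
    Tendsto (fun k => ∑' j, (s k).indicator f (x j)) atTop (𝓝 (∑' j, f (x j))) := by
  simp_rw [← lintegral_count]
  refine lintegral_tendsto_of_tendsto_of_monotone (fun k => measurable_from_top.aemeasurable)
    (ae_of_all _ fun j k l hkl => ?_) (ae_of_all _ fun j => ?_)
  · exact Set.indicator_le_indicator_of_subset (hs hkl) (fun _ => zero_le) _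
  · refine tendsto_const_nhds.congr' ?_
    filter_upwards [hu (x j)] with k hk
    rw [Set.indicator_of_mem hk]

/-- This replaces the normalisation by the random total weight with a mixture of Laplace
functionals. -/
lemma lintegral_expNeg_mul {z : ℝ≥0∞} (h0 : z ≠ 0) (ht : z ≠ ∞) :
    ∫⁻ r in Set.Ioi (0 : ℝ), expNeg (ENNReal.ofReal r * z) = z⁻¹ := by
  have hz : 0 < z.toReal := ENNReal.toReal_pos h0 ht
  have e : ∀ r ∈ Set.Ioi (0 : ℝ), expNeg (ENNReal.ofReal r * z)
      = ENNReal.ofReal (Real.exp (-z.toReal * r)) := fun r hr => by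
    have hr' : (0 : ℝ) < r := hr
    conv_lhs => rw [← ENNReal.ofReal_toReal ht, ← ENNReal.ofReal_mul hr'.le]
    rw [expNeg_ofReal (by positivity)]
    congr 2; ring
  rw [setLIntegral_congr_fun measurableSet_Ioi e, ← ofReal_integral_eq_lintegral_ofReal
    (integrableOn_exp_mul_Ioi (by linarith) 0) (ae_of_all _ fun _ => (Real.exp_pos _).le),
    integral_exp_mul_Ioi (by linarith)]
  rw [mul_zero, Real.exp_zero, neg_div_neg_eq, one_div, ENNReal.ofReal_inv_of_pos hz,
    ENNReal.ofReal_toReal ht]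

section Chain

variable {Ω E : Type*} [mΩ : MeasurableSpace Ω] [MeasurableSpace E]
  {P : Measure Ω} {F : Filtration ℕ mΩ} {μ : Measure E} {w : E → ℝ}
  {T : ℕ → Ω → ℝ} {X : ℕ → Ω → E}

lemma IsLaplaceWeight.lintegral_one_sub_expNeg_weight_ne_top (hw : IsLaplaceWeight μ w) {r : ℝ}
    (hr : 0 < r) : ∫⁻ x, (1 - expNeg (ENNReal.ofReal (r * w x))) ∂μ ≠ ∞ := by
  have := hw.lintegral_one_sub_expNeg_add_weight_ne_top (f := fun _ => 0) measurable_const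
    (by simp) hr
  simpa using this

/-- Integrating over an exponential clock turns the Mecke equation into one step of the chain. -/
lemma IsLaplaceWeight.lintegral_mecke_eq_clockDensity (hw : IsLaplaceWeight μ w) {f : E → ℝ≥0∞}
    (hf : Measurable f) (hfi : ∫⁻ x, (1 - expNeg (f x)) ∂μ ≠ ∞) {B : Set E}
    (hB : MeasurableSet B) {t : ℝ} (ht : 0 ≤ t) :
    ∫⁻ r in Set.Ioi (0 : ℝ), lapFactor μ w (fun x => f x + ENNReal.ofReal (r * w x)) t *
        ∫⁻ x, B.indicator 1 x * ENNReal.ofReal (w x) * expNeg (f x + ENNReal.ofReal (r * w x)) *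
          ENNReal.ofReal (Real.exp (-(t * w x))) ∂μ
      = ∫⁻ u in Set.Ioi t, ∫⁻ x, B.indicator 1 x * expNeg (f x) * lapFactor μ w f u *
          clockDensity μ w t u x ∂μ := by
  have hwm := hw.measurable
  have hB'' : Measurable (B.indicator (1 : E → ℝ≥0∞)) := measurable_one.indicator hB
  have hpre : (fun r : ℝ => t + r) ⁻¹' Set.Ioi t = Set.Ioi 0 := by ext r; simp
  -- Substitution `u = t + r`. The additional tilt `r` and the current time `t` merge, and `L_{f +
  -- rw}(t) = L_f(t + r) e^{-(Λ(t + r) - Λ(t))}`.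
  rw [← (measurePreserving_add_left volume t).setLIntegral_comp_preimage_emb
    (measurableEmbedding_addLeft t) _ (Set.Ioi t), hpre]
  refine setLIntegral_congr_fun measurableSet_Ioi fun r hr => ?_
  have hr0 : (0 : ℝ) < r := hr
  have h1 := hw.lapFactor_mul_exp (f := fun x => f x + ENNReal.ofReal (r * w x)) (by fun_prop)
    (hw.lintegral_one_sub_expNeg_add_weight_ne_top hf hfi hr0) (t := t) ht
  simp only [sub_self, neg_zero, Real.exp_zero, ENNReal.ofReal_one, mul_one] at h1
  have e : ∀ x, B.indicator 1 x * expNeg (f x) * lapFactor μ w f (t + r) *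
          clockDensity μ w t (t + r) x
      = B.indicator 1 x * expNeg (f x) * ENNReal.ofReal (w x * Real.exp (-((t + r) * w x))) *
        (lapFactor μ w f (t + r) *
          ENNReal.ofReal (Real.exp (-(lapExp μ w (t + r) - lapExp μ w t)))) := fun x => by
    rw [clockDensity, ENNReal.ofReal_mul' (Real.exp_pos _).le]; ring
  simp only [e]
  rw [h1, lintegral_mul_const _ (by fun_prop), hw.lapFactor_mul_exp hf hfi (by positivity),
    mul_comm]
  congr 1
  · refine lintegral_congr_ae ?_
    filter_upwards [hw.pos] with x hx
    rw [expNeg_add, expNeg_ofReal (by positivity),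
      show -((t + r) * w x) = -(r * w x) + -(t * w x) by ring, Real.exp_add,
      ENNReal.ofReal_mul hx.le, ENNReal.ofReal_mul (Real.exp_pos _).le]
    ring
  · congr 4
    refine integral_congr_ae ?_
    filter_upwards [hw.pos] with x hx
    rw [expNeg_add, expNeg_ofReal (by positivity), ENNReal.toReal_mul,
      ENNReal.toReal_ofReal (Real.exp_pos _).le,
      show -((t + r) * w x) = -(r * w x) + -(t * w x) by ring, Real.exp_add]
    ring

namespace IsSizeBiasedChain

variable (hc : IsSizeBiasedChain P F μ w T X) [SFinite μ] (hw : IsLaplaceWeight μ w)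
include hc hw

/-- `E e^{-r ∑ w}` is at most the probability that the sum is finite, and equals `exp (-∫ (1 -
e^{-rw}) dμ)`, which tends to `1` along `r = 1 / (k + 1)`. -/
lemma ae_tsum_weight_lt_top [IsProbabilityMeasure P] :
    ∀ᵐ ω ∂P, ∑' j, ENNReal.ofReal (w (X j ω)) < ∞ := by
  have hwm := hw.measurable
  have hm : Measurable fun ω => ∑' j, ENNReal.ofReal (w (X j ω)) := by
    simpa using hc.measurable_tsum_mark (f := fun x => ENNReal.ofReal (w x)) (by fun_prop) 0
  have hset : MeasurableSet {ω | ∑' j, ENNReal.ofReal (w (X j ω)) < ∞} :=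
    measurableSet_lt hm measurable_const
  have hle : ∀ k : ℕ, expNeg (∫⁻ x, (1 - expNeg (ENNReal.ofReal (1 / ((k : ℝ) + 1) * w x))) ∂μ)
      ≤ P {ω | ∑' j, ENNReal.ofReal (w (X j ω)) < ∞} := fun k => by
    have hr : (0 : ℝ) < 1 / ((k : ℝ) + 1) := by positivity
    have h := hc.lintegral_expNeg_tsum hw
      (f := fun x => ENNReal.ofReal (1 / ((k : ℝ) + 1) * w x)) (by fun_prop)
      (hw.lintegral_one_sub_expNeg_weight_ne_top hr) (n := 0) (Y := fun _ => 1) measurable_const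
      (by simp)
    simp only [one_mul, zero_add, hc.time_zero, lapFactor, zero_mul, neg_zero, Real.exp_zero,
      ENNReal.ofReal_one, mul_one, lintegral_const, measure_univ] at h
    rw [← h, ← lintegral_indicator_one hset]
    refine lintegral_mono fun ω => ?_
    by_cases hω : ∑' j, ENNReal.ofReal (w (X j ω)) < ∞
    · simpa [Set.indicator, hω] using expNeg_le_one _
    · simp only [ENNReal.ofReal_mul hr.le, ENNReal.tsum_mul_left, not_lt.1 hω |> top_le_iff.1]
      rw [ENNReal.mul_top (by simpa using hr), expNeg_top]
      exact zero_le
  have hlim : Tendsto (fun k : ℕ =>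
      expNeg (∫⁻ x, (1 - expNeg (ENNReal.ofReal (1 / ((k : ℝ) + 1) * w x))) ∂μ)) atTop (𝓝 1) := by
    suffices h0 : Tendsto (fun k : ℕ =>
        ∫⁻ x, (1 - expNeg (ENNReal.ofReal (1 / ((k : ℝ) + 1) * w x))) ∂μ) atTop
        (𝓝 (∫⁻ _, 0 ∂μ)) by
      simpa [Function.comp_def] using (continuous_expNeg.tendsto _).comp h0
    refine tendsto_lintegral_of_dominated_convergence
      (fun x => 1 - expNeg (ENNReal.ofReal (1 * w x))) (fun k => by fun_prop) (fun k => ?_)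
      (hw.lintegral_one_sub_expNeg_weight_ne_top one_pos) (ae_of_all _ fun x => ?_)
    · filter_upwards [hw.pos] with x hx
      refine tsub_le_tsub_left (expNeg_antitone (ENNReal.ofReal_le_ofReal ?_)) _
      gcongr
      rw [div_le_one (by positivity)]
      linarith [(Nat.cast_nonneg k : (0 : ℝ) ≤ k)]
    · have h1 : Tendsto (fun k : ℕ => ENNReal.ofReal (1 / ((k : ℝ) + 1) * w x)) atTop (𝓝 0) := by
        have := ENNReal.tendsto_ofReal
          ((tendsto_one_div_add_atTop_nhds_zero_nat (𝕜 := ℝ)).mul_const (w x))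
        simpa using this
      have h2 := ENNReal.Tendsto.sub (tendsto_const_nhds (x := (1 : ℝ≥0∞)))
        ((continuous_expNeg.tendsto 0).comp h1) (Or.inl ENNReal.one_ne_top)
      simpa using h2
  have h1 : P {ω | ∑' j, ENNReal.ofReal (w (X j ω)) < ∞} = 1 :=
    le_antisymm prob_le_one (le_of_tendsto' hlim hle)
  exact (prob_compl_eq_zero_iff hset).2 h1

/-- The size-biased choice of the next mark, tested against the Laplace functional of a function
of finite Laplace exponent. -/
lemma lintegral_sizeBiased_of_ne_top [IsProbabilityMeasure P] {f : E → ℝ≥0∞} (hf : Measurable f)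
    (hfi : ∫⁻ x, (1 - expNeg (f x)) ∂μ ≠ ∞) {B : Set E} (hB : MeasurableSet B)
    {n : ℕ} {Y : Ω → ℝ≥0∞} (hY : Measurable[F n] Y) (hYi : ∫⁻ ω, Y ω ∂P ≠ ∞) :
    ∫⁻ ω, Y ω * B.indicator 1 (X n ω) * expNeg (∑' j, f (X (n + j) ω)) ∂P
      = ∫⁻ ω, Y ω * ((∑' k, ENNReal.ofReal (w (X (n + k) ω)))⁻¹ *
          ∑' k, B.indicator 1 (X (n + k) ω) * ENNReal.ofReal (w (X (n + k) ω))) *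
          expNeg (∑' j, f (X (n + j) ω)) ∂P := by
  have hwm := hw.measurable
  have hB'' : Measurable (B.indicator (1 : E → ℝ≥0∞)) := measurable_one.indicator hB
  have hYm : Measurable Y := hY.mono (F.le n) le_rfl
  have hT := hc.measurable_time'
  have hX := hc.measurable_mark'
  have hL := measurable_lapFactor (μ := μ) hw.measurable hf
  have hS := hc.measurable_tsum_mark hf n
  have hZ := hc.measurable_tsum_mark (f := fun x => ENNReal.ofReal (w x)) (by fun_prop) n
  have hZB := hc.measurable_tsum_mark
    (f := fun x => B.indicator 1 x * ENNReal.ofReal (w x)) (by fun_prop) n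
  -- After the mark `X n`, the later marks contribute `L_f(T (n + 1))`; what is left is a single
  -- step of the chain.
  have hleft : ∫⁻ ω, Y ω * B.indicator 1 (X n ω) * expNeg (∑' j, f (X (n + j) ω)) ∂P
      = ∫⁻ ω, Y ω * (∫⁻ u in Set.Ioi (T n ω), ∫⁻ x, B.indicator 1 x * expNeg (f x) *
          lapFactor μ w f u * clockDensity μ w (T n ω) u x ∂μ) ∂P := by
    rw [← hc.lintegral_step n Y hY
      (fun p => B.indicator 1 p.2 * expNeg (f p.2) * lapFactor μ w f p.1) (by fun_prop)]
    have hY' : Measurable[F (n + 1)] fun ω => Y ω * (B.indicator 1 (X n ω) * expNeg (f (X n ω))) :=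
      (hY.mono (F.mono (Nat.le_succ n)) le_rfl).mul
        ((by fun_prop : Measurable fun x => B.indicator 1 x * expNeg (f x)).comp
          (hc.measurable_mark n))
    have hY'i : ∫⁻ ω, Y ω * (B.indicator 1 (X n ω) * expNeg (f (X n ω))) ∂P ≠ ∞ := by
      refine ne_top_of_le_ne_top hYi (lintegral_mono fun ω => mul_le_of_le_one_right' ?_)
      refine mul_le_one' ?_ (expNeg_le_one _)
      by_cases hx : X n ω ∈ B <;> simp [hx]
    simp_rw [← mul_assoc] at hY' hY'i ⊢
    rw [← hc.lintegral_expNeg_tsum hw hf hfi hY' hY'i]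
    refine lintegral_congr fun ω => ?_
    rw [tsum_eq_zero_add' (f := fun j => f (X (n + j) ω)) ENNReal.summable, expNeg_add]
    simp only [add_zero, add_assoc, add_comm 1]
    ring
  -- `1/Z = ∫₀^∞ e^{-rZ} dr`, where `Z` is the total weight of the future marks, almost surely
  -- positive and finite.
  have hright : ∫⁻ ω, Y ω * ((∑' k, ENNReal.ofReal (w (X (n + k) ω)))⁻¹ *
          ∑' k, B.indicator 1 (X (n + k) ω) * ENNReal.ofReal (w (X (n + k) ω))) *
          expNeg (∑' j, f (X (n + j) ω)) ∂P
      = ∫⁻ r in Set.Ioi (0 : ℝ), ∫⁻ ω, Y ω *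
          (∑' k, B.indicator 1 (X (n + k) ω) * ENNReal.ofReal (w (X (n + k) ω))) *
          expNeg (∑' j, (f (X (n + j) ω) + ENNReal.ofReal (r * w (X (n + j) ω)))) ∂P := by
    have e : ∀ r ∈ Set.Ioi (0 : ℝ), ∫⁻ ω, Y ω *
          (∑' k, B.indicator 1 (X (n + k) ω) * ENNReal.ofReal (w (X (n + k) ω))) *
          expNeg (∑' j, (f (X (n + j) ω) + ENNReal.ofReal (r * w (X (n + j) ω)))) ∂P
        = ∫⁻ ω, Y ω *
          (∑' k, B.indicator 1 (X (n + k) ω) * ENNReal.ofReal (w (X (n + k) ω))) *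
          (expNeg (∑' j, f (X (n + j) ω)) *
            expNeg (ENNReal.ofReal r * ∑' k, ENNReal.ofReal (w (X (n + k) ω)))) ∂P := fun r hr => by
      refine lintegral_congr fun ω => ?_
      rw [ENNReal.tsum_add, expNeg_add]
      simp_rw [ENNReal.ofReal_mul (le_of_lt hr), ENNReal.tsum_mul_left]
    rw [setLIntegral_congr_fun measurableSet_Ioi e, lintegral_lintegral_swap]
    · refine lintegral_congr_ae ?_
      filter_upwards [hc.ae_tsum_weight_lt_top hw, hc.ae_weight_pos hwm] with ω hfin hpos
      have hZ0 : ∑' k, ENNReal.ofReal (w (X (n + k) ω)) ≠ 0 := by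
        rw [Ne, ENNReal.tsum_eq_zero]
        push Not
        exact ⟨0, by simpa using hpos n⟩
      have hZt : ∑' k, ENNReal.ofReal (w (X (n + k) ω)) ≠ ∞ := by
        refine ne_top_of_le_ne_top hfin.ne ?_
        exact ENNReal.tsum_comp_le_tsum_of_injective (add_right_injective n)
          (fun j => ENNReal.ofReal (w (X j ω)))
      rw [lintegral_const_mul _ (by fun_prop), lintegral_const_mul _ (by fun_prop),
        lintegral_expNeg_mul hZ0 hZt]
      ring
    · have hZ' : Measurable fun p : ℝ × Ω => ∑' k, ENNReal.ofReal (w (X (n + k) p.2)) :=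
        hZ.comp measurable_snd
      have hZB' : Measurable fun p : ℝ × Ω =>
          ∑' k, B.indicator 1 (X (n + k) p.2) * ENNReal.ofReal (w (X (n + k) p.2)) :=
        hZB.comp measurable_snd
      have hS' : Measurable fun p : ℝ × Ω => ∑' j, f (X (n + j) p.2) := hS.comp measurable_snd
      refine Measurable.aemeasurable ?_
      simp only [Function.uncurry_def]
      fun_prop
  have hmid : ∀ r ∈ Set.Ioi (0 : ℝ), ∫⁻ ω, Y ω *
          (∑' k, B.indicator 1 (X (n + k) ω) * ENNReal.ofReal (w (X (n + k) ω))) *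
          expNeg (∑' j, (f (X (n + j) ω) + ENNReal.ofReal (r * w (X (n + j) ω)))) ∂P
      = ∫⁻ ω, Y ω * (lapFactor μ w (fun x => f x + ENNReal.ofReal (r * w x)) (T n ω) *
        ∫⁻ x, B.indicator 1 x * ENNReal.ofReal (w x) * expNeg (f x + ENNReal.ofReal (r * w x)) *
          ENNReal.ofReal (Real.exp (-(T n ω * w x))) ∂μ) ∂P := fun r hr =>
    hc.lintegral_mecke hw hf hfi hB hr rfl rfl rfl hY hYi
  rw [hleft, hright, setLIntegral_congr_fun measurableSet_Ioi hmid, lintegral_lintegral_swap]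
  · refine lintegral_congr_ae ?_
    filter_upwards [hc.time_nonneg n] with ω hω
    rw [← hw.lintegral_mecke_eq_clockDensity hf hfi hB hω, lintegral_const_mul]
    have h1 : Measurable fun r : ℝ =>
        ∫⁻ x, B.indicator 1 x * ENNReal.ofReal (w x) * expNeg (f x + ENNReal.ofReal (r * w x)) *
          ENNReal.ofReal (Real.exp (-(T n ω * w x))) ∂μ :=
      Measurable.lintegral_prod_right' (f := fun p : ℝ × E => B.indicator 1 p.2 *
        ENNReal.ofReal (w p.2) * expNeg (f p.2 + ENNReal.ofReal (p.1 * w p.2)) *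
          ENNReal.ofReal (Real.exp (-(T n ω * w p.2)))) (by fun_prop)
    have h2 : Measurable fun r : ℝ =>
        lapFactor μ w (fun x => f x + ENNReal.ofReal (r * w x)) (T n ω) :=
      measurable_expNeg.comp (Measurable.lintegral_prod_right' (f := fun p : ℝ × E =>
        (1 - expNeg (f p.2 + ENNReal.ofReal (p.1 * w p.2))) *
          ENNReal.ofReal (Real.exp (-(T n ω * w p.2)))) (by fun_prop))
    exact h2.mul h1
  · have h1 : Measurable fun q : ℝ × Ω =>
        ∫⁻ x, B.indicator 1 x * ENNReal.ofReal (w x) * expNeg (f x + ENNReal.ofReal (q.1 * w x)) *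
          ENNReal.ofReal (Real.exp (-(T n q.2 * w x))) ∂μ :=
      Measurable.lintegral_prod_right' (f := fun p : (ℝ × Ω) × E => B.indicator 1 p.2 *
        ENNReal.ofReal (w p.2) * expNeg (f p.2 + ENNReal.ofReal (p.1.1 * w p.2)) *
          ENNReal.ofReal (Real.exp (-(T n p.1.2 * w p.2)))) (by fun_prop)
    have h2 : Measurable fun q : ℝ × Ω =>
        lapFactor μ w (fun x => f x + ENNReal.ofReal (q.1 * w x)) (T n q.2) :=
      measurable_expNeg.comp (Measurable.lintegral_prod_right' (f := fun p : (ℝ × Ω) × E =>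
        (1 - expNeg (f p.2 + ENNReal.ofReal (p.1.1 * w p.2))) *
          ENNReal.ofReal (Real.exp (-(T n p.1.2 * w p.2)))) (by fun_prop))
    exact ((hYm.comp measurable_snd).mul (h2.mul h1)).aemeasurable

omit [SFinite μ] in
/-- The Laplace functional of the marks. -/
theorem lintegral_expNeg_tsum_mark [IsProbabilityMeasure P] [SigmaFinite μ] {f : E → ℝ≥0∞}
    (hf : Measurable f) :
    ∫⁻ ω, expNeg (∑' j, f (X j ω)) ∂P = expNeg (∫⁻ x, (1 - expNeg (f x)) ∂μ) := by
  have hs := measurableSet_spanningSets μ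
  have hX := hc.measurable_mark'
  -- After truncation, `1 - e^{-f}` is at most the indicator of a set of finite intensity.
  have hk : ∀ k, ∫⁻ ω, expNeg (∑' j, (spanningSets μ k).indicator f (X j ω)) ∂P
      = expNeg (∫⁻ x, (1 - expNeg ((spanningSets μ k).indicator f x)) ∂μ) := fun k => by
    have hfk : Measurable ((spanningSets μ k).indicator f) := hf.indicator (hs k)
    have hfi : ∫⁻ x, (1 - expNeg ((spanningSets μ k).indicator f x)) ∂μ ≠ ∞ := by
      refine ne_top_of_le_ne_top (measure_spanningSets_lt_top μ k).ne ?_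
      rw [← lintegral_indicator_one (hs k)]
      refine lintegral_mono fun x => ?_
      by_cases hx : x ∈ spanningSets μ k <;> simp [hx]
    have h := hc.lintegral_expNeg_tsum hw hfk hfi (n := 0) (Y := fun _ => 1) measurable_const
      (by simp)
    simpa [hc.time_zero, lapFactor] using h
  have h1 : Tendsto (fun k => ∫⁻ ω, expNeg (∑' j, (spanningSets μ k).indicator f (X j ω)) ∂P)
      atTop (𝓝 (∫⁻ ω, expNeg (∑' j, f (X j ω)) ∂P)) := by
    refine tendsto_lintegral_of_dominated_convergence (fun _ => 1)
      (fun k => measurable_expNeg.comp (Measurable.tsum fun j =>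
        (hf.indicator (hs k)).comp (hX j)))
      (fun k => ae_of_all _ fun ω => expNeg_le_one _) (by simp) (ae_of_all _ fun ω => ?_)
    exact (continuous_expNeg.tendsto _).comp (tendsto_tsum_indicator (monotone_spanningSets μ)
      (eventually_mem_spanningSets μ) f _)
  have h2 : Tendsto (fun k => expNeg (∫⁻ x, (1 - expNeg ((spanningSets μ k).indicator f x)) ∂μ))
      atTop (𝓝 (expNeg (∫⁻ x, (1 - expNeg (f x)) ∂μ))) := by
    refine (continuous_expNeg.tendsto _).comp (lintegral_tendsto_of_tendsto_of_monotone
      (fun k => (measurable_const.sub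
        (measurable_expNeg.comp (hf.indicator (hs k)))).aemeasurable)
      (ae_of_all _ fun x k l hkl => ?_) (ae_of_all _ fun x => ?_))
    · exact tsub_le_tsub_left (expNeg_antitone (Set.indicator_le_indicator_of_subset
        (monotone_spanningSets μ hkl) (fun _ => zero_le) _)) _
    · refine tendsto_const_nhds.congr' ?_
      filter_upwards [eventually_mem_spanningSets μ x] with k hk
      rw [Set.indicator_of_mem hk]
  simp_rw [hk] at h1
  exact tendsto_nhds_unique h1 h2

omit [SFinite μ] in
/-- The size-biased choice of the next mark, tested against Laplace functionals. -/
theorem lintegral_sizeBiased [IsProbabilityMeasure P] [SigmaFinite μ] {f : E → ℝ≥0∞}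
    (hf : Measurable f) {B : Set E} (hB : MeasurableSet B)
    {n : ℕ} {Y : Ω → ℝ≥0∞} (hY : Measurable[F n] Y) (hYi : ∫⁻ ω, Y ω ∂P ≠ ∞) :
    ∫⁻ ω, Y ω * B.indicator 1 (X n ω) * expNeg (∑' j, f (X (n + j) ω)) ∂P
      = ∫⁻ ω, Y ω * ((∑' k, ENNReal.ofReal (w (X (n + k) ω)))⁻¹ *
          ∑' k, B.indicator 1 (X (n + k) ω) * ENNReal.ofReal (w (X (n + k) ω))) *
          expNeg (∑' j, f (X (n + j) ω)) ∂P := by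
  have hs := measurableSet_spanningSets μ
  have hX := hc.measurable_mark'
  have hwm := hw.measurable
  have hB'' : Measurable (B.indicator (1 : E → ℝ≥0∞)) := measurable_one.indicator hB
  have hYm : Measurable Y := hY.mono (F.le n) le_rfl
  have hZ := hc.measurable_tsum_mark (f := fun x => ENNReal.ofReal (w x)) (by fun_prop) n
  have hZB := hc.measurable_tsum_mark
    (f := fun x => B.indicator 1 x * ENNReal.ofReal (w x)) (by fun_prop) n
  have hlim : ∀ V : Ω → ℝ≥0∞, Measurable V → (∀ ω, V ω ≤ Y ω) →
      Tendsto (fun k => ∫⁻ ω, V ω * expNeg (∑' j, (spanningSets μ k).indicator f (X (n + j) ω)) ∂P)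
        atTop (𝓝 (∫⁻ ω, V ω * expNeg (∑' j, f (X (n + j) ω)) ∂P)) := fun V hV hVY => by
    refine tendsto_lintegral_of_dominated_convergence Y
      (fun k => hV.mul (measurable_expNeg.comp (Measurable.tsum fun j =>
        (hf.indicator (hs k)).comp (hX (n + j)))))
      (fun k => ae_of_all _ fun ω => (mul_le_of_le_one_right' (expNeg_le_one _)).trans (hVY ω))
      hYi ?_
    have hYt : ∀ᵐ ω ∂P, Y ω ≠ ∞ := (ae_lt_top hYm hYi).mono fun x hx => hx.ne
    filter_upwards [hYt] with ω hω
    exact ENNReal.Tendsto.const_mul ((continuous_expNeg.tendsto _).comp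
      (tendsto_tsum_indicator (monotone_spanningSets μ) (eventually_mem_spanningSets μ) f _))
      (Or.inr (ne_top_of_le_ne_top hω (hVY ω)))
  have h1 := hlim (fun ω => Y ω * B.indicator 1 (X n ω)) (by fun_prop) fun ω => by
    by_cases hx : X n ω ∈ B <;> simp [hx]
  have h2 := hlim (fun ω => Y ω * ((∑' k, ENNReal.ofReal (w (X (n + k) ω)))⁻¹ *
      ∑' k, B.indicator 1 (X (n + k) ω) * ENNReal.ofReal (w (X (n + k) ω)))) (by fun_prop)
      fun ω => by
    refine mul_le_of_le_one_right' ?_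
    refine le_trans (mul_le_mul' le_rfl (ENNReal.tsum_le_tsum
      (g := fun k => ENNReal.ofReal (w (X (n + k) ω))) fun k => ?_)) (ENNReal.inv_mul_le_one _)
    by_cases hx : X (n + k) ω ∈ B <;> simp [hx]
  refine tendsto_nhds_unique (h1.congr fun k => ?_) h2
  refine hc.lintegral_sizeBiased_of_ne_top hw (hf.indicator (hs k)) ?_ hB hY hYi
  refine ne_top_of_le_ne_top (measure_spanningSets_lt_top μ k).ne ?_
  rw [← lintegral_indicator_one (hs k)]
  refine lintegral_mono fun x => ?_
  by_cases hx : x ∈ spanningSets μ k <;> simp [hx]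

end IsSizeBiasedChain

end Chain

end MixedGG

namespace MixedGG

open Filter Topology

/-! ### The marks form a Poisson random measure, in size-biased order -/

/-- A finite measure on `[0, ∞]` is determined by its Laplace transform. -/
theorem ext_of_lintegral_expNeg_mul {ν₁ ν₂ : Measure ℝ≥0∞} [IsFiniteMeasure ν₁]
    [IsFiniteMeasure ν₂]
    (h : ∀ a : ℕ, ∫⁻ x, expNeg (a * x) ∂ν₁ = ∫⁻ x, expNeg (a * x) ∂ν₂) : ν₁ = ν₂ := by
  have hm : Measurable fun (x : ℝ≥0∞) (_ : Unit) => x := by fun_prop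
  have key : ν₁.map (fun x (_ : Unit) => x) = ν₂.map (fun x (_ : Unit) => x) := by
    refine ext_of_lintegral_expNeg fun a => ?_
    have hg : Measurable fun x : Unit → ℝ≥0∞ => expNeg (∑ i, a i * x i) := by fun_prop
    rw [lintegral_map hg hm, lintegral_map hg hm]
    simpa using h (a ())
  have h2 := congrArg (fun ν => Measure.map (fun y : Unit → ℝ≥0∞ => y ()) ν) key
  simpa [Measure.map_map (measurable_pi_apply ()) hm, Function.comp_def] using h2

lemma lintegral_expNeg_poissonMeasure (r : NNReal) (a : ℕ) :
    ∫⁻ x, expNeg (a * x) ∂((poissonMeasure r).map (fun k : ℕ => (k : ℝ≥0∞)))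
      = expNeg ((1 - expNeg a) * r) := by
  have hm : Measurable fun x : ℝ≥0∞ => expNeg (a * x) := by fun_prop
  set q : ℝ := Real.exp (-a)
  have hq : expNeg (a : ℝ≥0∞) = ENNReal.ofReal q := by
    rw [← ENNReal.ofReal_natCast, expNeg_ofReal (Nat.cast_nonneg a)]
  have hq1 : q ≤ 1 := Real.exp_le_one_iff.2 (by simp)
  have hq0 : 0 < q := Real.exp_pos _
  rw [lintegral_map hm measurable_from_top, poissonMeasure, lintegral_sum_measure]
  have e : ∀ n : ℕ, ∫⁻ k : ℕ, expNeg (a * k)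
        ∂(ENNReal.ofReal (Real.exp (-r) * r ^ n / n.factorial) • Measure.dirac n)
      = ENNReal.ofReal (Real.exp (-r) * ((r * q) ^ n / n.factorial)) := fun n => by
    rw [lintegral_smul_measure, lintegral_dirac, mul_comm (a : ℝ≥0∞), expNeg_nsmul, hq,
      ← ENNReal.ofReal_pow hq0.le, smul_eq_mul, ← ENNReal.ofReal_mul (by positivity)]
    congr 1
    rw [mul_pow]; ring
  simp_rw [e]
  have hs : HasSum (fun n : ℕ => Real.exp (-r) * (((r : ℝ) * q) ^ n / n.factorial))
      (Real.exp (-r) * Real.exp (r * q)) := by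
    refine HasSum.mul_left _ ?_
    rw [Real.exp_eq_exp_ℝ]
    exact NormedSpace.expSeries_div_hasSum_exp _
  rw [← ENNReal.ofReal_tsum_of_nonneg (fun n => by positivity) hs.summable, hs.tsum_eq, hq,
    ← ENNReal.ofReal_one, ← ENNReal.ofReal_sub _ hq0.le, ← ENNReal.ofReal_coe_nnreal,
    ← ENNReal.ofReal_mul (by linarith), expNeg_ofReal (mul_nonneg (by linarith) r.coe_nonneg),
    ← Real.exp_add]
  congr 2
  ring

lemma lintegral_sum_dirac {E : Type*} [MeasurableSpace E] {f : E → ℝ≥0∞} (hf : Measurable f)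
    (x : ℕ → E) : ∫⁻ y, f y ∂(Measure.sum fun j => Measure.dirac (x j)) = ∑' j, f (x j) := by
  rw [lintegral_sum_measure]
  simp_rw [lintegral_dirac' _ hf]

lemma measurable_sum_dirac {Ω E : Type*} [MeasurableSpace Ω] [MeasurableSpace E] {X : ℕ → Ω → E}
    (hX : ∀ j, Measurable (X j)) :
    Measurable fun ω => Measure.sum fun j => Measure.dirac (X j ω) := by
  refine Measure.measurable_of_measurable_coe _ fun B hB => ?_
  simp_rw [Measure.sum_apply _ hB, Measure.dirac_apply' _ hB]
  exact Measurable.tsum fun j => (measurable_one.indicator hB).comp (hX j)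

/-- At most one indicator is nonzero at `x`. Disjointness thus makes the Poisson exponent additive,
and the Laplace transform a product. -/
lemma one_sub_expNeg_sum_indicator {E ι : Type*} [Fintype ι] {B : ι → Set E}
    (hd : Pairwise fun i j => Disjoint (B i) (B j)) (a : ι → ℝ≥0∞) (x : E) :
    1 - expNeg (∑ i, a i * (B i).indicator 1 x)
      = ∑ i, (1 - expNeg (a i)) * (B i).indicator 1 x := by
  classical
  by_cases hx : ∃ i, x ∈ B i
  · obtain ⟨i, hi⟩ := hx
    have hj : ∀ j, j ≠ i → x ∉ B j := fun j hj hxj =>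
      Set.disjoint_left.1 (hd hj) hxj hi
    rw [Finset.sum_eq_single i (fun j _ h => by simp [hj j h]) (by simp),
      Finset.sum_eq_single i (fun j _ h => by simp [hj j h]) (by simp)]
    simp [hi]
  · push Not at hx
    simp [hx]

section Chain

variable {Ω E : Type*} [mΩ : MeasurableSpace Ω] [MeasurableSpace E]
  {P : Measure Ω} {F : Filtration ℕ mΩ} {μ : Measure E} {w : E → ℝ}
  {T : ℕ → Ω → ℝ} {X : ℕ → Ω → E}

namespace IsSizeBiasedChain

variable (hc : IsSizeBiasedChain P F μ w T X) [SigmaFinite μ] (hw : IsLaplaceWeight μ w)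
  [IsProbabilityMeasure P]
include hc hw

/-- The Laplace functional at `f = ∑ a_i 1_{B_i}`. Its product form yields both the Poisson counts
and their independence. -/
lemma lintegral_expNeg_sum_count {ι : Type*} [Fintype ι] {B : ι → Set E}
    (hB : ∀ i, MeasurableSet (B i)) (hd : Pairwise fun i j => Disjoint (B i) (B j))
    (a : ι → ℝ≥0∞) :
    ∫⁻ ω, expNeg (∑ i, a i * (Measure.sum fun j => Measure.dirac (X j ω)) (B i)) ∂P
      = ∏ i, expNeg ((1 - expNeg (a i)) * μ (B i)) := by
  have hBm : ∀ i, Measurable ((B i).indicator (1 : E → ℝ≥0∞)) := fun i =>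
    measurable_one.indicator (hB i)
  have hf : Measurable fun x => ∑ i, a i * (B i).indicator 1 x :=
    Finset.measurable_fun_sum _ fun i _ => (hBm i).const_mul _
  have e : ∀ ω, ∑ i, a i * (Measure.sum fun j => Measure.dirac (X j ω)) (B i)
      = ∑' j, ∑ i, a i * (B i).indicator 1 (X j ω) := fun ω => by
    rw [← lintegral_sum_dirac hf (fun j => X j ω),
      lintegral_finsetSum _ fun i _ => (hBm i).const_mul _]
    refine Finset.sum_congr rfl fun i _ => ?_
    rw [lintegral_const_mul _ (hBm i), lintegral_indicator_one (hB i)]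
  simp_rw [e]
  rw [hc.lintegral_expNeg_tsum_mark hw hf]
  simp_rw [one_sub_expNeg_sum_indicator hd]
  rw [lintegral_finsetSum _ fun i _ => (hBm i).const_mul _, expNeg_sum]
  refine Finset.prod_congr rfl fun i _ => ?_
  rw [lintegral_const_mul _ (hBm i), lintegral_indicator_one (hB i)]

lemma lintegral_expNeg_count {B : Set E} (hB : MeasurableSet B) (a : ℝ≥0∞) :
    ∫⁻ ω, expNeg (a * (Measure.sum fun j => Measure.dirac (X j ω)) B) ∂P
      = expNeg ((1 - expNeg a) * μ B) := by
  have := hc.lintegral_expNeg_sum_count hw (ι := Unit) (B := fun _ => B) (fun _ => hB)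
    (fun i j hij => (hij (Subsingleton.elim _ _)).elim) (fun _ => a)
  simpa using this

/-- The marks of a size-biased chain form a Poisson random measure. -/
theorem isPoissonRandomMeasure :
    IsPoissonRandomMeasure P (fun ω => Measure.sum fun j => Measure.dirac (X j ω)) μ := by
  have hN : Measurable fun ω => Measure.sum fun j => Measure.dirac (X j ω) :=
    measurable_sum_dirac hc.measurable_mark'
  have hNB : ∀ B : Set E, MeasurableSet B →
      Measurable fun ω => (Measure.sum fun j => Measure.dirac (X j ω)) B := fun B hB =>
    (Measure.measurable_coe hB).comp hN
  refine ⟨hN, fun B hB hfin => ⟨(hNB B hB).aemeasurable, ?_⟩, fun B hB htop => ?_,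
    fun n B hB hd => ?_⟩
  · have : IsProbabilityMeasure (P.map fun ω => (Measure.sum fun j => Measure.dirac (X j ω)) B) :=
      Measure.isProbabilityMeasure_map (hNB B hB).aemeasurable
    have : IsProbabilityMeasure
        ((poissonMeasure (μ B).toNNReal).map (fun k : ℕ => (k : ℝ≥0∞))) :=
      Measure.isProbabilityMeasure_map measurable_from_top.aemeasurable
    refine ext_of_lintegral_expNeg_mul fun a => ?_
    rw [lintegral_map (by fun_prop) (hNB B hB), hc.lintegral_expNeg_count hw hB,
      lintegral_expNeg_poissonMeasure, ENNReal.coe_toNNReal hfin]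
  -- At `a = 1` the expectation of `e^{-N(B)}` is `e^{-∞} = 0`, which forces `N(B) = ∞` almost
  -- surely.
  · have h := hc.lintegral_expNeg_count hw hB 1
    have h1 : (1 : ℝ≥0∞) - expNeg 1 ≠ 0 := by
      rw [Ne, tsub_eq_zero_iff_le, not_le, ← ENNReal.ofReal_one, expNeg_ofReal zero_le_one]
      exact (ENNReal.ofReal_lt_ofReal_iff one_pos).2 (by simp)
    rw [htop, ENNReal.mul_top h1, expNeg_top] at h
    simp only [one_mul] at h
    have h' := (lintegral_eq_zero_iff (measurable_expNeg.comp (hNB B hB))).1 h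
    filter_upwards [h'] with ω hω
    exact expNeg_eq_zero.1 hω
  · rw [iIndepFun_iff_map_fun_eq_pi_map fun i => (hNB _ (hB i)).aemeasurable]
    have hprob : ∀ i, IsProbabilityMeasure
        (P.map fun ω => (Measure.sum fun j => Measure.dirac (X j ω)) (B i)) := fun i =>
      Measure.isProbabilityMeasure_map (hNB _ (hB i)).aemeasurable
    have hv : Measurable fun ω i => (Measure.sum fun j => Measure.dirac (X j ω)) (B i) :=
      measurable_pi_lambda _ fun i => hNB _ (hB i)
    refine ext_of_lintegral_expNeg fun a => ?_
    rw [lintegral_map (by fun_prop) hv, hc.lintegral_expNeg_sum_count hw hB hd]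
    simp_rw [expNeg_sum]
    rw [lintegral_prod_eq_prod_lintegral_of_indepFun Finset.univ
      (fun i (x : Fin n → ℝ≥0∞) => expNeg (a i * x i))
      (iIndepFun_pi (X := fun i (x : ℝ≥0∞) => expNeg (a i * x)) fun i => by fun_prop)
      (fun i => by fun_prop)]
    refine Finset.prod_congr rfl fun i _ => ?_
    have hme : MeasurePreserving (fun x : Fin n → ℝ≥0∞ => x i) (Measure.pi fun i =>
        P.map fun ω => (Measure.sum fun j => Measure.dirac (X j ω)) (B i))
        (P.map fun ω => (Measure.sum fun j => Measure.dirac (X j ω)) (B i)) :=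
      measurePreserving_eval _ i
    rw [hme.lintegral_comp (f := fun y => expNeg (a i * y)) (by fun_prop),
      lintegral_map (by fun_prop) (hNB _ (hB i)), hc.lintegral_expNeg_count hw (hB i)]

/-- Given the configuration of the marks and the first `n` of them, the next mark of a size-biased
chain is drawn from the remaining ones with probabilities proportional to their weights. -/
theorem hasConditionalLaw (n : ℕ) :
    HasConditionalLaw P (X n)
      (MeasurableSpace.comap
        (fun ω => (Measure.sum fun j => Measure.dirac (X j ω), fun i : Fin n => X i ω))
        inferInstance)
      (fun ω => (∑' k, ENNReal.ofReal (w (X (n + k) ω)))⁻¹ •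
        Measure.sum fun k => ENNReal.ofReal (w (X (n + k) ω)) • Measure.dirac (X (n + k) ω)) := by
  intro B hB
  have hX := hc.measurable_mark'
  have hwm := hw.measurable
  have hBm : Measurable (B.indicator (1 : E → ℝ≥0∞)) := measurable_one.indicator hB
  set N : Ω → Measure E := fun ω => Measure.sum fun j => Measure.dirac (X j ω) with hNdef
  have hN : Measurable N := measurable_sum_dirac hX
  set Φ : Ω → Measure E × (Fin n → E) := fun ω => (N ω, fun i : Fin n => X i ω)
  have hΦ : Measurable Φ := hN.prodMk (measurable_pi_lambda _ fun i => hX i)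
  have hZ := hc.measurable_tsum_mark (f := fun x => ENNReal.ofReal (w x)) (by fun_prop) n
  have hZB := hc.measurable_tsum_mark
    (f := fun x => B.indicator 1 x * ENNReal.ofReal (w x)) (by fun_prop) n
  set p : Ω → ℝ≥0∞ := fun ω => (∑' k, ENNReal.ofReal (w (X (n + k) ω)))⁻¹ *
    ∑' k, B.indicator 1 (X (n + k) ω) * ENNReal.ofReal (w (X (n + k) ω)) with hp
  have hpm : Measurable p := by fun_prop
  have hp1 : ∀ ω, p ω ≤ 1 := fun ω => by
    refine le_trans (mul_le_mul' le_rfl (ENNReal.tsum_le_tsum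
      (g := fun k => ENNReal.ofReal (w (X (n + k) ω))) fun k => ?_)) (ENNReal.inv_mul_le_one _)
    by_cases hx : X (n + k) ω ∈ B <;> simp [hx]
  have hκ : (fun ω => ((∑' k, ENNReal.ofReal (w (X (n + k) ω)))⁻¹ •
        Measure.sum fun k => ENNReal.ofReal (w (X (n + k) ω)) •
          Measure.dirac (X (n + k) ω)).real B) = fun ω => (p ω).toReal := by
    ext ω
    rw [measureReal_def, Measure.smul_apply, Measure.sum_apply _ hB, smul_eq_mul]
    congr 2
    refine tsum_congr fun k => ?_
    rw [Measure.smul_apply, Measure.dirac_apply' _ hB, smul_eq_mul, mul_comm]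
  rw [hκ]
  -- the pick is a function of the configuration and of the first marks
  have htail : ∀ {f : E → ℝ≥0∞}, Measurable f → (∀ x, f x ≠ ∞) →
      Measurable[MeasurableSpace.comap Φ inferInstance] fun ω => ∑' k, f (X (n + k) ω) := by
    intro f hf hft
    have h1 : Measurable fun q : Measure E × (Fin n → E) => ∫⁻ x, f x ∂q.1 - ∑ i, f (q.2 i) :=
      ((Measure.measurable_lintegral hf).comp measurable_fst).sub
        (Finset.measurable_fun_sum _ fun i _ =>
          hf.comp ((measurable_pi_apply i).comp measurable_snd))
    -- The tail sum is the integral against the configuration minus the first `n` terms. Only those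
    -- terms have to be finite for the subtraction.
    have h2 : (fun ω => ∑' k, f (X (n + k) ω))
        = (fun q : Measure E × (Fin n → E) => ∫⁻ x, f x ∂q.1 - ∑ i, f (q.2 i)) ∘ Φ := by
      ext ω
      simp only [Φ, Function.comp, N]
      rw [lintegral_sum_dirac hf (fun j => X j ω), Fin.sum_univ_eq_sum_range (fun i => f (X i ω)) n,
        ← Summable.sum_add_tsum_nat_add' (f := fun j => f (X j ω)) (k := n) ENNReal.summable,
        ENNReal.add_sub_cancel_left (ENNReal.sum_ne_top.2 fun i _ => hft _)]
      simp only [add_comm n]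
    rw [h2]
    exact h1.comp (comap_measurable Φ)
  have hpΦ : Measurable[MeasurableSpace.comap Φ inferInstance] p :=
    Measurable.mul (Measurable.inv (htail (f := fun x => ENNReal.ofReal (w x)) (by fun_prop)
      fun x => ENNReal.ofReal_ne_top))
      (htail (f := fun x => B.indicator 1 x * ENNReal.ofReal (w x)) (by fun_prop)
        fun x => ENNReal.mul_ne_top (by by_cases hx : x ∈ B <;> simp [hx]) ENNReal.ofReal_ne_top)
  have hXB : MeasurableSet (X n ⁻¹' B) := hX n hB
  have hind : Measurable fun ω => B.indicator (1 : E → ℝ≥0∞) (X n ω) := hBm.comp (hX n)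
  have hind1 : ∀ ω, B.indicator (1 : E → ℝ≥0∞) (X n ω) ≤ 1 := fun ω => by
    by_cases hx : X n ω ∈ B <;> simp [hx]
  -- both laws agree
  have hlaw : (P.withDensity fun ω => B.indicator 1 (X n ω)).map Φ
      = (P.withDensity p).map Φ := by
    have : IsFiniteMeasure (P.withDensity fun ω => B.indicator 1 (X n ω)) :=
      isFiniteMeasure_withDensity (ne_top_of_le_ne_top (b := ∫⁻ _, 1 ∂P) (by simp)
        (lintegral_mono hind1))
    have : IsFiniteMeasure (P.withDensity p) :=
      isFiniteMeasure_withDensity (ne_top_of_le_ne_top (b := ∫⁻ _, 1 ∂P) (by simp)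
        (lintegral_mono hp1))
    refine ext_prod_of_lintegral_expNeg_lintegral fun f hf C hC => ?_
    have hg : Measurable fun q : Measure E × (Fin n → E) =>
        C.indicator (1 : (Fin n → E) → ℝ≥0∞) q.2 * expNeg (∫⁻ x, f x ∂q.1) :=
      ((measurable_one.indicator hC).comp measurable_snd).mul
        (measurable_expNeg.comp ((Measure.measurable_lintegral hf).comp measurable_fst))
    have hgΦ : Measurable fun ω => C.indicator (1 : (Fin n → E) → ℝ≥0∞) (Φ ω).2 *
        expNeg (∫⁻ x, f x ∂(Φ ω).1) := hg.comp hΦ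
    rw [lintegral_map hg hΦ, lintegral_map hg hΦ,
      lintegral_withDensity_eq_lintegral_mul _ hind hgΦ,
      lintegral_withDensity_eq_lintegral_mul _ hpm hgΦ]
    -- `e^{-∫ f dN}` factors into the first `n` marks, which join the event `C` in the past, and the
    -- future marks.
    set Y : Ω → ℝ≥0∞ := fun ω => C.indicator 1 (fun i : Fin n => X i ω) *
      expNeg (∑ j ∈ Finset.range n, f (X j ω))
    have hY : Measurable[F n] Y := by
      have hpast : Measurable[F n] fun ω (i : Fin n) => X i ω :=
        @measurable_pi_lambda _ _ _ (F n) _ _ fun i =>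
          (hc.measurable_mark i).mono (F.mono i.2) le_rfl
      refine ((measurable_one.indicator hC).comp hpast).mul (measurable_expNeg.comp ?_)
      have h := hc.measurable_sum_mark hf 0 n
      simp only [zero_add] at h
      exact h.mono (F.mono (zero_add n).le) le_rfl
    have hYi : ∫⁻ ω, Y ω ∂P ≠ ∞ := by
      refine ne_top_of_le_ne_top (b := ∫⁻ _, 1 ∂P) (by simp) (lintegral_mono fun ω => ?_)
      refine mul_le_one' ?_ (expNeg_le_one _)
      by_cases hx : (fun i : Fin n => X i ω) ∈ C <;> simp [hx]
    have hYg : ∀ ω, C.indicator 1 (Φ ω).2 * expNeg (∫⁻ x, f x ∂(Φ ω).1)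
        = Y ω * expNeg (∑' j, f (X (n + j) ω)) := fun ω => by
      simp only [Φ, N, Y]
      rw [lintegral_sum_dirac hf (fun j => X j ω),
        ← Summable.sum_add_tsum_nat_add' (f := fun j => f (X j ω)) (k := n) ENNReal.summable,
        expNeg_add]
      simp only [add_comm n, mul_assoc]
    have key := hc.lintegral_sizeBiased hw hf hB hY hYi
    simp only [Pi.mul_apply, hYg]
    calc _ = _ := lintegral_congr fun ω => by ring
      _ = _ := key
      _ = _ := lintegral_congr fun ω => by simp only [hp]; ring
  symm
  refine ae_eq_condExp_of_forall_setIntegral_eq hΦ.comap_le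
    ((integrable_const 1).indicator hXB) (fun s _ _ => ?_) (fun s hs _ => ?_) ?_
  · refine Integrable.integrableOn ?_
    refine integrable_toReal_of_lintegral_ne_top hpm.aemeasurable ?_
    exact ne_top_of_le_ne_top (b := ∫⁻ _, 1 ∂P) (by simp) (lintegral_mono hp1)
  · obtain ⟨D, hD, rfl⟩ := hs
    have h1 := congrArg (fun ν => ν D) hlaw
    simp only [Measure.map_apply hΦ hD, withDensity_apply _ (hΦ hD)] at h1
    rw [integral_toReal hpm.aemeasurable
      (ae_of_all _ fun ω => (hp1 ω).trans_lt ENNReal.one_lt_top), ← h1]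
    have e : ∀ ω, B.indicator (1 : E → ℝ≥0∞) (X n ω) = (X n ⁻¹' B).indicator 1 ω := fun ω => rfl
    simp_rw [e]
    rw [lintegral_indicator_one hXB, integral_indicator hXB]
    simp [measureReal_def]
  · exact (hpΦ.ennreal_toReal).stronglyMeasurable.aestronglyMeasurable

end IsSizeBiasedChain

end Chain

end MixedGG

namespace MixedGG

open Filter Topology

/-! ### The mixed generalized gamma Lévy measure -/

/-- The reciprocal of Gamma is entire, so `1 / Γ(1 - s)` is continuous up to `s = 1` and the case `α
= 1` needs no separate treatment. -/
lemma continuous_one_div_Gamma : Continuous fun s : ℝ => (Real.Gamma s)⁻¹ := by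
  have h : (fun s : ℝ => (Real.Gamma s)⁻¹) = fun s : ℝ => ((Complex.Gamma s)⁻¹).re := by
    ext s
    rw [Complex.Gamma_ofReal, ← Complex.ofReal_inv, Complex.ofReal_re]
  rw [h]
  exact Complex.continuous_re.comp
    (Complex.differentiable_one_div_Gamma.continuous.comp Complex.continuous_ofReal)

@[fun_prop]
lemma measurable_Gamma : Measurable Real.Gamma := by
  have := continuous_one_div_Gamma.measurable.inv
  simpa [Pi.inv_def] using this

lemma setLIntegral_Ioi_comp_mul_left {c : ℝ} (hc : 0 < c) (f : ℝ → ℝ≥0∞) :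
    ∫⁻ x in Set.Ioi 0, f x = ∫⁻ x in Set.Ioi 0, ENNReal.ofReal c * f (c * x) := by
  have himg : (fun x => c * x) '' Set.Ioi 0 = Set.Ioi 0 := by
    ext x
    simp only [Set.mem_image, Set.mem_Ioi]
    exact ⟨by rintro ⟨y, hy, rfl⟩; positivity, fun hx => ⟨x / c, by positivity, by field_simp⟩⟩
  have h := lintegral_image_eq_lintegral_abs_deriv_mul (f := fun x => c * x) (f' := fun _ => c)
    (measurableSet_Ioi (a := 0)) (fun x _ => by
      simpa using ((hasDerivAt_id x).const_mul c).hasDerivWithinAt)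
    (mul_right_injective₀ hc.ne').injOn f
  rw [himg, abs_of_pos hc] at h
  exact h

lemma lintegral_deriv_Ioc_of_nonneg {f f' : ℝ → ℝ} {a b : ℝ} (hab : a ≤ b)
    (hcont : ContinuousOn f (Set.Icc a b)) (hd : ∀ x ∈ Set.Ioo a b, HasDerivAt f (f' x) x)
    (h0 : ∀ x ∈ Set.Ioo a b, 0 ≤ f' x) :
    ∫⁻ x in Set.Ioo a b, ENNReal.ofReal (f' x) = ENNReal.ofReal (f b - f a) := by
  have hi := intervalIntegral.integrableOn_deriv_of_nonneg hcont hd h0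
  rw [← intervalIntegral.integral_eq_sub_of_hasDerivAt_of_le hab hcont hd
    ((intervalIntegrable_iff_integrableOn_Ioc_of_le hab).2 hi),
    intervalIntegral.integral_of_le hab, integral_Ioc_eq_integral_Ioo,
    ofReal_integral_eq_lintegral_ofReal (hi.mono_set Set.Ioo_subset_Ioc_self)]
  exact (ae_restrict_iff' measurableSet_Ioo).2 (ae_of_all _ h0)

/-- The standing assumptions on the parameters. -/
structure IsMGGParam (α τ β c η : ℝ) : Prop where
  tau_nonneg : 0 ≤ τ
  tau_lt : τ < α
  le_one : α ≤ 1
  beta_nonneg : 0 ≤ β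
  c_pos : 0 < c
  eta_pos : 0 < η

lemma measurable_rhoMSt (α τ : ℝ) : Measurable fun w => rhoMSt w α τ := by
  unfold rhoMSt
  refine measurable_const.mul ?_
  have h : Measurable fun p : ℝ × ℝ => rhoSt p.1 p.2 := by unfold rhoSt; fun_prop
  simp_rw [intervalIntegral.intervalIntegral_eq_integral_uIoc]
  exact (h.stronglyMeasurable.integral_prod_right'
    (ν := volume.restrict (Set.uIoc τ α))).measurable.const_smul
      (if τ ≤ α then 1 else -1 : ℝ)

lemma measurable_rhoMGG (α τ β c η : ℝ) : Measurable (rhoMGG α τ β c η) := by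
  unfold rhoMGG
  have := measurable_rhoMSt α τ
  fun_prop

instance (ρ : ℝ → ℝ) : SigmaFinite (levyMeasure ρ) := by
  unfold levyMeasure
  exact SigmaFinite.withDensity_ofReal _

lemma ae_pos_levyMeasure (ρ : ℝ → ℝ) : ∀ᵐ x ∂levyMeasure ρ, 0 < x := by
  unfold levyMeasure
  exact (withDensity_absolutelyContinuous _ _).ae_le
    ((ae_restrict_iff' measurableSet_Ioi).2 (ae_of_all _ fun x hx => hx))

lemma lintegral_levyMeasure {ρ : ℝ → ℝ} (hρ : Measurable ρ) {φ : ℝ → ℝ≥0∞} (hφ : Measurable φ) :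
    ∫⁻ x, φ x ∂levyMeasure ρ = ∫⁻ x in Set.Ioi 0, φ x * ENNReal.ofReal (ρ x) := by
  rw [levyMeasure, lintegral_withDensity_eq_lintegral_mul _ (by fun_prop) hφ]
  exact lintegral_congr fun x => mul_comm _ _

/-- Base `0` is allowed for the sake of `β = 0`. On the open interval `s > 0`, hence `0 ^ s = 0`. -/
lemma integrableOn_rpow_param {x : ℝ} (hx : 0 ≤ x) {τ α : ℝ} (hτ : 0 ≤ τ) :
    IntegrableOn (fun s : ℝ => x ^ s) (Set.Ioo τ α) := by
  rcases hx.eq_or_lt with rfl | hx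
  · refine (integrableOn_zero (s := Set.Ioo τ α)).congr_fun (fun s hs => ?_) measurableSet_Ioo
    rw [Real.zero_rpow (hτ.trans_lt hs.1).ne']
  · refine (Continuous.integrableOn_Icc ?_).mono_set Set.Ioo_subset_Icc_self
    exact continuous_const.rpow continuous_id fun s => Or.inl hx.ne'

namespace IsMGGParam

variable {α τ β c η : ℝ} (hp : IsMGGParam α τ β c η)
include hp

lemma ofReal_rhoMSt {x : ℝ} (hx : 0 < x) :
    ENNReal.ofReal (rhoMSt x α τ) = ∫⁻ s in Set.Ioo τ α,
      ENNReal.ofReal ((α - τ)⁻¹ * (s / Real.Gamma (1 - s)) * x ^ (-1 - s)) := by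
  have hα : 0 < α - τ := sub_pos.2 hp.tau_lt
  have hi : IntegrableOn (fun s => rhoSt x s) (Set.Ioo τ α) := by
    refine (Continuous.integrableOn_Icc ?_).mono_set Set.Ioo_subset_Icc_self
    unfold rhoSt
    simp_rw [div_eq_mul_inv]
    exact (continuous_id.mul (continuous_one_div_Gamma.comp (by fun_prop))).mul
      (continuous_const.rpow (by fun_prop) fun s => Or.inl hx.ne')
  have h0 : ∀ s ∈ Set.Ioo τ α, 0 ≤ rhoSt x s := fun s hs => by
    unfold rhoSt
    have h1 : 0 ≤ s := hp.tau_nonneg.trans hs.1.le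
    have h2 : 0 < Real.Gamma (1 - s) := Real.Gamma_pos_of_pos (by linarith [hs.2, hp.le_one])
    positivity
  rw [rhoMSt, intervalIntegral.integral_of_le hp.tau_lt.le, integral_Ioc_eq_integral_Ioo,
    ENNReal.ofReal_mul (by positivity), ofReal_integral_eq_lintegral_ofReal hi
      ((ae_restrict_iff' measurableSet_Ioo).2 (ae_of_all _ h0)),
    ← lintegral_const_mul' _ _ ENNReal.ofReal_ne_top]
  refine lintegral_congr fun s => ?_
  rw [← ENNReal.ofReal_mul (by positivity), rhoSt, mul_assoc]

lemma rhoMGG_nonneg {x : ℝ} (hx : 0 < x) : 0 ≤ rhoMGG α τ β c η x := by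
  have hc := hp.c_pos
  have hη := hp.eta_pos
  have hα : 0 < α - τ := sub_pos.2 hp.tau_lt
  unfold rhoMGG rhoMSt
  have : 0 ≤ ∫ s in τ..α, rhoSt (x / c) s := by
    rw [intervalIntegral.integral_of_le hp.tau_lt.le, integral_Ioc_eq_integral_Ioo]
    refine setIntegral_nonneg measurableSet_Ioo fun s hs => ?_
    unfold rhoSt
    have h1 : 0 ≤ s := hp.tau_nonneg.trans hs.1.le
    have h2 : 0 < Real.Gamma (1 - s) := Real.Gamma_pos_of_pos (by linarith [hs.2, hp.le_one])
    positivity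
  positivity

/-- The Lévy measure as a mixture over the stability index. -/
lemma lintegral_levyMeasure_rhoMGG {φ : ℝ → ℝ≥0∞} (hφ : Measurable φ) :
    ∫⁻ x, φ x ∂levyMeasure (rhoMGG α τ β c η)
      = ∫⁻ s in Set.Ioo τ α, ∫⁻ x in Set.Ioi 0, φ (c * x) * ENNReal.ofReal
          (η / (α - τ) * (s / Real.Gamma (1 - s)) * x ^ (-1 - s) * Real.exp (-(β * x))) := by
  have hc := hp.c_pos
  have hη := hp.eta_pos
  have hα : 0 < α - τ := sub_pos.2 hp.tau_lt
  rw [lintegral_levyMeasure (measurable_rhoMGG _ _ _ _ _) hφ, setLIntegral_Ioi_comp_mul_left hc,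
    lintegral_lintegral_swap (by
      refine Measurable.aemeasurable ?_
      simp only [Function.uncurry_def]
      fun_prop)]
  refine setLIntegral_congr_fun measurableSet_Ioi fun x hx => ?_
  have hx0 : (0 : ℝ) < x := hx
  have e1 : ENNReal.ofReal (rhoMGG α τ β c η (c * x))
      = ENNReal.ofReal (η / c * Real.exp (-(β * x))) * ENNReal.ofReal (rhoMSt x α τ) := by
    rw [← ENNReal.ofReal_mul (by positivity), rhoMGG]
    congr 1
    rw [mul_div_cancel_left₀ _ hc.ne', show -β * (c * x) / c = -(β * x) by field_simp]
    ring
  rw [e1, hp.ofReal_rhoMSt hx0, ← lintegral_const_mul' _ _ ENNReal.ofReal_ne_top, ← mul_assoc,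
    ← lintegral_const_mul _ (by fun_prop)]
  refine lintegral_congr fun s => ?_
  rw [← ENNReal.ofReal_mul (by positivity), mul_comm (ENNReal.ofReal c), mul_assoc,
    ← ENNReal.ofReal_mul hc.le]
  congr 2
  field_simp

/-- The weighted, exponentially tilted Lévy measure as a mixture of Gamma distributions. -/
lemma lintegral_tilted_levyMeasure {φ : ℝ → ℝ≥0∞} (hφ : Measurable φ) {u : ℝ} (hu : 0 < u) :
    ∫⁻ x, φ x * ENNReal.ofReal (x * Real.exp (-(u * x))) ∂levyMeasure (rhoMGG α τ β c η)
      = ∫⁻ s in Set.Ioo τ α, ENNReal.ofReal (η * c / (α - τ) * (s * (c * u + β) ^ (s - 1))) *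
          ∫⁻ x, φ (c * x) ∂gammaMeasure (1 - s) (c * u + β) := by
  have hc := hp.c_pos
  have hη := hp.eta_pos
  have hβ := hp.beta_nonneg
  have hα : 0 < α - τ := sub_pos.2 hp.tau_lt
  have hv : 0 < c * u + β := by positivity
  rw [hp.lintegral_levyMeasure_rhoMGG (by fun_prop)]
  refine setLIntegral_congr_fun measurableSet_Ioo fun s hs => ?_
  have hs0 : 0 ≤ s := hp.tau_nonneg.trans hs.1.le
  have hs1 : 0 < 1 - s := by linarith [hs.2, hp.le_one]
  have hΓ : 0 < Real.Gamma (1 - s) := Real.Gamma_pos_of_pos hs1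
  have hgm : Measurable (gammaPDF (1 - s) (c * u + β)) :=
    (measurable_gammaPDFReal _ _).ennreal_ofReal
  have hsupp : ∫⁻ x, gammaPDF (1 - s) (c * u + β) x * φ (c * x)
      = ∫⁻ x in Set.Ioi 0, gammaPDF (1 - s) (c * u + β) x * φ (c * x) := by
    rw [setLIntegral_congr Ioi_ae_eq_Ici, ← lintegral_indicator measurableSet_Ici]
    refine lintegral_congr fun x => ?_
    by_cases hx : 0 ≤ x
    · simp [hx]
    · simp [hx, gammaPDF_of_neg (not_le.1 hx)]
  rw [gammaMeasure, lintegral_withDensity_eq_lintegral_mul _ hgm (by fun_prop)]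
  simp only [Pi.mul_apply]
  rw [hsupp, ← lintegral_const_mul' _ _ ENNReal.ofReal_ne_top]
  refine setLIntegral_congr_fun measurableSet_Ioi fun x hx => ?_
  have hx0 : (0 : ℝ) < x := hx
  rw [gammaPDF_of_nonneg hx0.le, mul_assoc, ← ENNReal.ofReal_mul (by positivity),
    ← mul_assoc (ENNReal.ofReal _), ← ENNReal.ofReal_mul (by positivity), mul_comm (φ _)]
  congr 2
  -- The size-biasing factor `x` raises the stable exponent `-1 - s` to the exponent of a Gamma
  -- density of shape `1 - s`.
  have h1 : x ^ (1 - s - 1) = x * x ^ (-1 - s) := by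
    rw [show 1 - s - 1 = 1 + (-1 - s) by ring, Real.rpow_add hx0, Real.rpow_one]
  have h2 : (c * u + β) ^ (s - 1) * (c * u + β) ^ (1 - s) = 1 := by
    rw [← Real.rpow_add hv]; simp
  have h3 : Real.exp (-((c * u + β) * x)) = Real.exp (-(u * (c * x))) * Real.exp (-(β * x)) := by
    rw [← Real.exp_add]; ring_nf
  rw [h1, h3]
  linear_combination (-(η * c / (α - τ) * s / Real.Gamma (1 - s) * x * x ^ (-1 - s) *
    Real.exp (-(u * (c * x))) * Real.exp (-(β * x)))) * h2

/-- The Laplace exponent of the mixed generalized gamma Lévy measure. -/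
lemma lintegral_one_sub_exp_levyMeasure {t : ℝ} (ht : 0 ≤ t) :
    ∫⁻ x, ENNReal.ofReal (1 - Real.exp (-(t * x))) ∂levyMeasure (rhoMGG α τ β c η)
      = ENNReal.ofReal (η * (psiMSt (c * t + β) α τ - psiMSt β α τ)) := by
  have hc := hp.c_pos
  have hη := hp.eta_pos
  have hβ := hp.beta_nonneg
  have hα : 0 < α - τ := sub_pos.2 hp.tau_lt
  -- `1 - e^{-tx} = ∫₀^t x e^{-ux} du`, which brings in the tilted measure already known as a Gamma
  -- mixture.
  have h1 : ∫⁻ x, ENNReal.ofReal (1 - Real.exp (-(t * x))) ∂levyMeasure (rhoMGG α τ β c η)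
      = ∫⁻ x, (∫⁻ u in Set.Ioo 0 t, ENNReal.ofReal (x * Real.exp (-(u * x))))
          ∂levyMeasure (rhoMGG α τ β c η) := by
    refine lintegral_congr_ae ?_
    filter_upwards [ae_pos_levyMeasure _] with x hx
    rw [lintegral_deriv_Ioc_of_nonneg (f := fun u => -Real.exp (-(u * x))) ht (by fun_prop)
      (fun u _ => by
        have := (((hasDerivAt_id u).mul_const x).neg.exp).neg
        convert! this using 1
        simp only [id, Pi.neg_apply]; ring) (fun u _ => by positivity)]
    congr 1
    simp; ring
  -- Each Gamma law has mass one, so only the mixing weights remain.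
  have h2 : ∀ u ∈ Set.Ioo 0 t,
      ∫⁻ x, ENNReal.ofReal (x * Real.exp (-(u * x))) ∂levyMeasure (rhoMGG α τ β c η)
        = ∫⁻ s in Set.Ioo τ α,
          ENNReal.ofReal (η * c / (α - τ) * (s * (c * u + β) ^ (s - 1))) := fun u hu => by
    have h := hp.lintegral_tilted_levyMeasure (φ := fun _ => 1) measurable_const hu.1
    simp only [one_mul, lintegral_const] at h
    rw [h]
    refine setLIntegral_congr_fun measurableSet_Ioo fun s hs => ?_
    have hu0 := hu.1
    have hv : 0 < c * u + β := by positivity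
    have := isProbabilityMeasure_gammaMeasure (a := 1 - s) (r := c * u + β)
      (by linarith [hs.2, hp.le_one]) hv
    simp
  -- The mixing weight is the derivative in `u` of `η / (α - τ) (c u + β) ^ s`. For `β = 0` this
  -- primitive is continuous at `u = 0` since `s > 0`.
  have h3 : ∀ s ∈ Set.Ioo τ α, ∫⁻ u in Set.Ioo 0 t,
      ENNReal.ofReal (η * c / (α - τ) * (s * (c * u + β) ^ (s - 1)))
        = ENNReal.ofReal (η / (α - τ) * ((c * t + β) ^ s - β ^ s)) := fun s hs => by
    have hs0 : 0 < s := hp.tau_nonneg.trans_lt hs.1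
    rw [lintegral_deriv_Ioc_of_nonneg (f := fun u => η / (α - τ) * (c * u + β) ^ s) ht]
    · congr 1; simp; ring
    · exact Continuous.continuousOn (continuous_const.mul
        (Continuous.rpow_const (by fun_prop) fun u => Or.inr hs0.le))
    · intro u hu
      have hu0 := hu.1
      have hv : 0 < c * u + β := by positivity
      have h := ((((hasDerivAt_id u).const_mul c).add_const β).rpow_const (p := s)
        (Or.inl hv.ne')).const_mul (η / (α - τ))
      convert! h using 1
      simp only [id]; ring
    · intro u hu
      have hu0 := hu.1
      positivity
  rw [h1, lintegral_lintegral_swap (by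
      refine Measurable.aemeasurable ?_
      simp only [Function.uncurry_def]
      fun_prop), setLIntegral_congr_fun measurableSet_Ioo h2, lintegral_lintegral_swap (by
      refine Measurable.aemeasurable ?_
      simp only [Function.uncurry_def]
      fun_prop), setLIntegral_congr_fun measurableSet_Ioo h3]
  have hi : IntegrableOn (fun s => (c * t + β) ^ s - β ^ s) (Set.Ioo τ α) :=
    (integrableOn_rpow_param (by positivity) hp.tau_nonneg).sub
      (integrableOn_rpow_param hβ hp.tau_nonneg)
  have h0 : ∀ s ∈ Set.Ioo τ α, 0 ≤ η / (α - τ) * ((c * t + β) ^ s - β ^ s) := fun s hs => by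
    have hs0 : 0 < s := hp.tau_nonneg.trans_lt hs.1
    have : β ^ s ≤ (c * t + β) ^ s := Real.rpow_le_rpow hβ (by nlinarith) hs0.le
    exact mul_nonneg (by positivity) (by linarith)
  rw [← ofReal_integral_eq_lintegral_ofReal (hi.const_mul _)
    ((ae_restrict_iff' measurableSet_Ioo).2 (ae_of_all _ h0)), integral_const_mul,
    integral_sub (integrableOn_rpow_param (by positivity) hp.tau_nonneg)
      (integrableOn_rpow_param hβ hp.tau_nonneg)]
  congr 1
  unfold psiMSt psiSt
  rw [intervalIntegral.integral_of_le hp.tau_lt.le, integral_Ioc_eq_integral_Ioo,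
    intervalIntegral.integral_of_le hp.tau_lt.le, integral_Ioc_eq_integral_Ioo]
  ring

lemma strictMonoOn_psiMSt : StrictMonoOn (fun t => psiMSt t α τ) (Set.Ici 0) := by
  intro x hx y hy hxy
  have hx0 : (0 : ℝ) ≤ x := hx
  have hy0 : (0 : ℝ) ≤ y := hy
  have hα : 0 < α - τ := sub_pos.2 hp.tau_lt
  have hi : ∀ z : ℝ, 0 ≤ z → IntervalIntegrable (fun s => z ^ s) volume τ α := fun z hz => by
    rw [intervalIntegrable_iff_integrableOn_Ioo_of_le hp.tau_lt.le]
    exact integrableOn_rpow_param hz hp.tau_nonneg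
  have h := intervalIntegral.intervalIntegral_pos_of_pos_on ((hi y hy).sub (hi x hx))
    (fun s hs => sub_pos.2 (Real.rpow_lt_rpow hx0 hxy (hp.tau_nonneg.trans_lt hs.1))) hp.tau_lt
  rw [intervalIntegral.integral_sub (hi y hy) (hi x hx)] at h
  exact mul_lt_mul_of_pos_left (sub_pos.1 h) (by positivity)

/-- Exponents above the midpoint `m` of `(τ, α)` make up half of the average, so `ψ(x) ≥ x^m / 2`
for `x ≥ 1`. The midpoint is positive even when `τ = 0`. -/
lemma tendsto_psiMSt : Tendsto (fun t => psiMSt t α τ) atTop atTop := by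
  have hα : 0 < α - τ := sub_pos.2 hp.tau_lt
  set m : ℝ := (τ + α) / 2
  have hm1 : τ < m := by simp only [m]; linarith [hp.tau_lt]
  have hm2 : m < α := by simp only [m]; linarith [hp.tau_lt]
  have hm0 : 0 < m := hp.tau_nonneg.trans_lt hm1
  refine tendsto_atTop_mono' _ ?_ ((tendsto_rpow_atTop hm0).const_mul_atTop (one_half_pos (α := ℝ)))
  filter_upwards [eventually_ge_atTop 1] with x hx
  have hx0 : 0 < x := by linarith
  have hcont : Continuous fun s : ℝ => x ^ s :=
    continuous_const.rpow continuous_id fun s => Or.inl hx0.ne'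
  have hi : ∀ a b : ℝ, IntervalIntegrable (fun s => x ^ s) volume a b := fun a b =>
    hcont.intervalIntegrable a b
  have h1 : ∫ s in m..α, x ^ m ≤ ∫ s in m..α, x ^ s :=
    intervalIntegral.integral_mono_on hm2.le intervalIntegrable_const (hi _ _) fun s hs =>
      Real.rpow_le_rpow_of_exponent_le hx hs.1
  have h2 : 0 ≤ ∫ s in τ..m, x ^ s :=
    intervalIntegral.integral_nonneg hm1.le fun s _ => by positivity
  have h3 : ∫ s in τ..α, x ^ s = (∫ s in τ..m, x ^ s) + ∫ s in m..α, x ^ s :=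
    (intervalIntegral.integral_add_adjacent_intervals (hi _ _) (hi _ _)).symm
  rw [intervalIntegral.integral_const, smul_eq_mul] at h1
  unfold psiMSt psiSt
  rw [inv_mul_eq_div, le_div_iff₀ hα, h3]
  have h4 : α - m = (α - τ) / 2 := by simp only [m]; ring
  rw [h4] at h1
  linarith

lemma isLevyIntensity : IsLevyIntensity (rhoMGG α τ β c η) where
  measurable := measurable_rhoMGG _ _ _ _ _
  nonneg w hw := hp.rhoMGG_nonneg hw
  lintegral_lt_top := by
    have h := hp.lintegral_one_sub_exp_levyMeasure zero_le_one
    rw [lintegral_levyMeasure (measurable_rhoMGG _ _ _ _ _) (by fun_prop)] at h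
    have e : ∀ w ∈ Set.Ioi (0 : ℝ), ENNReal.ofReal ((1 - Real.exp (-w)) * rhoMGG α τ β c η w)
        = ENNReal.ofReal (1 - Real.exp (-(1 * w))) * ENNReal.ofReal (rhoMGG α τ β c η w) :=
      fun w hw => by
        rw [one_mul, ENNReal.ofReal_mul' (hp.rhoMGG_nonneg hw)]
    rw [setLIntegral_congr_fun measurableSet_Ioi e, h]
    exact ENNReal.ofReal_lt_top

/-! ### The intensity `ρ_mGG(w) dw H(dθ)` with the weight `w` -/

section Weight

variable {Θ : Type*} [MeasurableSpace Θ] (H : Measure Θ) [IsProbabilityMeasure H]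

omit hp [IsProbabilityMeasure H] in
lemma ae_pos_fst [SFinite H] (ρ : ℝ → ℝ) : ∀ᵐ x ∂(levyMeasure ρ).prod H, 0 < x.1 :=
  Measure.quasiMeasurePreserving_fst.ae (ae_pos_levyMeasure ρ)

omit hp in
lemma lintegral_fst_prod (ρ : ℝ → ℝ) {φ : ℝ → ℝ≥0∞} (hφ : Measurable φ) :
    ∫⁻ x, φ x.1 ∂(levyMeasure ρ).prod H = ∫⁻ x, φ x ∂levyMeasure ρ := by
  rw [lintegral_prod _ (by fun_prop)]
  simp

lemma integrable_one_sub_exp_fst {t : ℝ} (ht : 0 ≤ t) :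
    Integrable (fun x : ℝ × Θ => 1 - Real.exp (-(t * x.1)))
      ((levyMeasure (rhoMGG α τ β c η)).prod H) := by
  refine ⟨(by fun_prop : Measurable _).aestronglyMeasurable, ?_⟩
  rw [hasFiniteIntegral_iff_ofReal]
  · rw [lintegral_fst_prod H _ (φ := fun x => ENNReal.ofReal (1 - Real.exp (-(t * x))))
      (by fun_prop), hp.lintegral_one_sub_exp_levyMeasure ht]
    exact ENNReal.ofReal_lt_top
  · filter_upwards [ae_pos_fst H _] with x hx
    have : Real.exp (-(t * x.1)) ≤ 1 := Real.exp_le_one_iff.2 (by simp; positivity)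
    simpa using this

/-- `H` has mass one, so only the weight matters. This formula links the chain to the function
inverted in the arrival times. -/
lemma lapExp_eq {t : ℝ} (ht : 0 ≤ t) :
    lapExp ((levyMeasure (rhoMGG α τ β c η)).prod H) Prod.fst t
      = η * (psiMSt (c * t + β) α τ - psiMSt β α τ) := by
  have hc := hp.c_pos
  have hη := hp.eta_pos
  have hβ := hp.beta_nonneg
  rw [lapExp, integral_eq_lintegral_of_nonneg_ae]
  · rw [lintegral_fst_prod H _ (φ := fun x => ENNReal.ofReal (1 - Real.exp (-(t * x))))
      (by fun_prop), hp.lintegral_one_sub_exp_levyMeasure ht, ENNReal.toReal_ofReal]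
    refine mul_nonneg hη.le (sub_nonneg.2 ?_)
    exact hp.strictMonoOn_psiMSt.monotoneOn hβ (by simp; positivity) (by nlinarith)
  · filter_upwards [ae_pos_fst H _] with x hx
    have : Real.exp (-(t * x.1)) ≤ 1 := Real.exp_le_one_iff.2 (by simp; positivity)
    simpa using this
  · exact (by fun_prop : Measurable _).aestronglyMeasurable

lemma isLaplaceWeight :
    IsLaplaceWeight ((levyMeasure (rhoMGG α τ β c η)).prod H) (Prod.fst : ℝ × Θ → ℝ) where
  measurable := measurable_fst
  pos := ae_pos_fst H _
  integrable t ht := hp.integrable_one_sub_exp_fst H ht.le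
  tendsto := by
    have h1 : Tendsto (fun t => η * (psiMSt (c * t + β) α τ - psiMSt β α τ)) atTop atTop := by
      refine Tendsto.const_mul_atTop hp.eta_pos (tendsto_atTop_add_const_right _ _ ?_)
      exact hp.tendsto_psiMSt.comp (tendsto_atTop_add_const_right _ _
        (tendsto_id.const_mul_atTop hp.c_pos))
    refine h1.congr' ?_
    filter_upwards [eventually_ge_atTop 0] with t ht
    rw [hp.lapExp_eq H ht]

end Weight

end IsMGGParam

end MixedGG

namespace MixedGG

open Filter Topology

/-! ### The exponential clock of a weighted measure -/

lemma lintegral_expMeasure_one {K : ℝ → ℝ≥0∞} (hK : Measurable K) :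
    ∫⁻ y, K y ∂expMeasure 1 = ∫⁻ y in Set.Ioi 0, ENNReal.ofReal (Real.exp (-y)) * K y := by
  have hgm : Measurable (gammaPDF 1 1) := (measurable_gammaPDFReal _ _).ennreal_ofReal
  rw [expMeasure, gammaMeasure, lintegral_withDensity_eq_lintegral_mul _ hgm hK,
    setLIntegral_congr Ioi_ae_eq_Ici, ← lintegral_indicator measurableSet_Ici]
  refine lintegral_congr fun x => ?_
  by_cases hx : 0 ≤ x
  · simp [hx, gammaPDF_of_nonneg hx]
  · simp [hx, gammaPDF_of_neg (not_le.1 hx)]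

lemma lintegral_Ioi_zero_comp_add {f : ℝ → ℝ≥0∞} (a : ℝ) :
    ∫⁻ y in Set.Ioi 0, f (a + y) = ∫⁻ y in Set.Ioi a, f y := by
  rw [← lintegral_indicator measurableSet_Ioi, ← lintegral_indicator measurableSet_Ioi,
    ← lintegral_add_left_eq_self (μ := volume) ((Set.Ioi a).indicator f) a]
  refine lintegral_congr fun y => ?_
  simp [Set.indicator]

namespace IsLaplaceWeight

variable {E : Type*} [MeasurableSpace E] {μ : Measure E} {w : E → ℝ} (hw : IsLaplaceWeight μ w)
include hw

lemma continuousOn_lapExp : ContinuousOn (lapExp μ w) (Set.Ici 0) := by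
  have h := hw.continuousOn_integral_tilted (G := fun _ => 1) measurable_const
    (fun _ => zero_le_one) (fun _ => le_rfl) (by simp)
  simp only [one_mul] at h
  exact h

lemma hasDerivAt_lapExp {t : ℝ} (ht : 0 < t) :
    HasDerivAt (lapExp μ w) (∫ x, w x * Real.exp (-(t * w x)) ∂μ) t := by
  have h := hw.hasDerivAt_integral_tilted (G := fun _ => 1) measurable_const
    (fun _ => zero_le_one) (fun _ => le_rfl) (by simp) ht
  simp only [one_mul] at h
  exact h

lemma image_lapExp_Ici : lapExp μ w '' Set.Ici 0 = Set.Ici 0 := by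
  have h0 : lapExp μ w 0 = 0 := by simp [lapExp]
  refine Set.Subset.antisymm ?_ ?_
  · rintro _ ⟨t, ht, rfl⟩
    have ht0 : (0 : ℝ) ≤ t := ht
    refine Set.mem_Ici.2 (integral_nonneg_of_ae ?_)
    filter_upwards [hw.pos] with x hx
    have : Real.exp (-(t * w x)) ≤ 1 := Real.exp_le_one_iff.2 (by simp; positivity)
    simpa using this
  · intro y hy
    obtain ⟨b, hb, hb0⟩ := ((hw.tendsto.eventually_ge_atTop y).and
      (eventually_ge_atTop 0)).exists
    obtain ⟨t, ht, rfl⟩ := intermediate_value_Icc hb0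
      (hw.continuousOn_lapExp.mono Set.Icc_subset_Ici_self) ⟨by rw [h0]; exact hy, hb⟩
    exact ⟨t, ht.1, rfl⟩

lemma image_lapExp_Ioi (hmono : StrictMonoOn (lapExp μ w) (Set.Ici 0)) {t : ℝ} (ht : 0 ≤ t) :
    lapExp μ w '' Set.Ioi t = Set.Ioi (lapExp μ w t) := by
  refine subset_antisymm ?_ fun y hy => ?_
  · rintro _ ⟨u, hu, rfl⟩
    have hu0 : t < u := hu
    exact hmono ht (ht.trans hu0.le) hu
  · have hy0 : lapExp μ w t < y := hy
    have h0 : 0 ≤ lapExp μ w t := hw.image_lapExp_Ici.le ⟨t, ht, rfl⟩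
    obtain ⟨u, hu, rfl⟩ := hw.image_lapExp_Ici.ge (h0.trans hy0.le)
    exact ⟨u, (hmono.lt_iff_lt ht hu).1 hy0, rfl⟩

/-- The exponential distribution, read on the scale of the Laplace exponent. -/
lemma lintegral_expMeasure_lapExp_add (hmono : StrictMonoOn (lapExp μ w) (Set.Ici 0))
    {K : ℝ → ℝ≥0∞} (hK : Measurable K) {t : ℝ} (ht : 0 ≤ t) :
    ∫⁻ y, K (lapExp μ w t + y) ∂expMeasure 1
      = ∫⁻ u in Set.Ioi t, ENNReal.ofReal (∫ x, w x * Real.exp (-(u * w x)) ∂μ) *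
          (ENNReal.ofReal (Real.exp (-(lapExp μ w u - lapExp μ w t))) * K (lapExp μ w u)) := by
  rw [lintegral_expMeasure_one (by fun_prop)]
  -- The exponential variable is shifted to start at `Λ(t)`; the change of variables `y = Λ(u)` then
  -- produces the rate `Λ'(u)`.
  have h1 := lintegral_Ioi_zero_comp_add
    (f := fun y => ENNReal.ofReal (Real.exp (-(y - lapExp μ w t))) * K y) (lapExp μ w t)
  simp only [add_sub_cancel_left] at h1
  rw [h1, ← hw.image_lapExp_Ioi hmono ht,
    lintegral_image_eq_lintegral_abs_deriv_mul measurableSet_Ioi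
      (fun u hu => (hw.hasDerivAt_lapExp (ht.trans_lt hu)).hasDerivWithinAt)
      (hmono.injOn.mono fun u (hu : t < u) => ht.trans hu.le)]
  refine setLIntegral_congr_fun measurableSet_Ioi fun u _ => ?_
  rw [abs_of_nonneg]
  refine integral_nonneg_of_ae ?_
  filter_upwards [hw.pos] with x hx
  positivity

end IsLaplaceWeight

/-! ### The sampling kernel -/

/-- The arrival times as a function of the points `ξ`, in units of `1 / c`, and extended
by a constant to `ξ < 0`. -/
noncomputable def scaledTime (α τ β c η x : ℝ) : ℝ :=
  (psiMStInv (max x 0 / η + psiMSt β α τ) α τ - β) / c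

/-- The density of the stability index on `(τ, α)`, given the rate `v` of the weight. -/
noncomputable def indexPDF (α τ v s : ℝ) : ℝ≥0∞ :=
  ENNReal.ofReal (s * v ^ s / ∫ r in τ..α, r * v ^ r)

lemma measurable_indexPDF (α τ : ℝ) : Measurable fun p : ℝ × ℝ => indexPDF α τ p.1 p.2 := by
  have h : Measurable fun p : ℝ × ℝ => p.2 * p.1 ^ p.2 := by fun_prop
  have h1 : Measurable fun v : ℝ => ∫ r in τ..α, r * v ^ r := by
    simp_rw [intervalIntegral.intervalIntegral_eq_integral_uIoc]
    exact (h.stronglyMeasurable.integral_prod_right'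
      (ν := volume.restrict (Set.uIoc τ α))).measurable.const_smul
        (if τ ≤ α then 1 else -1 : ℝ)
  exact (h.div (h1.comp measurable_fst)).ennreal_ofReal

@[fun_prop]
lemma Measurable.indexPDF {A : Type*} [MeasurableSpace A] {f g : A → ℝ} (hf : Measurable f)
    (hg : Measurable g) {α τ : ℝ} : Measurable fun a => indexPDF α τ (f a) (g a) :=
  (measurable_indexPDF α τ).comp (hf.prodMk hg)

lemma measurable_gammaPDF_uncurry :
    Measurable fun p : ℝ × ℝ × ℝ => gammaPDF p.1 p.2.1 p.2.2 := by
  unfold gammaPDF gammaPDFReal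
  refine Measurable.ennreal_ofReal (Measurable.ite ?_ (by fun_prop) (by fun_prop))
  exact measurableSet_le (by fun_prop) (by fun_prop)

@[fun_prop]
lemma Measurable.gammaPDF {A : Type*} [MeasurableSpace A] {f g h : A → ℝ} (hf : Measurable f)
    (hg : Measurable g) (hh : Measurable h) : Measurable fun a => gammaPDF (f a) (g a) (h a) :=
  measurable_gammaPDF_uncurry.comp (hf.prodMk (hg.prodMk hh))

/-- The integral against the joint law of the stability index and the weight, given the
rate `v` of the weight. -/
noncomputable def pairIntegral (α τ v : ℝ) (f : ℝ → ℝ → ℝ≥0∞) : ℝ≥0∞ :=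
  ∫⁻ s in Set.Ioo τ α, indexPDF α τ v s * ∫⁻ x, gammaPDF (1 - s) v x * f s x

lemma Measurable.pairIntegral {A : Type*} [MeasurableSpace A] {α τ : ℝ} {v : A → ℝ}
    (hv : Measurable v) {f : A → ℝ → ℝ → ℝ≥0∞}
    (hf : Measurable fun p : A × ℝ × ℝ => f p.1 p.2.1 p.2.2) :
    Measurable fun a => pairIntegral α τ (v a) (f a) := by
  unfold MixedGG.pairIntegral
  refine Measurable.lintegral_prod_right ?_
  simp only [Function.uncurry_def]
  refine Measurable.mul (by fun_prop) ?_
  refine Measurable.lintegral_prod_right (f := fun (p : A × ℝ) x =>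
    ProbabilityTheory.gammaPDF (1 - p.2) (v p.1) x * f p.1 p.2 x) ?_
  simp only [Function.uncurry_def]
  refine Measurable.mul (by fun_prop) ?_
  exact hf.comp (f := fun q : (A × ℝ) × ℝ => (q.1.1, q.1.2, q.2)) (by fun_prop)

/-! ### Time change and kernel of the mixed generalized gamma scheme -/

namespace IsMGGParam

variable {α τ β c η : ℝ} (hp : IsMGGParam α τ β c η)
include hp

section Weight

variable {Θ : Type*} [MeasurableSpace Θ] (H : Measure Θ) [IsProbabilityMeasure H]

lemma strictMonoOn_lapExp :
    StrictMonoOn (lapExp ((levyMeasure (rhoMGG α τ β c η)).prod H) Prod.fst) (Set.Ici 0) := by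
  intro x hx y hy hxy
  have hx0 : (0 : ℝ) ≤ x := hx
  have hy0 : (0 : ℝ) ≤ y := hy
  have hc := hp.c_pos
  have hβ := hp.beta_nonneg
  rw [hp.lapExp_eq H hx, hp.lapExp_eq H hy]
  refine mul_lt_mul_of_pos_left (sub_lt_sub_right ?_ _) hp.eta_pos
  refine hp.strictMonoOn_psiMSt ?_ ?_ (by nlinarith)
  · simp only [Set.mem_Ici]; positivity
  · simp only [Set.mem_Ici]; positivity

/-- Since `Λ(t) = η (ψ(ct + β) - ψ(β))` and `ψ` is injective on `[0, ∞)`, the scaled arrival time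
inverts `Λ`. -/
lemma scaledTime_lapExp {t : ℝ} (ht : 0 ≤ t) : scaledTime α τ β c η
    (lapExp ((levyMeasure (rhoMGG α τ β c η)).prod H) Prod.fst t) = t := by
  have hc := hp.c_pos
  have hη := hp.eta_pos
  have hβ := hp.beta_nonneg
  have h0 := (hp.isLaplaceWeight H).image_lapExp_Ici.le ⟨t, ht, rfl⟩
  rw [scaledTime, max_eq_left h0, hp.lapExp_eq H ht, mul_div_cancel_left₀ _ hη.ne',
    sub_add_cancel, psiMStInv,
    (hp.strictMonoOn_psiMSt.injOn).leftInvOn_invFunOn (show 0 ≤ c * t + β by positivity)]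
  field_simp
  ring

/-- Surjectivity of `Λ` onto `[0, ∞)` makes the scaled time a right inverse as well; on negative
inputs it takes its value at `0`. -/
lemma exists_scaledTime (x : ℝ) : 0 ≤ scaledTime α τ β c η x ∧
    lapExp ((levyMeasure (rhoMGG α τ β c η)).prod H) Prod.fst (scaledTime α τ β c η x)
      = max x 0 := by
  obtain ⟨t, ht, hx⟩ := (hp.isLaplaceWeight H).image_lapExp_Ici.ge (le_max_right x 0)
  have : scaledTime α τ β c η x = t := by
    rw [← hp.scaledTime_lapExp H ht, hx, scaledTime, scaledTime, max_eq_left (le_max_right x 0)]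
  rw [this]
  exact ⟨ht, hx⟩

end Weight

/-- The scaled time does not involve `H`, so a one-point location space serves here and below. -/
lemma scaledTime_nonneg (x : ℝ) : 0 ≤ scaledTime α τ β c η x :=
  (hp.exists_scaledTime (Measure.dirac ()) x).1

lemma monotone_scaledTime : Monotone (scaledTime α τ β c η) := by
  intro x y hxy
  obtain ⟨hx, ex⟩ := hp.exists_scaledTime (Measure.dirac ()) x
  obtain ⟨hy, ey⟩ := hp.exists_scaledTime (Measure.dirac ()) y
  rw [← (hp.strictMonoOn_lapExp (Measure.dirac ())).le_iff_le hx hy, ex, ey]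
  exact max_le_max_right _ hxy

lemma measurable_scaledTime : Measurable (scaledTime α τ β c η) :=
  hp.monotone_scaledTime.measurable

lemma scaledTime_zero : scaledTime α τ β c η 0 = 0 := by
  have h := hp.scaledTime_lapExp (Measure.dirac ()) le_rfl
  simpa [lapExp] using h

lemma scaledTime_pos {x : ℝ} (hx : 0 < x) : 0 < scaledTime α τ β c η x := by
  obtain ⟨h, e⟩ := hp.exists_scaledTime (Measure.dirac ()) x
  refine h.lt_of_ne fun h0 => ?_
  rw [← h0, max_eq_left hx.le] at e
  simp [lapExp] at e
  exact hx.ne e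

lemma tendsto_scaledTime : Tendsto (scaledTime α τ β c η) atTop atTop := by
  refine tendsto_atTop_atTop_of_monotone hp.monotone_scaledTime fun b =>
    ⟨lapExp ((levyMeasure (rhoMGG α τ β c η)).prod (Measure.dirac ())) Prod.fst (max b 0), ?_⟩
  rw [hp.scaledTime_lapExp _ (le_max_right b 0)]
  exact le_max_left b 0

lemma arrivalTime_eq {Ω : Type*} {ξ : ℕ → Ω → ℝ} {j : ℕ} {ω : Ω} (h : 0 ≤ ξ j ω) :
    arrivalTime α τ β η ξ j ω = c * scaledTime α τ β c η (ξ j ω) := by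
  have hc := hp.c_pos
  rw [scaledTime, max_eq_left h, arrivalTime]
  field_simp

lemma integral_index_pos {v : ℝ} (hv : 0 < v) : 0 < ∫ r in τ..α, r * v ^ r := by
  refine intervalIntegral.intervalIntegral_pos_of_pos_on ?_ (fun s hs => ?_) hp.tau_lt
  · exact (continuous_id.mul (continuous_const.rpow continuous_id
      fun s => Or.inl hv.ne')).intervalIntegrable _ _
  · have : 0 < s := hp.tau_nonneg.trans_lt hs.1
    positivity

lemma lintegral_indexPDF {v : ℝ} (hv : 0 < v) : ∫⁻ s in Set.Ioo τ α, indexPDF α τ v s = 1 := by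
  have hZ := hp.integral_index_pos hv
  unfold indexPDF
  rw [← ofReal_integral_eq_lintegral_ofReal]
  · rw [integral_div, ← integral_Ioc_eq_integral_Ioo,
      ← intervalIntegral.integral_of_le hp.tau_lt.le, div_self hZ.ne', ENNReal.ofReal_one]
  · refine (Continuous.integrableOn_Icc ?_).mono_set Set.Ioo_subset_Icc_self
    exact (continuous_id.mul (continuous_const.rpow continuous_id
      fun s => Or.inl hv.ne')).div_const _
  · refine (ae_restrict_iff' measurableSet_Ioo).2 (ae_of_all _ fun s hs => ?_)
    have : 0 < s := hp.tau_nonneg.trans_lt hs.1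
    simp only [Pi.zero_apply]
    positivity

/-- The rate of the clock times the joint law of the stability index and the weight is the
weighted, exponentially tilted Lévy measure. -/
lemma rate_mul_pairIntegral {φ : ℝ → ℝ≥0∞} (hφ : Measurable φ) {u : ℝ} (hu : 0 < u) :
    (∫⁻ x, ENNReal.ofReal (x * Real.exp (-(u * x))) ∂levyMeasure (rhoMGG α τ β c η)) *
        pairIntegral α τ (c * u + β) (fun _ x => φ (c * x))
      = ∫⁻ x, φ x * ENNReal.ofReal (x * Real.exp (-(u * x)))
          ∂levyMeasure (rhoMGG α τ β c η) := by
  have hc := hp.c_pos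
  have hη := hp.eta_pos
  have hβ := hp.beta_nonneg
  have hα : 0 < α - τ := sub_pos.2 hp.tau_lt
  have hv : 0 < c * u + β := by positivity
  set v := c * u + β with hv_def
  have hZ := hp.integral_index_pos hv
  set Z := ∫ r in τ..α, r * v ^ r with hZ_def
  -- `s v^{s-1}` is the unnormalised index density divided by `v`, which is constant in `s`;
  -- normalising yields the constant `Z / v`.
  have key : ∀ s ∈ Set.Ioo τ α, ENNReal.ofReal (η * c / (α - τ) * (s * v ^ (s - 1)))
      = ENNReal.ofReal (η * c / (α - τ) / v * Z) * indexPDF α τ v s := fun s hs => by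
    have hs0 : 0 < s := hp.tau_nonneg.trans_lt hs.1
    rw [indexPDF, ← ENNReal.ofReal_mul (by positivity)]
    congr 1
    rw [Real.rpow_sub_one hv.ne', ← hZ_def]
    field_simp
  -- The test function `1` shows that this same constant is the rate of the clock, so the normaliser
  -- `Z` cancels.
  have h1 := hp.lintegral_tilted_levyMeasure (φ := fun _ => 1) measurable_const hu
  rw [← hv_def] at h1
  have h2 : ∀ s ∈ Set.Ioo τ α, ENNReal.ofReal (η * c / (α - τ) * (s * v ^ (s - 1))) *
      (∫⁻ _, 1 ∂gammaMeasure (1 - s) v)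
        = ENNReal.ofReal (η * c / (α - τ) / v * Z) * indexPDF α τ v s := fun s hs => by
    have := isProbabilityMeasure_gammaMeasure (a := 1 - s) (r := v)
      (by linarith [hs.2, hp.le_one]) hv
    rw [lintegral_one, measure_univ, mul_one, key s hs]
  rw [setLIntegral_congr_fun measurableSet_Ioo h2, lintegral_const_mul' _ _ ENNReal.ofReal_ne_top,
    hp.lintegral_indexPDF hv, mul_one] at h1
  simp only [one_mul] at h1
  rw [h1, hp.lintegral_tilted_levyMeasure hφ hu, ← hv_def, pairIntegral,
    ← lintegral_const_mul' _ _ ENNReal.ofReal_ne_top]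
  refine setLIntegral_congr_fun measurableSet_Ioo fun s hs => ?_
  rw [← mul_assoc, ← key s hs, gammaMeasure, lintegral_withDensity_eq_lintegral_mul _
    (by fun_prop) (by fun_prop)]
  rfl

/-- The next time and atom of the sampling scheme have the density of a size-biased chain. -/
lemma lintegral_expMeasure_pairIntegral {Θ : Type*} [MeasurableSpace Θ] (H : Measure Θ)
    [IsProbabilityMeasure H] {h : ℝ × ℝ × Θ → ℝ≥0∞} (hh : Measurable h) {t : ℝ} (ht : 0 ≤ t) :
    ∫⁻ y, (fun x => pairIntegral α τ (c * scaledTime α τ β c η x + β) fun _ w =>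
        ∫⁻ ϑ, h (scaledTime α τ β c η x, c * w, ϑ) ∂H)
        (lapExp ((levyMeasure (rhoMGG α τ β c η)).prod H) Prod.fst t + y) ∂expMeasure 1
      = ∫⁻ u in Set.Ioi t, ∫⁻ x, h (u, x) *
          clockDensity ((levyMeasure (rhoMGG α τ β c η)).prod H) Prod.fst t u x
          ∂(levyMeasure (rhoMGG α τ β c η)).prod H := by
  have hw := hp.isLaplaceWeight H
  have hst := hp.measurable_scaledTime
  have hm : Measurable fun p : ℝ × ℝ => ∫⁻ θ, h (p.1, p.2, θ) ∂H := by
    refine Measurable.lintegral_prod_right (f := fun (p : ℝ × ℝ) θ => h (p.1, p.2, θ)) ?_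
    simp only [Function.uncurry_def]
    fun_prop
  rw [hw.lintegral_expMeasure_lapExp_add (K := fun x =>
    pairIntegral α τ (c * scaledTime α τ β c η x + β) fun _ w =>
      ∫⁻ ϑ, h (scaledTime α τ β c η x, c * w, ϑ) ∂H) (hp.strictMonoOn_lapExp H)
    (Measurable.pairIntegral (by fun_prop) (by fun_prop)) ht]
  refine setLIntegral_congr_fun measurableSet_Ioi fun u hu => ?_
  have hu0 : 0 < u := ht.trans_lt hu
  rw [hp.scaledTime_lapExp H hu0.le]
  -- `Λ'(u)` depends on the weight alone; multiplied by the law of index and weight, it becomes the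
  -- unnormalised tilted intensity.
  have hrate : ENNReal.ofReal (∫ x : ℝ × Θ, x.1 * Real.exp (-(u * x.1))
      ∂(levyMeasure (rhoMGG α τ β c η)).prod H)
        = ∫⁻ x, ENNReal.ofReal (x * Real.exp (-(u * x))) ∂levyMeasure (rhoMGG α τ β c η) := by
    rw [ofReal_integral_eq_lintegral_ofReal]
    · exact lintegral_fst_prod H _ (φ := fun x => ENNReal.ofReal (x * Real.exp (-(u * x))))
        (by fun_prop)
    · simpa using hw.integrable_weight_mul_exp (H := fun _ => 1) measurable_const
        (fun _ => zero_le_one) (fun _ => le_rfl) hu0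
    · filter_upwards [hw.pos] with x hx
      simp only [Pi.zero_apply]
      positivity
  rw [hrate, mul_left_comm, hp.rate_mul_pairIntegral (φ := fun w => ∫⁻ θ, h (u, w, θ) ∂H)
    (by fun_prop) hu0, ← lintegral_const_mul _ (by fun_prop), lintegral_prod _ (by
      unfold clockDensity; fun_prop)]
  refine lintegral_congr fun x => ?_
  have e : ∀ θ : Θ, clockDensity ((levyMeasure (rhoMGG α τ β c η)).prod H) Prod.fst t u (x, θ)
      = ENNReal.ofReal (x * Real.exp (-(u * x))) * ENNReal.ofReal (Real.exp
        (-(lapExp ((levyMeasure (rhoMGG α τ β c η)).prod H) Prod.fst u -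
          lapExp ((levyMeasure (rhoMGG α τ β c η)).prod H) Prod.fst t))) := fun θ => by
    rw [clockDensity, ENNReal.ofReal_mul' (Real.exp_pos _).le]
  simp_rw [e]
  rw [lintegral_mul_const _ (by fun_prop)]
  ring

end IsMGGParam

end MixedGG

namespace MixedGG

open Filter Topology

/-! ### Independence and conditional laws -/

section Independence

variable {Ω A B C : Type*} [mΩ : MeasurableSpace Ω] [MeasurableSpace A] [MeasurableSpace B]
  [MeasurableSpace C] {P : Measure Ω} [IsProbabilityMeasure P] {X : Ω → A} {Y : Ω → B} {Z : Ω → C}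

/-- If `Y` has a conditional law given `U` with a density, then the joint law is explicit. -/
lemma HasConditionalLaw.lintegral_eq {κ : Ω → Measure B}
    (h : HasConditionalLaw P Y (MeasurableSpace.comap X inferInstance) κ) (hX : Measurable X)
    (hY : Measurable Y) {ν : Measure B} [SFinite ν] {p : A → B → ℝ≥0∞}
    (hp : Measurable (Function.uncurry p))
    (hκ : ∀ᵐ ω ∂P, IsFiniteMeasure (κ ω) ∧ κ ω = ν.withDensity (p (X ω)))
    {F : A → B → ℝ≥0∞} (hF : Measurable (Function.uncurry F)) :
    ∫⁻ ω, F (X ω) (Y ω) ∂P = ∫⁻ ω, ∫⁻ y, p (X ω) y * F (X ω) y ∂ν ∂P := by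
  -- It suffices to compare rectangles, where the defining property of conditional expectation over
  -- `X ⁻¹' s` applies.
  have hmap : P.map (fun ω => (X ω, Y ω)) = ((P.map X).prod ν).withDensity (Function.uncurry p) := by
    have := Measure.isProbabilityMeasure_map (μ := P) (hX.prodMk hY).aemeasurable
    refine Measure.ext_prod fun {s t} hs ht => ?_
    have hle : MeasurableSpace.comap X inferInstance ≤ mΩ := hX.comap_le
    have hi : Integrable ((Y ⁻¹' t).indicator fun _ => (1 : ℝ)) P :=
      (integrable_const 1).indicator (hY ht)
    have e1 : ∫ ω in X ⁻¹' s, (κ ω).real t ∂P = P.real (X ⁻¹' s ∩ Y ⁻¹' t) := by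
      rw [← setIntegral_congr_ae (hX hs) ((h t ht).mono fun ω hω _ => hω),
        setIntegral_condExp hle hi ⟨s, hs, rfl⟩, setIntegral_indicator (hY ht)]
      simp
    have e2 : P (X ⁻¹' s ∩ Y ⁻¹' t) = ∫⁻ ω in X ⁻¹' s, κ ω t ∂P := by
      rw [← ofReal_measureReal, ← e1, ofReal_integral_eq_lintegral_ofReal
        (integrable_condExp.congr (h t ht)).integrableOn
        (ae_of_all _ fun ω => measureReal_nonneg)]
      refine lintegral_congr_ae (ae_restrict_of_ae ?_)
      filter_upwards [hκ] with ω hω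
      have := hω.1
      exact ofReal_measureReal
    rw [Measure.map_apply (hX.prodMk hY) (hs.prod ht), withDensity_apply _ (hs.prod ht),
      Set.mk_preimage_prod, e2, ← Measure.prod_restrict, lintegral_prod _ hp.aemeasurable,
      setLIntegral_map hs (by
        refine Measurable.lintegral_prod_right ?_
        exact hp) hX]
    refine lintegral_congr_ae (ae_restrict_of_ae ?_)
    filter_upwards [hκ] with ω hω
    rw [hω.2, withDensity_apply _ ht]
    rfl
  have h1 : ∫⁻ ω, F (X ω) (Y ω) ∂P
      = ∫⁻ q, Function.uncurry F q ∂P.map (fun ω => (X ω, Y ω)) := by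
    rw [lintegral_map hF (hX.prodMk hY)]
    rfl
  rw [h1, hmap, lintegral_withDensity_eq_lintegral_mul _ hp hF,
    lintegral_prod _ (hp.mul hF).aemeasurable, lintegral_map _ hX]
  · rfl
  · exact Measurable.lintegral_prod_right (hp.mul hF)

lemma IndepFun.lintegral_comp (h : IndepFun X Y P) (hX : Measurable X) (hY : Measurable Y)
    {F : A × B → ℝ≥0∞} (hF : Measurable F) :
    ∫⁻ ω, F (X ω, Y ω) ∂P = ∫⁻ ω, ∫⁻ y, F (X ω, y) ∂(P.map Y) ∂P := by
  have := Measure.isProbabilityMeasure_map (μ := P) hY.aemeasurable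
  rw [← lintegral_map (f := F) hF (hX.prodMk hY),
    (indepFun_iff_map_prod_eq_prod_map_map hX.aemeasurable hY.aemeasurable).1 h,
    lintegral_prod _ hF.aemeasurable, lintegral_map hF.lintegral_prod_right' hX]

lemma IndepFun.lintegral_comp_symm (h : IndepFun X Y P) (hX : Measurable X) (hY : Measurable Y)
    {F : A × B → ℝ≥0∞} (hF : Measurable F) :
    ∫⁻ ω, F (X ω, Y ω) ∂P = ∫⁻ y, ∫⁻ ω, F (X ω, y) ∂P ∂(P.map Y) := by
  have := Measure.isProbabilityMeasure_map (μ := P) hY.aemeasurable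
  rw [IndepFun.lintegral_comp h hX hY hF, lintegral_lintegral_swap]
  exact (hF.comp (by fun_prop : Measurable fun q : Ω × B => (X q.1, q.2))).aemeasurable

/-- Both hypotheses together say that the joint law is a threefold product, which may be bracketed
either way. -/
lemma IndepFun.assoc_left (h : IndepFun X (fun ω => (Y ω, Z ω)) P) (h' : IndepFun Y Z P)
    (hX : Measurable X) (hY : Measurable Y) (hZ : Measurable Z) :
    IndepFun (fun ω => (X ω, Y ω)) Z P := by
  have := Measure.isProbabilityMeasure_map (μ := P) hX.aemeasurable
  have := Measure.isProbabilityMeasure_map (μ := P) hY.aemeasurable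
  have := Measure.isProbabilityMeasure_map (μ := P) hZ.aemeasurable
  have hXY : IndepFun X Y P := h.comp measurable_id measurable_fst
  rw [indepFun_iff_map_prod_eq_prod_map_map (by fun_prop) (by fun_prop)] at h h' hXY ⊢
  rw [h'] at h
  rw [hXY, ← MeasurableEquiv.prodAssoc.map_measurableEquiv_injective.eq_iff,
    Measure.prodAssoc_prod, ← h, Measure.map_map (by fun_prop) (by fun_prop)]
  rfl

lemma IndepFun.assoc_right (h : IndepFun (fun ω => (X ω, Y ω)) Z P) (h' : IndepFun X Y P)
    (hX : Measurable X) (hY : Measurable Y) (hZ : Measurable Z) :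
    IndepFun X (fun ω => (Y ω, Z ω)) P := by
  have h1 : IndepFun Z (fun ω => (Y ω, X ω)) P := h.symm.comp measurable_id measurable_swap
  have h2 := (IndepFun.assoc_left h1 h'.symm hZ hY hX).symm
  exact h2.comp measurable_id measurable_swap

-- Everything indexed away from `i` is measurable for the σ-algebra of the complement of `{i}`, so
-- `g` may be any reindexing that avoids `i`.
omit [IsProbabilityMeasure P] in
lemma iIndepFun.indepFun_pi_of_ne {ι κ : Type*} {f : ι → Ω → A} (hf : iIndepFun f P)
    (hm : ∀ i, Measurable (f i)) {i : ι} {g : κ → ι} (hg : ∀ k, g k ≠ i) :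
    IndepFun (f i) (fun ω k => f (g k) ω) P := by
  have h := indep_iSup_of_disjoint (fun j => (hm j).comap_le) hf.iIndep
    (S := {i}) (T := {i}ᶜ) disjoint_compl_right
  refine indep_of_indep_of_le_left (indep_of_indep_of_le_right h ?_) ?_
  · refine Measurable.comap_le ?_
    refine @measurable_pi_lambda _ _ _ (_) _ _ fun k => ?_
    refine Measurable.mono (comap_measurable _) ?_ le_rfl
    exact le_iSup₂ (f := fun j (_ : j ∈ ({i}ᶜ : Set ι)) => MeasurableSpace.comap (f j) inferInstance)
      (g k) (hg k)
  · exact le_iSup₂ (f := fun j (_ : j ∈ ({i} : Set ι)) => MeasurableSpace.comap (f j) inferInstance)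
      i rfl

end Independence

end MixedGG

namespace MixedGG

open Filter Topology

/-! ### The points of the Poisson process -/

/-- The point before the `n`-th one, where the points start from `0`. -/
def prevPoint (x : ℕ → ℝ) : ℕ → ℝ
  | 0 => 0
  | n + 1 => x n

/-- The gap before the `n`-th point. -/
def gap (x : ℕ → ℝ) (n : ℕ) : ℝ := x n - prevPoint x n

/-- The position of the last of `n` marked points, or `0` if `n = 0`. -/
def lastPoint {A : Type*} : (n : ℕ) → (Fin n → ℝ × A) → ℝ
  | 0, _ => 0
  | n + 1, p => (p (Fin.last n)).1

lemma measurable_prevPoint (n : ℕ) : Measurable fun x => prevPoint x n := by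
  cases n with
  | zero => exact measurable_const
  | succ n => exact measurable_pi_apply n

lemma measurable_gap (n : ℕ) : Measurable fun x => gap x n :=
  (measurable_pi_apply n).sub (measurable_prevPoint n)

lemma measurable_lastPoint {A : Type*} [MeasurableSpace A] (n : ℕ) :
    Measurable (lastPoint (A := A) n) := by
  cases n with
  | zero => exact measurable_const
  | succ n => exact (measurable_pi_apply (Fin.last n)).fst

/-- It presents the previous point as a measurable function of the finite history. -/
lemma lastPoint_eq {A : Type*} (x : ℕ → ℝ) (a : ℕ → A) (n : ℕ) :
    lastPoint n (fun i : Fin n => (x i, a i)) = prevPoint x n := by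
  cases n <;> rfl

lemma prevPoint_add_gap (x : ℕ → ℝ) (n : ℕ) : prevPoint x n + gap x n = x n := by
  simp [gap]

lemma gap_eq (x : ℕ → ℝ) (n : ℕ) : (x n - if n = 0 then 0 else x (n - 1)) = gap x n := by
  cases n <;> simp [gap, prevPoint]

namespace IsUnitRatePoissonPoints

variable {Ω : Type*} [MeasurableSpace Ω] {P : Measure Ω} {ξ : ℕ → Ω → ℝ}
  (hξ : IsUnitRatePoissonPoints P ξ)
include hξ

lemma measurable_gap (n : ℕ) : Measurable fun ω => gap (fun i => ξ i ω) n :=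
  (MixedGG.measurable_gap n).comp (measurable_pi_lambda _ hξ.measurable)

lemma iIndepFun : iIndepFun (fun n ω => gap (fun i => ξ i ω) n) P := by
  have h := hξ.iIndepFun_gap
  have e : (fun (j : ℕ) ω => ξ j ω - if j = 0 then 0 else ξ (j - 1) ω)
      = fun n ω => gap (fun i => ξ i ω) n := by
    ext j ω; exact gap_eq (fun i => ξ i ω) j
  rwa [e] at h

lemma map_gap (n : ℕ) : P.map (fun ω => gap (fun i => ξ i ω) n) = expMeasure 1 := by
  have e : (fun ω => ξ n ω - if n = 0 then 0 else ξ (n - 1) ω)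
      = fun ω => gap (fun i => ξ i ω) n := by
    ext ω; exact gap_eq (fun i => ξ i ω) n
  rw [← e]
  exact (hξ.hasLaw_gap n).map_eq

lemma ae_pos : ∀ᵐ ω ∂P, ∀ n, 0 < ξ n ω := by
  have h : ∀ᵐ ω ∂P, ∀ n, 0 < gap (fun i => ξ i ω) n := by
    refine ae_all_iff.2 fun n => ?_
    refine ae_of_ae_map (hξ.measurable_gap n).aemeasurable (p := fun y => 0 < y) ?_
    rw [hξ.map_gap, ae_iff]
    have h := lintegral_expMeasure_one (K := Set.indicator (Set.Iic 0) 1)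
      (measurable_one.indicator measurableSet_Iic)
    rw [lintegral_indicator_one measurableSet_Iic] at h
    simp only [not_lt]
    refine h.trans ((setLIntegral_congr_fun (g := fun _ => 0) measurableSet_Ioi
      fun y (hy : 0 < y) => ?_).trans (by simp))
    simp [hy]
  filter_upwards [h] with ω hω n
  induction n with
  | zero => simpa [gap, prevPoint] using hω 0
  | succ n ih =>
    have := hω (n + 1)
    simp only [gap, prevPoint] at this
    linarith

lemma ae_prevPoint_nonneg : ∀ᵐ ω ∂P, ∀ n, 0 ≤ prevPoint (fun i => ξ i ω) n := by
  filter_upwards [hξ.ae_pos] with ω hω n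
  cases n with
  | zero => exact le_rfl
  | succ n => exact (hω n).le

end IsUnitRatePoissonPoints

/-! ### The sampling scheme as a size-biased chain -/

lemma pairIntegral_mul_const {α τ v : ℝ} {f : ℝ → ℝ → ℝ≥0∞} (hf : Measurable (Function.uncurry f))
    (a : ℝ≥0∞) : pairIntegral α τ v (fun s x => f s x * a) = pairIntegral α τ v f * a := by
  have h1 : Measurable fun s => ∫⁻ x, gammaPDF (1 - s) v x * f s x := by
    refine Measurable.lintegral_prod_right (f := fun s x => gammaPDF (1 - s) v x * f s x) ?_
    simp only [Function.uncurry_def]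
    exact Measurable.mul (by fun_prop) hf
  unfold pairIntegral
  rw [← lintegral_mul_const _ (by fun_prop)]
  refine lintegral_congr fun s => ?_
  have h2 : Measurable fun x => gammaPDF (1 - s) v x * f s x :=
    Measurable.mul (by fun_prop) (hf.comp (f := fun x : ℝ => (s, x)) (by fun_prop))
  rw [mul_assoc, ← lintegral_mul_const _ h2]
  simp_rw [mul_assoc]

namespace IsSamplingScheme

variable {Ω Θ : Type*} [MeasurableSpace Ω] [MeasurableSpace Θ] {P : Measure Ω}
  [IsProbabilityMeasure P] {α τ β c η : ℝ} {H : Measure Θ} {ξ S W' : ℕ → Ω → ℝ} {θ : ℕ → Ω → Θ}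
  (hs : IsSamplingScheme P α τ β η H ξ S W' θ) (hp : IsMGGParam α τ β c η)

include hs in
omit [IsProbabilityMeasure P] in
lemma measurable_points : Measurable fun ω (i : ℕ) => ξ i ω :=
  measurable_pi_lambda _ hs.poissonPoints.measurable

include hs in
omit [IsProbabilityMeasure P] in
lemma measurable_pairs (n : ℕ) : Measurable fun ω (i : Fin n) => (S i ω, W' i ω) :=
  measurable_pi_lambda _ fun i => (hs.measurable_index i).prodMk (hs.measurable_weight i)

include hs in
omit [IsProbabilityMeasure P] in
lemma measurable_past (n : ℕ) : Measurable fun ω (i : Fin n) => (ξ i ω, S i ω, W' i ω) :=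
  measurable_pi_lambda _ fun i => (hs.poissonPoints.measurable i).prodMk
    ((hs.measurable_index i).prodMk (hs.measurable_weight i))

include hs in
omit [IsProbabilityMeasure P] in
lemma measurable_locations (n : ℕ) : Measurable fun ω (i : Fin n) => θ i ω :=
  measurable_pi_lambda _ fun i => hs.measurable_location i

include hs hp

/-- The conditional law of the stability index given all the points and the past pairs. -/
lemma lintegral_index (n : ℕ) {F : (ℕ → ℝ) × (Fin n → ℝ × ℝ) → ℝ → ℝ≥0∞}
    (hF : Measurable (Function.uncurry F)) :
    ∫⁻ ω, F (fun i => ξ i ω, fun i => (S i ω, W' i ω)) (S n ω) ∂P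
      = ∫⁻ ω, (∫⁻ s in Set.Ioo τ α, indexPDF α τ (c * scaledTime α τ β c η (ξ n ω) + β) s *
          F (fun i => ξ i ω, fun i => (S i ω, W' i ω)) s) ∂P := by
  have hst := hp.measurable_scaledTime
  have hX := hs.measurable_points.prodMk (hs.measurable_pairs n)
  refine (hs.condLaw_index n).lintegral_eq
    (p := fun a s => indexPDF α τ (c * scaledTime α τ β c η (a.1 n) + β) s) hX
    (hs.measurable_index n) (by simp only [Function.uncurry_def]; fun_prop) ?_ hF
  filter_upwards [hs.poissonPoints.ae_pos] with ω hω
  have hc := hp.c_pos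
  have hβ := hp.beta_nonneg
  have ht := hp.scaledTime_pos (hω n)
  have e : indexLaw α τ β (arrivalTime α τ β η ξ n ω) = (volume.restrict (Set.Ioo τ α)).withDensity
      (indexPDF α τ (c * scaledTime α τ β c η (ξ n ω) + β)) := by
    rw [hp.arrivalTime_eq (hω n).le]
    rfl
  refine ⟨⟨?_⟩, e⟩
  rw [e, withDensity_apply _ MeasurableSet.univ, Measure.restrict_univ,
    hp.lintegral_indexPDF (by positivity)]
  exact ENNReal.one_lt_top

/-- This keeps the Gamma shape `1 - S n` positive, so that the conditional law of the weight is a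
probability measure with the expected density. -/
lemma ae_index_mem (n : ℕ) : ∀ᵐ ω ∂P, S n ω ∈ Set.Ioo τ α := by
  have h := hs.lintegral_index hp n (F := fun _ s => (Set.Ioo τ α)ᶜ.indicator 1 s) (by
    simp only [Function.uncurry_def]
    exact (measurable_one.indicator measurableSet_Ioo.compl).comp measurable_snd)
  have h0 : ∀ ω, ∫⁻ s in Set.Ioo τ α, indexPDF α τ (c * scaledTime α τ β c η (ξ n ω) + β) s *
      (Set.Ioo τ α)ᶜ.indicator 1 s = 0 := fun ω => by
    refine (setLIntegral_congr_fun (g := fun _ => 0) measurableSet_Ioo fun s hs => ?_).trans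
      (by simp)
    simp only [Set.indicator_of_notMem (Set.notMem_compl_iff.2 hs), mul_zero]
  simp_rw [h0, lintegral_zero] at h
  have h1 : Measurable fun ω => (Set.Ioo τ α)ᶜ.indicator (1 : ℝ → ℝ≥0∞) (S n ω) :=
    (measurable_one.indicator measurableSet_Ioo.compl).comp (hs.measurable_index n)
  filter_upwards [(lintegral_eq_zero_iff h1).1 h] with ω hω
  by_contra hn
  simp [Set.indicator_of_mem (Set.mem_compl hn)] at hω

/-- The conditional law of the index and the weight given all the points and the past pairs. -/
lemma lintegral_pair (n : ℕ) {F : (ℕ → ℝ) × (Fin n → ℝ × ℝ) → ℝ → ℝ → ℝ≥0∞}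
    (hF : Measurable fun q : ((ℕ → ℝ) × (Fin n → ℝ × ℝ)) × ℝ × ℝ => F q.1 q.2.1 q.2.2) :
    ∫⁻ ω, F (fun i => ξ i ω, fun i => (S i ω, W' i ω)) (S n ω) (W' n ω) ∂P
      = ∫⁻ ω, pairIntegral α τ (c * scaledTime α τ β c η (ξ n ω) + β)
          (F (fun i => ξ i ω, fun i => (S i ω, W' i ω))) ∂P := by
  have hst := hp.measurable_scaledTime
  have hX : Measurable fun ω => (fun i : ℕ => ξ i ω, fun i : Fin n => (S i ω, W' i ω), S n ω) :=
    hs.measurable_points.prodMk ((hs.measurable_pairs n).prodMk (hs.measurable_index n))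
  have hp' : Measurable (Function.uncurry fun (a : (ℕ → ℝ) × (Fin n → ℝ × ℝ) × ℝ) x =>
      gammaPDF (1 - a.2.2) (c * scaledTime α τ β c η (a.1 n) + β) x) := by
    simp only [Function.uncurry_def]
    fun_prop
  have hF' : Measurable (Function.uncurry fun (a : (ℕ → ℝ) × (Fin n → ℝ × ℝ) × ℝ) x =>
      F (a.1, a.2.1) a.2.2 x) := by
    simp only [Function.uncurry_def]
    exact hF.comp (f := fun q : ((ℕ → ℝ) × (Fin n → ℝ × ℝ) × ℝ) × ℝ =>
      ((q.1.1, q.1.2.1), q.1.2.2, q.2)) (by fun_prop)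
  have h := (hs.condLaw_weight n).lintegral_eq (ν := volume) hX (hs.measurable_weight n)
    hp' ?_ hF'
  · refine h.trans ?_
    have hm : Measurable (Function.uncurry fun (a : (ℕ → ℝ) × (Fin n → ℝ × ℝ)) (s : ℝ) =>
        ∫⁻ x, gammaPDF (1 - s) (c * scaledTime α τ β c η (a.1 n) + β) x * F a s x) := by
      simp only [Function.uncurry_def]
      have := (hp'.mul hF').lintegral_prod_right' (ν := volume)
      exact this.comp (f := fun q : ((ℕ → ℝ) × (Fin n → ℝ × ℝ)) × ℝ => (q.1.1, q.1.2, q.2))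
        (by fun_prop)
    exact hs.lintegral_index hp n hm
  · filter_upwards [hs.poissonPoints.ae_pos, hs.ae_index_mem hp n] with ω hω hS
    have hc := hp.c_pos
    have hβ := hp.beta_nonneg
    have ht := hp.scaledTime_pos (hω n)
    have hpr := isProbabilityMeasure_gammaMeasure (a := 1 - S n ω)
      (r := c * scaledTime α τ β c η (ξ n ω) + β) (by linarith [hS.2, hp.le_one]) (by positivity)
    rw [hp.arrivalTime_eq (hω n).le]
    exact ⟨inferInstance, rfl⟩

/-- The points, indices and weights up to time `n` are independent of the later gaps. -/
lemma indepFun_past_gap (n : ℕ) :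
    IndepFun (fun ω (i : Fin n) => (ξ i ω, S i ω, W' i ω))
      (fun ω j => gap (fun i => ξ i ω) (n + j)) P := by
  have hst := hp.measurable_scaledTime
  have hgap : ∀ m, Measurable fun ω (j : ℕ) => gap (fun i => ξ i ω) (m + j) := fun m =>
    measurable_pi_lambda _ fun j => hs.poissonPoints.measurable_gap (m + j)
  induction n with
  | zero =>
    have e : (fun ω (i : Fin 0) => (ξ i ω, S i ω, W' i ω)) = fun _ => default := by
      ext ω i : 2; exact i.elim0
    rw [e]
    exact indepFun_const_left _ _
  | succ n ih =>
    have h1 : IndepFun (fun ω => gap (fun i => ξ i ω) n)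
        (fun ω j => gap (fun i => ξ i ω) (n + 1 + j)) P :=
      iIndepFun.indepFun_pi_of_ne hs.poissonPoints.iIndepFun hs.poissonPoints.measurable_gap
        fun k => by omega
    have h2 : IndepFun (fun ω (i : Fin n) => (ξ i ω, S i ω, W' i ω))
        (fun ω => (gap (fun i => ξ i ω) n, fun j => gap (fun i => ξ i ω) (n + 1 + j))) P := by
      have h := ih.comp (φ := id) (ψ := fun f : ℕ → ℝ => (f 0, fun j => f (1 + j)))
        measurable_id (by fun_prop)
      convert! h using 1
      ext ω
      · rfl
      · simp [add_assoc]
    have h3 := IndepFun.assoc_left h2 h1 (hs.measurable_past n)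
      (hs.poissonPoints.measurable_gap n) (hgap (n + 1))
    -- The new index and weight are drawn given all the points, so their independence of the later
    -- gaps is not immediate. Integrating them out leaves a function of the past and the gap `n`
    -- only.
    rw [indepFun_iff_measure_inter_preimage_eq_mul]
    intro s t hms hmt
    set a : (Fin n → ℝ × ℝ × ℝ) → ℝ × ℝ × ℝ → ℝ≥0∞ := fun p q =>
      s.indicator 1 (Fin.snoc (α := fun _ => ℝ × ℝ × ℝ) p q : Fin (n + 1) → ℝ × ℝ × ℝ) with ha
    have hma : Measurable (Function.uncurry a) := by
      refine (measurable_one.indicator hms).comp (measurable_pi_lambda _ fun i => ?_)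
      refine Fin.lastCases ?_ (fun i => ?_) i
      · simp only [Fin.snoc_last]; fun_prop
      · simp only [Fin.snoc_castSucc]; fun_prop
    set b : (ℕ → ℝ) → ℝ≥0∞ := t.indicator 1 with hb
    have hmb : Measurable b := measurable_one.indicator hmt
    -- The conditional probability of `s`. It sees the points only through the past and the current
    -- point, rebuilt as last point plus gap.
    set K : (Fin n → ℝ × ℝ × ℝ) × ℝ → ℝ≥0∞ := fun q =>
      pairIntegral α τ (c * scaledTime α τ β c η (lastPoint n q.1 + q.2) + β)
        fun s x => a q.1 (lastPoint n q.1 + q.2, s, x) with hK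
    have hlast := measurable_lastPoint (A := ℝ × ℝ) n
    have hmK : Measurable K := by
      refine Measurable.pairIntegral (by fun_prop) ?_
      exact hma.comp (f := fun p : ((Fin n → ℝ × ℝ × ℝ) × ℝ) × ℝ × ℝ =>
        (p.1.1, (lastPoint n p.1.1 + p.1.2, p.2.1, p.2.2))) (by fun_prop)
    have key : ∀ b : (ℕ → ℝ) → ℝ≥0∞, Measurable b →
        ∫⁻ ω, s.indicator 1 (fun i : Fin (n + 1) => (ξ i ω, S i ω, W' i ω)) *
            b (fun j => gap (fun i => ξ i ω) (n + 1 + j)) ∂P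
          = (∫⁻ ω, K (fun i => (ξ i ω, S i ω, W' i ω), gap (fun i => ξ i ω) n) ∂P) *
            ∫⁻ ω, b (fun j => gap (fun i => ξ i ω) (n + 1 + j)) ∂P := fun b hmb => by
      have e1 := hs.lintegral_pair hp n (F := fun q s x =>
        a (fun i => (q.1 i, q.2 i)) (q.1 n, s, x) * b (fun j => gap q.1 (n + 1 + j))) (by
          refine Measurable.mul ?_ ?_
          · exact hma.comp (f := fun p : ((ℕ → ℝ) × (Fin n → ℝ × ℝ)) × ℝ × ℝ =>
              (fun i : Fin n => (p.1.1 i, p.1.2 i), (p.1.1 n, p.2.1, p.2.2))) (by fun_prop)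
          · refine hmb.comp (measurable_pi_lambda _ fun j => ?_)
            exact (measurable_gap (n + 1 + j)).comp measurable_fst.fst)
      have e2 : ∀ ω, s.indicator 1 (fun i : Fin (n + 1) => (ξ i ω, S i ω, W' i ω))
          = a (fun i => (ξ i ω, S i ω, W' i ω)) (ξ n ω, S n ω, W' n ω) := fun ω => by
        simp only [ha]
        congr 1
        ext i : 1
        refine Fin.lastCases ?_ (fun i => ?_) i <;> simp
      simp_rw [e2]
      refine e1.trans ?_
      rw [← lintegral_mul_eq_lintegral_mul_lintegral_of_indepFun''
        (f := fun ω => K (fun i => (ξ i ω, S i ω, W' i ω), gap (fun i => ξ i ω) n))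
        (g := fun ω => b (fun j => gap (fun i => ξ i ω) (n + 1 + j)))
        (hmK.comp ((hs.measurable_past n).prodMk (hs.poissonPoints.measurable_gap n))).aemeasurable
        (hmb.comp (hgap (n + 1))).aemeasurable (h3.comp hmK hmb)]
      refine lintegral_congr fun ω => ?_
      rw [pairIntegral_mul_const]
      · simp only [hK, lastPoint_eq (fun i => ξ i ω) (fun i => (S i ω, W' i ω)),
          prevPoint_add_gap]
      · exact hma.comp (f := fun p : ℝ × ℝ => (fun i : Fin n => (ξ i ω, S i ω, W' i ω),
          (ξ n ω, p.1, p.2))) (by fun_prop)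
    have k1 := key b hmb
    -- The choice `b = 1` identifies the integral of `K` with the probability of `s`.
    have k2 := key (fun _ => 1) measurable_const
    simp only [mul_one, lintegral_const, measure_univ] at k2
    rw [← k2] at k1
    have hps := hs.measurable_past (n + 1)
    have m1 : ∫⁻ ω, s.indicator 1 (fun i : Fin (n + 1) => (ξ i ω, S i ω, W' i ω)) ∂P
        = P ((fun ω (i : Fin (n + 1)) => (ξ i ω, S i ω, W' i ω)) ⁻¹' s) := by
      rw [← lintegral_indicator_one (hps hms)]; rfl
    have m2 : ∫⁻ ω, b (fun j => gap (fun i => ξ i ω) (n + 1 + j)) ∂P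
        = P ((fun ω j => gap (fun i => ξ i ω) (n + 1 + j)) ⁻¹' t) := by
      rw [← lintegral_indicator_one (hgap (n + 1) hmt)]; rfl
    rw [m1, m2] at k1
    rw [← k1, ← lintegral_indicator_one ((hps hms).inter (hgap (n + 1) hmt)),
      Set.inter_indicator_one]
    rfl

end IsSamplingScheme

end MixedGG

/-! ### The one-step law of the sampling scheme -/

namespace MixedGG

open Filter Topology

namespace IsSamplingScheme

variable {Ω Θ : Type*} [MeasurableSpace Ω] [MeasurableSpace Θ] {P : Measure Ω}
  [IsProbabilityMeasure P] {α τ β c η : ℝ} {H : Measure Θ} {ξ S W' : ℕ → Ω → ℝ} {θ : ℕ → Ω → Θ}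
  (hs : IsSamplingScheme P α τ β η H ξ S W' θ) (hp : IsMGGParam α τ β c η)
include hs

/-- The current point and weight are included next to the past, so that the new location can be
integrated out first. -/
lemma indepFun_location_past (n : ℕ) :
    IndepFun (θ n) (fun ω => (fun i : Fin n => θ i ω, fun i : Fin n => (ξ i ω, S i ω, W' i ω),
      ξ n ω, W' n ω)) P := by
  have h1 : IndepFun (θ n) (fun ω (i : Fin n) => θ i ω) P :=
    iIndepFun.indepFun_pi_of_ne hs.iIndepFun_location hs.measurable_location
      fun k => by have := k.2; omega
  have h2 : IndepFun (fun ω => (θ n ω, fun i : Fin n => θ i ω))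
      (fun ω => (fun i : Fin n => (ξ i ω, S i ω, W' i ω), ξ n ω, W' n ω)) P :=
    hs.indepFun_location.comp (φ := fun f : ℕ → Θ => (f n, fun i : Fin n => f i))
      (ψ := fun f : ℕ → ℝ × ℝ × ℝ => (fun i : Fin n => f i, (f n).1, (f n).2.2))
      (by fun_prop) (by fun_prop)
  exact IndepFun.assoc_right h2 h1 (hs.measurable_location n) (hs.measurable_locations n)
    ((hs.measurable_past n).prodMk ((hs.poissonPoints.measurable n).prodMk
      (hs.measurable_weight n)))

omit [IsProbabilityMeasure P] in
lemma indepFun_past_locations (n : ℕ) :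
    IndepFun (fun ω => (fun i : Fin n => (ξ i ω, S i ω, W' i ω), ξ n ω, W' n ω))
      (fun ω (i : Fin n) => θ i ω) P :=
  (hs.indepFun_location.comp (φ := fun f : ℕ → Θ => fun i : Fin n => f i)
      (ψ := fun f : ℕ → ℝ × ℝ × ℝ => (fun i : Fin n => f i, (f n).1, (f n).2.2))
      (by fun_prop) (by fun_prop)).symm

include hp

/-- This combines the independence from past points, indices and weights with that from the
locations, so that the gap can be integrated out last. -/
lemma indepFun_gap_past (n : ℕ) :
    IndepFun (fun ω => gap (fun i => ξ i ω) n)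
      (fun ω => (fun i : Fin n => (ξ i ω, S i ω, W' i ω), fun i : Fin n => θ i ω)) P := by
  have h1 : IndepFun (fun ω => gap (fun i => ξ i ω) n)
      (fun ω (i : Fin n) => (ξ i ω, S i ω, W' i ω)) P :=
    ((hs.indepFun_past_gap hp n).comp (φ := id) (ψ := fun f : ℕ → ℝ => f 0) measurable_id
      (by fun_prop)).symm
  have hg := measurable_gap n
  have h2 : IndepFun (fun ω => (gap (fun i => ξ i ω) n, fun i : Fin n => (ξ i ω, S i ω, W' i ω)))
      (fun ω (i : Fin n) => θ i ω) P :=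
    (hs.indepFun_location.comp (φ := fun f : ℕ → Θ => fun i : Fin n => f i)
      (ψ := fun f : ℕ → ℝ × ℝ × ℝ => (gap (fun i => (f i).1) n, fun i : Fin n => f i))
      (by fun_prop) (by
        refine Measurable.prodMk ?_ (by fun_prop)
        exact hg.comp (f := fun (f : ℕ → ℝ × ℝ × ℝ) i => (f i).1) (by fun_prop))).symm
  exact IndepFun.assoc_right h2 h1 (hs.poissonPoints.measurable_gap n) (hs.measurable_past n)
    (hs.measurable_locations n)

/-- The law of the next time and the next atom, given the past. -/
lemma lintegral_step [IsProbabilityMeasure H] (n : ℕ)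
    {y : (Fin n → ℝ × ℝ × ℝ) × (Fin n → Θ) → ℝ≥0∞} (hy : Measurable y)
    {h : ℝ × ℝ × Θ → ℝ≥0∞} (hh : Measurable h) :
    ∫⁻ ω, y (fun i => (ξ i ω, S i ω, W' i ω), fun i => θ i ω) *
        h (scaledTime α τ β c η (ξ n ω), c * W' n ω, θ n ω) ∂P
      = ∫⁻ ω, y (fun i => (ξ i ω, S i ω, W' i ω), fun i => θ i ω) *
        (∫⁻ u in Set.Ioi (scaledTime α τ β c η (prevPoint (fun i => ξ i ω) n)),
          ∫⁻ x, h (u, x) * clockDensity ((levyMeasure (rhoMGG α τ β c η)).prod H) Prod.fst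
            (scaledTime α τ β c η (prevPoint (fun i => ξ i ω) n)) u x
            ∂(levyMeasure (rhoMGG α τ β c η)).prod H) ∂P := by
  have hst := hp.measurable_scaledTime
  have hpast := hs.measurable_past n
  have hloc := hs.measurable_locations n
  have hξn := hs.poissonPoints.measurable n
  have hWn := hs.measurable_weight n
  have hV := hpast.prodMk (hξn.prodMk hWn)
  set k : ℝ → ℝ → ℝ≥0∞ := fun x w => ∫⁻ ϑ, h (scaledTime α τ β c η x, c * w, ϑ) ∂H with hk
  have hmk : Measurable (Function.uncurry k) := by
    refine Measurable.lintegral_prod_right (f := fun (p : ℝ × ℝ) ϑ =>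
      h (scaledTime α τ β c η p.1, c * p.2, ϑ)) ?_
    simp only [Function.uncurry_def]
    fun_prop
  set κ : ℝ → ℝ≥0∞ := fun x =>
    pairIntegral α τ (c * scaledTime α τ β c η x + β) fun _ w => k x w with hκ
  have hmκ : Measurable κ := Measurable.pairIntegral (by fun_prop)
    (hmk.comp (f := fun p : ℝ × ℝ × ℝ => (p.1, p.2.2)) (by fun_prop))
  -- The location is integrated out against `H`.
  have s1 : ∫⁻ ω, y (fun i => (ξ i ω, S i ω, W' i ω), fun i => θ i ω) *
        h (scaledTime α τ β c η (ξ n ω), c * W' n ω, θ n ω) ∂P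
      = ∫⁻ ω, y (fun i => (ξ i ω, S i ω, W' i ω), fun i => θ i ω) * k (ξ n ω) (W' n ω) ∂P := by
    have e := IndepFun.lintegral_comp (hs.indepFun_location_past n).symm (hloc.prodMk hV)
      (hs.measurable_location n)
      (F := fun p => y (p.1.2.1, p.1.1) *
        h (scaledTime α τ β c η p.1.2.2.1, c * p.1.2.2.2, p.2)) (by fun_prop)
    refine e.trans (lintegral_congr fun ω => ?_)
    rw [(hs.hasLaw_location n).map_eq]
    exact lintegral_const_mul (y (fun i => (ξ i ω, S i ω, W' i ω), fun i => θ i ω))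
      (f := fun ϑ => h (scaledTime α τ β c η (ξ n ω), c * W' n ω, ϑ))
      (by fun_prop)
  -- The conditional laws of index and weight do not mention the locations; these are frozen by
  -- independence before index and weight are integrated out.
  have s2 : ∫⁻ ω, y (fun i => (ξ i ω, S i ω, W' i ω), fun i => θ i ω) * k (ξ n ω) (W' n ω) ∂P
      = ∫⁻ ω, y (fun i => (ξ i ω, S i ω, W' i ω), fun i => θ i ω) * κ (ξ n ω) ∂P := by
    have e1 := IndepFun.lintegral_comp_symm (hs.indepFun_past_locations n) hV hloc
      (F := fun p => y (p.1.1, p.2) * k p.1.2.1 p.1.2.2) (by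
        refine Measurable.mul (by fun_prop) ?_
        exact hmk.comp (f := fun p : ((Fin n → ℝ × ℝ × ℝ) × ℝ × ℝ) × (Fin n → Θ) =>
          (p.1.2.1, p.1.2.2)) (by fun_prop))
    have e2 := IndepFun.lintegral_comp_symm (hs.indepFun_past_locations n) hV hloc
      (F := fun p => y (p.1.1, p.2) * κ p.1.2.1) (by fun_prop)
    refine e1.trans (Eq.trans (lintegral_congr fun ϑ => ?_) e2.symm)
    have e3 := hs.lintegral_pair hp n (F := fun q _ w =>
      k (q.1 n) w * y (fun i => (q.1 i, q.2 i), ϑ)) (by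
        refine Measurable.mul ?_ (hy.comp (by fun_prop))
        exact hmk.comp (f := fun p : ((ℕ → ℝ) × (Fin n → ℝ × ℝ)) × ℝ × ℝ => (p.1.1 n, p.2.2))
          (by fun_prop))
    beta_reduce at e3 ⊢
    simp_rw [mul_comm (y _)]
    refine e3.trans (lintegral_congr fun ω => ?_)
    rw [pairIntegral_mul_const]
    exact hmk.comp (f := fun p : ℝ × ℝ => (ξ n ω, p.2)) (by fun_prop)
  -- The current point is the previous one plus an independent exponential gap.
  have s3 : ∫⁻ ω, y (fun i => (ξ i ω, S i ω, W' i ω), fun i => θ i ω) * κ (ξ n ω) ∂P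
      = ∫⁻ ω, y (fun i => (ξ i ω, S i ω, W' i ω), fun i => θ i ω) *
        (∫⁻ d, κ (prevPoint (fun i => ξ i ω) n + d) ∂expMeasure 1) ∂P := by
    have hl := measurable_lastPoint (A := ℝ × ℝ) n
    have e := IndepFun.lintegral_comp (hs.indepFun_gap_past hp n).symm (hpast.prodMk hloc)
      (hs.poissonPoints.measurable_gap n)
      (F := fun p => y p.1 * κ (lastPoint n p.1.1 + p.2)) (by fun_prop)
    have hlast := fun ω => lastPoint_eq (fun i => ξ i ω) (fun i => (S i ω, W' i ω)) n
    simp only [hlast, prevPoint_add_gap] at e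
    refine e.trans (lintegral_congr fun ω => ?_)
    rw [hs.poissonPoints.map_gap, lintegral_const_mul _ (by fun_prop)]
  rw [s1, s2, s3]
  refine lintegral_congr_ae ?_
  filter_upwards [hs.poissonPoints.ae_prevPoint_nonneg] with ω hω
  congr 1
  obtain ⟨h0, h1⟩ := hp.exists_scaledTime H (prevPoint (fun i => ξ i ω) n)
  rw [← hp.lintegral_expMeasure_pairIntegral H hh h0, h1, max_eq_left (hω n)]

omit hs hp [IsProbabilityMeasure P] in
lemma _root_.MixedGG.lintegral_exp_neg_expMeasure :
    ∫⁻ y, ENNReal.ofReal (Real.exp (-y)) ∂expMeasure 1 = 2⁻¹ := by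
  rw [lintegral_expMeasure_one (by fun_prop), ← lintegral_expNeg_mul two_ne_zero (by simp)]
  refine setLIntegral_congr_fun measurableSet_Ioi fun y hy => ?_
  have hy0 : (0 : ℝ) < y := hy
  rw [mul_two, expNeg_add, expNeg_ofReal hy0.le]

/-- Each of the `n + 1` independent gaps contributes a factor `E e^{-gap} = 1/2`. -/
lemma lintegral_exp_neg_point (n : ℕ) :
    ∫⁻ ω, ENNReal.ofReal (Real.exp (-ξ n ω)) ∂P = 2⁻¹ ^ (n + 1) := by
  have hind : ∀ m, ∫⁻ ω, ENNReal.ofReal (Real.exp (-ξ m ω)) ∂P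
      = (∫⁻ ω, ENNReal.ofReal (Real.exp (-prevPoint (fun i => ξ i ω) m)) ∂P) * 2⁻¹ := fun m => by
    have hl := measurable_lastPoint (A := ℝ × ℝ) m
    have e := IndepFun.lintegral_comp ((hs.indepFun_gap_past hp m).symm)
      ((hs.measurable_past m).prodMk (hs.measurable_locations m))
      (hs.poissonPoints.measurable_gap m)
      (F := fun p => ENNReal.ofReal (Real.exp (-lastPoint m p.1.1)) *
        ENNReal.ofReal (Real.exp (-p.2))) (by fun_prop)
    have hlast := fun ω => lastPoint_eq (fun i => ξ i ω) (fun i => (S i ω, W' i ω)) m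
    simp only [hlast] at e
    rw [hs.poissonPoints.map_gap] at e
    have e1 : ∀ ω, ENNReal.ofReal (Real.exp (-prevPoint (fun i => ξ i ω) m)) *
        ENNReal.ofReal (Real.exp (-gap (fun i => ξ i ω) m))
          = ENNReal.ofReal (Real.exp (-ξ m ω)) := fun ω => by
      rw [← ENNReal.ofReal_mul (Real.exp_pos _).le, ← Real.exp_add, ← neg_add, prevPoint_add_gap]
    simp_rw [e1] at e
    rw [e, ← lintegral_mul_const']
    · refine lintegral_congr fun ω => ?_
      rw [lintegral_const_mul _ (by fun_prop), lintegral_exp_neg_expMeasure]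
    · simp
  induction n with
  | zero => rw [hind]; simp [prevPoint]
  | succ n ih => rw [hind, pow_succ, ← ih]; rfl

/-- The expectations of `e^{-ξ n}` are summable, so almost surely `e^{-ξ n} → 0`. -/
lemma tendsto_points : ∀ᵐ ω ∂P, Tendsto (fun n => ξ n ω) atTop atTop := by
  have hm : ∀ n, Measurable fun ω => ENNReal.ofReal (Real.exp (-ξ n ω)) := fun n => by
    have := hs.poissonPoints.measurable n
    fun_prop
  have h : ∫⁻ ω, ∑' n, ENNReal.ofReal (Real.exp (-ξ n ω)) ∂P ≠ ∞ := by
    rw [lintegral_tsum fun n => (hm n).aemeasurable]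
    simp_rw [hs.lintegral_exp_neg_point hp]
    rw [ENNReal.tsum_geometric_add_one]
    simp
  filter_upwards [ae_lt_top (Measurable.tsum hm) h] with ω hω
  have h1 := ENNReal.tendsto_atTop_zero_of_tsum_ne_top hω.ne
  have h2 := (ENNReal.tendsto_toReal ENNReal.zero_ne_top).comp h1
  simp only [Function.comp_def, ENNReal.toReal_ofReal (Real.exp_pos _).le,
    ENNReal.toReal_zero] at h2
  have h3 := Real.tendsto_exp_comp_nhds_zero.1 h2
  simpa [Function.comp_def] using tendsto_neg_atBot_atTop.comp h3

omit hp [IsProbabilityMeasure P] in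
lemma measurable_history (n : ℕ) : Measurable fun ω =>
    (fun i : Fin n => (ξ i ω, S i ω, W' i ω), fun i : Fin n => θ i ω) :=
  (hs.measurable_past n).prodMk (hs.measurable_locations n)

omit hp [IsProbabilityMeasure P] in
/-- The σ-algebras generated by the first points, indices, weights and locations. -/
@[reducible] def history : Filtration ℕ ‹MeasurableSpace Ω› where
  seq n := MeasurableSpace.comap (fun ω =>
    (fun i : Fin n => (ξ i ω, S i ω, W' i ω), fun i : Fin n => θ i ω)) inferInstance
  mono' m n hmn := by
    refine Measurable.comap_le ?_
    have hg : Measurable fun q : (Fin n → ℝ × ℝ × ℝ) × (Fin n → Θ) =>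
        (fun i : Fin m => q.1 (Fin.castLE hmn i), fun i : Fin m => q.2 (Fin.castLE hmn i)) := by
      fun_prop
    exact hg.comp (comap_measurable _)
  le' n := (hs.measurable_history n).comap_le

/-- The sampling scheme is a size-biased chain. -/
lemma isSizeBiasedChain [IsProbabilityMeasure H] :
    IsSizeBiasedChain P hs.history ((levyMeasure (rhoMGG α τ β c η)).prod H) Prod.fst
      (fun n ω => scaledTime α τ β c η (prevPoint (fun i => ξ i ω) n))
      (fun n ω => (c * W' n ω, θ n ω)) where
  measurable_time n := by
    have hst := hp.measurable_scaledTime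
    have hl := measurable_lastPoint (A := ℝ × ℝ) n
    have hg : Measurable fun q : (Fin n → ℝ × ℝ × ℝ) × (Fin n → Θ) =>
        scaledTime α τ β c η (lastPoint n q.1) := by fun_prop
    have h := hg.comp (comap_measurable (fun ω =>
      (fun i : Fin n => (ξ i ω, S i ω, W' i ω), fun i : Fin n => θ i ω)))
    have hlast := fun ω => lastPoint_eq (fun i => ξ i ω) (fun i => (S i ω, W' i ω)) n
    simpa only [Function.comp_def, hlast] using h
  measurable_mark n := by
    have hg : Measurable fun q : (Fin (n + 1) → ℝ × ℝ × ℝ) × (Fin (n + 1) → Θ) =>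
        (c * (q.1 (Fin.last n)).2.2, q.2 (Fin.last n)) := by fun_prop
    exact hg.comp (comap_measurable (fun ω =>
      (fun i : Fin (n + 1) => (ξ i ω, S i ω, W' i ω), fun i : Fin (n + 1) => θ i ω)))
  time_zero ω := hp.scaledTime_zero
  time_nonneg n := ae_of_all _ fun ω => hp.scaledTime_nonneg _
  tendsto_time := by
    filter_upwards [hs.tendsto_points hp] with ω hω
    refine hp.tendsto_scaledTime.comp ?_
    -- The chain starts from time `0`, so its time of index `n + 1` belongs to the point `ξ n`.
    rw [← tendsto_add_atTop_iff_nat 1]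
    exact hω
  lintegral_step n Y hY h hh := by
    -- A variable measurable for the history is a measurable function of it.
    obtain ⟨y, hy, rfl⟩ := hY.exists_eq_measurable_comp
    exact hs.lintegral_step hp n hy hh

end IsSamplingScheme

end MixedGG
-- Conclusion: the chain of the sampling scheme carries all three assertions
theorem proposition3 {Ω Θ : Type*} [MeasurableSpace Ω]
    [TopologicalSpace Θ] [PolishSpace Θ] [MeasurableSpace Θ] [BorelSpace Θ]
    (P : Measure Ω) [IsProbabilityMeasure P] (H : Measure Θ) [IsProbabilityMeasure H]
    (α τ β c η : ℝ) (hτ : 0 ≤ τ) (hτα : τ < α) (hα : α ≤ 1)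
    (hβ : 0 ≤ β) (hc : 0 < c) (hη : 0 < η)
    (ξ S W' : ℕ → Ω → ℝ) (θ : ℕ → Ω → Θ)
    (hscheme : MixedGG.IsSamplingScheme P α τ β η H ξ S W' θ)
    (W : ℕ → Ω → ℝ) (hW : ∀ j ω, W j ω = c * W' j ω) :
    MixedGG.IsCRM P (MixedGG.rhoMGG α τ β c η) H (MixedGG.discreteMeasure W θ) ∧
    MixedGG.IsPoissonRandomMeasure P (MixedGG.pointMeasure W θ)
      ((MixedGG.levyMeasure (MixedGG.rhoMGG α τ β c η)).prod H) ∧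
    MixedGG.IsSizeBiasedOrder P W θ := by
  have hp : MixedGG.IsMGGParam α τ β c η := ⟨hτ, hτα, hα, hβ, hc, hη⟩
  have hw := hp.isLaplaceWeight H
  have hchain := hscheme.isSizeBiasedChain hp
  obtain rfl : W = fun j ω => c * W' j ω := funext fun j => funext fun ω => hW j ω
  have hprm := hchain.isPoissonRandomMeasure hw
  refine ⟨⟨hp.isLevyIntensity, _, hprm, ae_of_all _ fun ω => ?_⟩, hprm, ?_, ?_, ?_, ?_, ?_⟩
  -- Integrating the weight against the point measure returns `∑ W_j δ_{θ_j}`, for every outcome.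
  · refine Measure.ext fun B hB => ?_
    rw [Measure.map_apply measurable_snd hB, withDensity_apply _ (measurable_snd hB),
      ← lintegral_indicator (measurable_snd hB), MixedGG.lintegral_sum_dirac
      (Measurable.indicator (by fun_prop) (measurable_snd hB)), MixedGG.discreteMeasure,
      Measure.sum_apply _ hB]
    refine tsum_congr fun j => ?_
    by_cases h : θ j ω ∈ B <;> simp [hB, h]
  · exact fun j => (hscheme.measurable_weight j).const_mul c
  · exact hscheme.measurable_location
  · exact hchain.ae_weight_pos hw.measurable
  · exact hchain.ae_tsum_weight_lt_top hw
  · exact hchain.hasConditionalLaw hw
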